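/- Let $t\ge 0$ and $N\ge 1$ be integers with $t\le N$, and let $\tau\in S_t$. A *unitary diagram* with target permutation $\tau$ is an orientable ribbon graph (a map, not necessarily connected) such that 1. it has exactly $2t$ vertices of degree 1 (the *leaves*), labelled bijectively by $1,\dots,t,\bar 1,\dots,\bar t$; all other (*internal*) vertices have even degree greater than $2$; 2. each part of its boundary lies on exactly one boundary segment running from a leaf to the next leaf along the boundary; these segments are $j\to\bar j$ (marked solid) and $\tau(j)\to\bar j$ (marked dashed) for $j=1,\dots,t$; each edge is marked solid on one side and dashed on the other side, both running in the same direction. Let $D^{U}_{v,e}(\tau)$ be the number of isomorphism classes of unitary diagrams with target permutation $\tau$, with $v$ internal vertices and $e$ edges (those leading to leaves included). Let $V^{U}_N(\tau)$ be the CUE class coefficient (Weingarten function) $$V^{U}_N(\tau)=\int_{U(N)}\prod_{k=1}^t U_{k,k}\,\overline{U_{k,\tau^{-1}(k)}}\;dU ,$$ where $dU$ is the Haar probability measure; it is the coefficient in the expansion of averages over $U(N)$, $$\Big\langle \prod_{k=1}^tU_{a_k a_{\bar k}}\,\overline{U_{b_k b_{\bar k}}}\Big\rangle=\sum_{\sigma,\pi\in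 S_t}V^{U}_N(\sigma^{-1}\pi)\prod_{k=1}^t\delta_{a_k,b_{\sigma(k)}}\,\delta_{a_{\bar k},b_{\overline{\pi(k)}}}.$$ Then $D^U_{v,e}(\tau)\ne0$ implies $v\le e$; for every $m\ge 0$ only finitely many pairs $(v,e)$ with $e-v=m$ have $D^U_{v,e}(\tau)\neq 0$; and, summing in the order of the powers of $1/N$, $$\sum_{v,e}D^{U}_{v,e}(\tau)\frac{(-1)^v}{N^{e-v}}:=\sum_{m\ge0}\frac1{N^m}\Big(\sum_{v}(-1)^vD^{U}_{v,v+m}(\tau)\Big)=V^{U}_N(\tau),$$ where the series over $m$ converges absolutely. -/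

import Mathlib

/-! ## Ribbon graphs

A ribbon graph (map on an oriented, possibly disconnected surface) is given by its half-edges,
the involution exchanging the two halves of every edge, and the rotation of the half-edges around
the vertices. The edges, vertices and boundary walks are the orbits of `edge`, `rot` and `walk`. -/

/-- A ribbon graph with set of half-edges `H`. -/
structure RibbonGraph (H : Type) where
  /-- the other half of the same edge -/
  edge : Equiv.Perm H
  /-- the next half-edge, in clockwise order, at the same vertex -/
  rot : Equiv.Perm H
  edge_edge : ∀ h, edge (edge h) = h
  edge_ne : ∀ h, edge h ≠ h

namespace RibbonGraph

variable {H : Type}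

/-- Every edge has two sides. The half-edge `h` also stands for the left-hand side of its edge, as
seen when leaving the vertex of `h` along the edge; so `h` and `edge h` are the two sides of one
edge. Following the boundary along the side `h`, one arrives at the vertex of `edge h` and goes on
along the left-hand side of the next edge there in clockwise order. -/
def walk (G : RibbonGraph H) : Equiv.Perm H := G.rot * G.edge

/-- Let `L` be the set of half-edges at the leaves. The portion of the boundary that starts at the
leaf with half-edge `x` and runs to the next leaf ends at the leaf with half-edge `y`, and all
the sides of edges that it passes along belong to `S`. -/
def IsBoundarySegment (G : RibbonGraph H) (L S : Set H) (x y : H) : Prop :=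
  x ∈ L ∧ y ∈ L ∧ ∃ k : ℕ, 0 < k ∧ (G.walk ^ k) x = y ∧
    (∀ i : ℕ, 0 < i → i < k → (G.walk ^ i) x ∉ L) ∧ ∀ i : ℕ, i < k → (G.walk ^ i) x ∈ S

end RibbonGraph

/-! ## Unitary diagrams -/

/-- A unitary diagram with target permutation `τ` of `{1, …, t}` and set of half-edges `H`. The
label `Sum.inl j` stands for `j`, and `Sum.inr j` for `j` with a bar. The surface is oriented so
that a solid segment `j → j̄` has its edges on its right, that is, it follows the boundary walk.
A dashed segment `τ(j) → j̄` then has its edges on its left and follows the boundary walk backwards,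
that is, the walk runs along it from `j̄` to `τ(j)`; solid and dashed marks on the two sides of
an edge therefore run in the same direction. -/
structure UnitaryDiagram (H : Type) [Fintype H] [DecidableEq H] {t : ℕ}
    (τ : Equiv.Perm (Fin t)) extends RibbonGraph H where
  /-- the half-edge at the leaf with the given label -/
  leaf : Fin t ⊕ Fin t → H
  leaf_injective : Function.Injective leaf
  /-- the vertices of degree 1 are exactly the labelled ones -/
  rot_eq_self_iff : ∀ h, rot h = h ↔ h ∈ Set.range leaf
  /-- the degrees of all other vertices are even and greater than 2 -/
  internal_degree : ∀ d ∈ rot.cycleType, Even d ∧ 2 < d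
  /-- the sides that are marked solid; the other ones are marked dashed -/
  solid : Set H
  solid_segment : ∀ j, toRibbonGraph.IsBoundarySegment (Set.range leaf) solid
    (leaf (Sum.inl j)) (leaf (Sum.inr j))
  dashed_segment : ∀ j, toRibbonGraph.IsBoundarySegment (Set.range leaf) solidᶜ
    (leaf (Sum.inr j)) (leaf (Sum.inl (τ j)))
  /-- every part of the boundary lies on a segment that starts at a leaf -/
  marked : ∀ h, ∃ z, ∃ n : ℕ, (toRibbonGraph.walk ^ n) (leaf z) = h
  /-- every edge is solid on one side and dashed on the other -/
  two_sides : ∀ h, edge h ∈ solid ↔ h ∉ solid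

namespace UnitaryDiagram

variable {H : Type} [Fintype H] [DecidableEq H] {t : ℕ} {τ : Equiv.Perm (Fin t)}

/-- The number of internal vertices: they are the vertices of degree at least two, that is, the
nontrivial cycles of the rotation. -/
def internalVertices (d : UnitaryDiagram H τ) : ℕ := d.rot.cycleType.card

/-- Isomorphism of diagrams: a relabelling of the half-edges that respects the whole structure,
the labels of the leaves included. -/
def Iso (d d' : UnitaryDiagram H τ) : Prop :=
  ∃ f : Equiv.Perm H, (∀ h, f (d.edge h) = d'.edge (f h)) ∧ (∀ h, f (d.rot h) = d'.rot (f h)) ∧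
    (∀ z, f (d.leaf z) = d'.leaf z) ∧ ∀ h, h ∈ d.solid ↔ f h ∈ d'.solid

variable (H τ) in
/-- Isomorphism as an equivalence relation. -/
def isoSetoid : Setoid (UnitaryDiagram H τ) where
  r := Iso
  iseqv := by
    refine ⟨fun d => ⟨1, by simp⟩, ?_, ?_⟩
    · rintro d d' ⟨f, h1, h2, h3, h4⟩
      refine ⟨f.symm, fun h => ?_, fun h => ?_, fun z => ?_, fun h => ?_⟩
      · rw [Equiv.symm_apply_eq, h1, Equiv.apply_symm_apply]
      · rw [Equiv.symm_apply_eq, h2, Equiv.apply_symm_apply]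
      · rw [Equiv.symm_apply_eq, h3]
      · rw [h4, Equiv.apply_symm_apply]
    · rintro d d' d'' ⟨f, h1, h2, h3, h4⟩ ⟨g, k1, k2, k3, k4⟩
      exact ⟨f.trans g, fun h => by simp [h1, k1], fun h => by simp [h2, k2],
        fun z => by simp [h3, k3], fun h => by simp [h4, k4]⟩

/-- There are only finitely many diagrams on a given finite set of half-edges. -/
theorem finite : Finite (UnitaryDiagram H τ) := by
  refine Finite.of_injective (β := Equiv.Perm H × Equiv.Perm H × (Fin t ⊕ Fin t → H) × Set H)
    (fun d => (d.edge, d.rot, d.leaf, d.solid)) ?_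
  rintro ⟨⟨_, _, _, _⟩, _, _, _, _, _, _, _, _, _⟩ ⟨⟨_, _, _, _⟩, _, _, _, _, _, _, _, _, _⟩ h
  simp only [Prod.mk.injEq] at h
  obtain ⟨rfl, rfl, rfl, rfl⟩ := h
  rfl

end UnitaryDiagram

/-- The number of unitary diagrams, up to isomorphism, with target permutation `τ`, with `v`
internal vertices and `e` edges (that is, `2 * e` half-edges). -/
noncomputable def numUnitaryDiagrams (v e : ℕ) {t : ℕ} (τ : Equiv.Perm (Fin t)) : ℕ :=
  (Quotient.mk (UnitaryDiagram.isoSetoid (Fin (2 * e)) τ) ''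
    {d : UnitaryDiagram (Fin (2 * e)) τ | d.internalVertices = v}).ncard

/-- The sum of the signs `(-1) ^ v` of all the unitary diagrams with target permutation `τ` that
contribute at the order `N ^ (-m)`, where `m = e - v`. -/
noncomputable def unitaryOrderCoeff {t : ℕ} (τ : Equiv.Perm (Fin t)) (m : ℕ) : ℤ :=
  ∑ᶠ v : ℕ, (numUnitaryDiagrams v (v + m) τ : ℤ) * (-1) ^ v

/-! ## The circular unitary ensemble -/

namespace CUE

noncomputable instance measurableSpaceUnitary (N : ℕ) : MeasurableSpace (Matrix.unitaryGroup (Fin N) ℂ) :=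
  borel _

instance borelSpaceUnitary (N : ℕ) : BorelSpace (Matrix.unitaryGroup (Fin N) ℂ) := ⟨rfl⟩

instance compactSpaceUnitary (N : ℕ) : CompactSpace (Matrix.unitaryGroup (Fin N) ℂ) := by
  have hK : IsCompact (Set.univ.pi fun _ : Fin N => Set.univ.pi fun _ : Fin N =>
      Metric.closedBall (0 : ℂ) 1) :=
    isCompact_univ_pi fun _ => isCompact_univ_pi fun _ => isCompact_closedBall _ _
  have hc : IsClosed (Matrix.unitaryGroup (Fin N) ℂ : Set (Matrix (Fin N) (Fin N) ℂ)) :=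
    isClosed_unitary
  exact isCompact_iff_compactSpace.mp (hK.of_isClosed_subset hc fun U hU i _ j _ => by
    simpa using entry_norm_bound_of_unitary hU i j)

/-- The circular unitary ensemble: the Haar measure of `U(N)` with total mass one. -/
noncomputable def haar (N : ℕ) : MeasureTheory.Measure (Matrix.unitaryGroup (Fin N) ℂ) :=
  MeasureTheory.Measure.haarMeasure ⊤

/-- The average of the product of the `U (a k) (a' k)` and the conjugates of the `U (b k) (b' k)`,
for `U` in the circular unitary ensemble. -/
noncomputable def average {N s t : ℕ} (a a' : Fin s → Fin N) (b b' : Fin t → Fin N) : ℂ :=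
  ∫ U : Matrix.unitaryGroup (Fin N) ℂ,
    (∏ k, (U : Matrix (Fin N) (Fin N) ℂ) (a k) (a' k)) *
      ∏ k, (starRingEnd ℂ) ((U : Matrix (Fin N) (Fin N) ℂ) (b k) (b' k)) ∂(haar N)

/-- The CUE class coefficient (Weingarten function) of a permutation `τ` of `{1, …, t}`, where
`t ≤ N`: the average of `U 1 1 ⋯ U t t` times the conjugate of
`U 1 (τ⁻¹ 1) ⋯ U t (τ⁻¹ t)`. -/
noncomputable def classCoeff {N t : ℕ} (ht : t ≤ N) (τ : Equiv.Perm (Fin t)) : ℂ :=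
  average (Fin.castLE ht) (Fin.castLE ht) (Fin.castLE ht) (fun k => Fin.castLE ht (τ⁻¹ k))

/-- The class coefficients are the only possible coefficients in the expansion of all averages of
products of `t` matrix elements and `t` conjugate matrix elements as sums over pairs of
permutations that match the indices. -/
theorem eq_classCoeff_of_expansion {N t : ℕ} (ht : t ≤ N) (V : Equiv.Perm (Fin t) → ℂ)
    (hV : ∀ a a' b b' : Fin t → Fin N, average a a' b b' =
      ∑ σ : Equiv.Perm (Fin t), ∑ π : Equiv.Perm (Fin t), V (σ⁻¹ * π) *
        ∏ k, (if a k = b (σ k) then 1 else 0) * (if a' k = b' (π k) then 1 else 0)) :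
    V = classCoeff ht := by
  funext τ
  rw [classCoeff, hV, Finset.sum_eq_single 1, Finset.sum_eq_single τ]
  · simp
  · intro π _ hπ
    obtain ⟨k, hk⟩ : ∃ k, k ≠ τ⁻¹ (π k) := by
      by_contra! h
      exact hπ (Equiv.ext fun k => by conv_rhs => rw [h k]
                                      simp)
    rw [Finset.prod_eq_zero (Finset.mem_univ k), mul_zero]
    rw [if_neg (c := _ = Fin.castLE ht (τ⁻¹ (π k))), mul_zero]
    exact fun h => hk (Fin.castLE_injective ht h)
  · simp
  · intro σ _ hσ
    obtain ⟨k, hk⟩ : ∃ k, k ≠ σ k := by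
      by_contra! h
      exact hσ (Equiv.ext fun k => (h k).symm)
    refine Finset.sum_eq_zero fun π _ => ?_
    rw [Finset.prod_eq_zero (Finset.mem_univ k), mul_zero]
    rw [if_neg (c := Fin.castLE ht k = Fin.castLE ht (σ k)), zero_mul]
    exact fun h => hk (Fin.castLE_injective ht h)
  · simp

end CUE

/-!
Both sides satisfy the same recursion in the number of leaves, and the recursion determines them.

A unitary diagram amounts to a pair of permutations of its edges (`PermPair`): `solid` leads from an
edge to the next one along its solid side, `dashed` to the next one along its dashed side. Closed up
at the leaves, each of the two has one cycle for each boundary segment of its kind, and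
`dashed * solid⁻¹` is the target permutation on the edges at the leaves and goes around the internal
vertices on the other edges (`numUnitaryDiagrams_eq`). Every internal vertex of a diagram with `n`
inner edges has two outgoing edges or more, so `2 * v ≤ n`; this gives the first two assertions.

For the recursion, fix a leaf `t` and look at the internal vertex next to it. If its degree is more
than four, a vertex of degree four can be split off that carries the leaf `t` and, opposite to it,
the new edge; conversely, the edge opposite to `t` at a vertex of degree four can be contracted if
it does not lead to a leaf. This changes the numbers of vertices and edges by one each and hence
flips the sign at a fixed order in `1 / N`, so these diagrams cancel (`numClasses_contractible`,
`signedCount_cancel`). There remain the diagrams in which `t` is directly connected to its partner,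
and those in which another leaf `j` is opposite to `t` at a vertex of degree four. Such a vertex can
be removed, whereby the target permutation is multiplied by the transposition of `t` and `j`
(`numClasses_tied`). The result is `PermPair.signedCount_succ`.

The class coefficients satisfy the corresponding relation `CUE.coeff_recursion`, which follows from
the orthonormality of the columns of a unitary matrix and from the invariance of the Haar measure
under the unitary reflections of two rows (`CUE.mean_coincident_rows`). As there are at most `N`
leaves, the relation is a linear system that is diagonally dominant: it has one solution, namely its
absolutely convergent Neumann series, whose terms are the signed numbers of diagrams
(`CUE.hasSum_diagramCoeff`).
-/

/-! ### Cycles of permutations and multiplication by a transposition -/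

section Cycles

open Equiv

variable {Ω : Type*}

/-- An equivalence relation that holds between every point and its image holds between any two
points of a common cycle. -/
theorem sameCycle_induction {σ : Perm Ω} {R : Ω → Ω → Prop} (hR : Equivalence R)
    (h : ∀ w, R w (σ w)) {u v : Ω} (huv : σ.SameCycle u v) : R u v := by
  obtain ⟨n, rfl⟩ := huv
  induction n using Int.induction_on with
  | zero => exact hR.refl _
  | succ n ih =>
    rw [add_comm, zpow_add, zpow_one, Perm.mul_apply]
    exact hR.trans ih (h _)
  | pred n ih =>
    rw [sub_eq_neg_add, zpow_add, zpow_neg_one, Perm.mul_apply]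
    refine hR.trans ih (hR.symm ?_)
    simpa using h (σ⁻¹ ((σ ^ (-(n : ℤ))) u))

theorem sameCycle_equivalence (σ : Perm Ω) : Equivalence σ.SameCycle :=
  ⟨Perm.SameCycle.refl σ, fun h => h.symm, fun h h' => h.trans h'⟩

theorem sameCycle_self_apply (σ : Perm Ω) (w : Ω) : σ.SameCycle w (σ w) := ⟨1, by simp⟩

/-- The version of `sameCycle_induction` for a map that intertwines two permutations up to
cycles. -/
theorem SameCycle.map_of_step {Ω' : Type*} {σ : Perm Ω} {σ' : Perm Ω'} (f : Ω → Ω')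
    (h : ∀ w, σ'.SameCycle (f w) (f (σ w))) {u v : Ω} (huv : σ.SameCycle u v) :
    σ'.SameCycle (f u) (f v) :=
  sameCycle_induction (R := fun a b => σ'.SameCycle (f a) (f b))
    ⟨fun _ => Perm.SameCycle.refl _ _, fun h => h.symm, fun h h' => h.trans h'⟩ h huv

variable [DecidableEq Ω]

/-- Inserting a fixed point `x` of `σ` into a cycle of `σ`, just before `y`, does not change which
of the other points lie on a common cycle. -/
theorem sameCycle_swap_mul_iff {σ : Perm Ω} {x y u v : Ω} (hx : σ x = x) (hy : y ≠ x)
    (hu : u ≠ x) (hv : v ≠ x) : (swap x y * σ).SameCycle u v ↔ σ.SameCycle u v := by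
  have hxu : ∀ w, w ≠ x → σ w ≠ x := fun w hw h => hw (σ.injective (h.trans hx.symm))
  constructor
  · intro h
    have := SameCycle.map_of_step (σ' := σ) (fun w => if w = x then y else w) ?_ h
    · simpa [hu, hv] using this
    · intro w
      by_cases hw : w = x
      · subst hw
        simp [hx, Perm.SameCycle.refl]
      · by_cases hwy : σ w = y
        · simp [hw, hwy]
          rw [← hwy]
          exact sameCycle_self_apply σ w
        · simp [hw, swap_apply_of_ne_of_ne (hxu w hw) hwy, hxu w hw, Perm.SameCycle.refl]
  · intro h
    have key : ∀ w, (swap x y * σ).SameCycle w (σ w) := by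
      intro w
      by_cases hw : w = x
      · rw [hw, hx]
      · by_cases hwy : σ w = y
        · refine ⟨2, ?_⟩
          simp [zpow_ofNat, pow_succ, hwy, hx]
        · refine ⟨1, ?_⟩
          simp [swap_apply_of_ne_of_ne (hxu w hw) hwy]
    exact sameCycle_induction (sameCycle_equivalence _) key h

theorem sameCycle_mul_swap_iff {σ : Perm Ω} {x y u v : Ω} (hx : σ x = x) (hy : y ≠ x)
    (hu : u ≠ x) (hv : v ≠ x) : (σ * swap x y).SameCycle u v ↔ σ.SameCycle u v := by
  rw [mul_swap_eq_swap_mul, hx]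
  exact sameCycle_swap_mul_iff hx (fun h => hy (σ.injective (h.trans hx.symm))) hu hv

omit [DecidableEq Ω] in
theorem sameCycle_conj_iff {σ g : Perm Ω} {u v : Ω} :
    (g * σ * g⁻¹).SameCycle (g u) (g v) ↔ σ.SameCycle u v := by
  rw [Perm.sameCycle_conj]; simp

/-- The number of cycles of `σ` that meet `A`. -/
noncomputable def numCycles (σ : Perm Ω) (A : Finset Ω) : ℕ := by
  classical exact (A.image fun x => {z | σ.SameCycle x z}).card

omit [DecidableEq Ω] in
theorem setOf_sameCycle_eq_iff {σ : Perm Ω} {x y : Ω} :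
    {z | σ.SameCycle x z} = {z | σ.SameCycle y z} ↔ σ.SameCycle x y := by
  constructor
  · intro h
    exact (h.symm.subset (Perm.SameCycle.refl σ y : y ∈ {z | σ.SameCycle y z}))
  · intro h
    ext z
    exact ⟨fun h' => h.symm.trans h', fun h' => h.trans h'⟩

theorem card_image_congr {ι ι' κ κ' : Type*} [DecidableEq κ] [DecidableEq κ'] {A : Finset ι}
    {A' : Finset ι'} {f : ι → κ} {f' : ι' → κ'} (g : ι → ι') (hg : ∀ x ∈ A, g x ∈ A')
    (hs : ∀ y ∈ A', ∃ x ∈ A, f' (g x) = f' y)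
    (h : ∀ x ∈ A, ∀ y ∈ A, f x = f y ↔ f' (g x) = f' (g y)) :
    (A.image f).card = (A'.image f').card := by
  have hex : ∀ k ∈ A.image f, ∃ x ∈ A, f x = k := by simp
  choose r hrA hr using hex
  refine Finset.card_bij (fun k hk => f' (g (r k hk))) ?_ ?_ ?_
  · intro k hk
    exact Finset.mem_image_of_mem _ (hg _ (hrA k hk))
  · intro k hk k' hk' e
    exact (hr k hk).symm.trans (((h _ (hrA k hk) _ (hrA k' hk')).mpr e).trans (hr k' hk'))
  · intro k' hk'
    obtain ⟨y, hy, rfl⟩ := Finset.mem_image.mp hk'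
    obtain ⟨x, hx, hxy⟩ := hs y hy
    have hk := Finset.mem_image_of_mem f hx
    refine ⟨f x, hk, ?_⟩
    exact ((h _ (hrA _ hk) _ hx).mp (hr _ hk)).trans hxy

omit [DecidableEq Ω] in
theorem numCycles_congr {Ω' : Type*} {σ : Perm Ω} {σ' : Perm Ω'} {A : Finset Ω}
    {A' : Finset Ω'} (g : Ω → Ω') (hg : ∀ x ∈ A, g x ∈ A')
    (hs : ∀ y ∈ A', ∃ x ∈ A, σ'.SameCycle (g x) y)
    (h : ∀ x ∈ A, ∀ y ∈ A, σ.SameCycle x y ↔ σ'.SameCycle (g x) (g y)) :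
    numCycles σ A = numCycles σ' A' := by
  classical
  refine card_image_congr g hg (fun y hy => ?_) fun x hx y hy => ?_
  · obtain ⟨x, hx, h⟩ := hs y hy
    exact ⟨x, hx, setOf_sameCycle_eq_iff.mpr h⟩
  · rw [setOf_sameCycle_eq_iff, setOf_sameCycle_eq_iff, h x hx y hy]

theorem numCycles_conj (σ g : Perm Ω) (A : Finset Ω) :
    numCycles (g * σ * g⁻¹) (A.image g) = numCycles σ A := by
  refine (numCycles_congr g (fun x hx => Finset.mem_image_of_mem _ hx) (fun y hy => ?_)
    fun x _ y _ => sameCycle_conj_iff.symm).symm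
  obtain ⟨x, hx, rfl⟩ := Finset.mem_image.mp hy
  exact ⟨x, hx, Perm.SameCycle.refl _ _⟩

theorem numCycles_insert_of_fixed {σ : Perm Ω} {A : Finset Ω} {x : Ω} (hx : σ x = x)
    (hxA : x ∉ A) : numCycles σ (insert x A) = numCycles σ A + 1 := by
  classical
  unfold numCycles
  rw [Finset.image_insert, Finset.card_insert_of_notMem]
  intro h
  obtain ⟨y, hy, hyx⟩ := Finset.mem_image.mp h
  have h2 : σ.SameCycle y x := setOf_sameCycle_eq_iff.mp hyx
  exact hxA ((h2.eq_of_right hx) ▸ hy)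

theorem numCycles_mul_swap_insert {σ : Perm Ω} {A : Finset Ω} {x y : Ω} (hx : σ x = x)
    (hxA : x ∉ A) (hy : y ∈ A) : numCycles (σ * swap x y) (insert x A) = numCycles σ A := by
  have hyx : y ≠ x := fun h => hxA (h ▸ hy)
  refine (numCycles_congr id (fun z hz => Finset.mem_insert_of_mem hz) (fun z hz => ?_)
    fun z hz w hw => ?_).symm
  · rcases Finset.mem_insert.mp hz with rfl | hz
    · exact ⟨y, hy, 1, by simp [hx]⟩
    · exact ⟨z, hz, Perm.SameCycle.refl _ _⟩
  · exact (sameCycle_mul_swap_iff hx hyx (fun h => hxA (h ▸ hz)) (fun h => hxA (h ▸ hw))).symm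

theorem sameCycle_of_eqOn {σ σ' : Perm Ω} {A : Finset Ω} (h : ∀ x ∈ A, σ x = σ' x)
    (hA : ∀ x ∈ A, σ x ∈ A) {x y : Ω} (hx : x ∈ A) (hxy : σ.SameCycle x y) :
    σ'.SameCycle x y := by
  have hA' : ∀ x, x ∈ A ↔ σ x ∈ A := by
    intro x
    refine ⟨hA x, fun hx => ?_⟩
    have : A.image σ = A := Finset.eq_of_subset_of_card_le
      (fun z hz => by obtain ⟨w, hw, rfl⟩ := Finset.mem_image.mp hz; exact hA w hw)
      (by rw [Finset.card_image_of_injective _ σ.injective])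
    rw [← this] at hx
    obtain ⟨w, hw, hwx⟩ := Finset.mem_image.mp hx
    exact σ.injective hwx ▸ hw
  refine (sameCycle_induction (R := fun a b => (a ∈ A ↔ b ∈ A) ∧ (a ∈ A → σ'.SameCycle a b))
    ⟨fun a => ⟨Iff.rfl, fun _ => Perm.SameCycle.refl _ _⟩,
      fun h => ⟨h.1.symm, fun hb => (h.2 (h.1.mpr hb)).symm⟩,
      fun h h' => ⟨h.1.trans h'.1, fun ha => (h.2 ha).trans (h'.2 (h.1.mp ha))⟩⟩ ?_ hxy).2 hx
  intro w
  refine ⟨hA' w, fun hw => ?_⟩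
  rw [h w hw]
  exact sameCycle_self_apply σ' w

theorem numCycles_eqOn {σ σ' : Perm Ω} {A : Finset Ω} (h : ∀ x ∈ A, σ x = σ' x)
    (hA : ∀ x ∈ A, σ x ∈ A) : numCycles σ A = numCycles σ' A := by
  refine numCycles_congr id (fun z hz => hz) (fun z hz => ⟨z, hz, Perm.SameCycle.refl _ _⟩)
    fun z hz w hw => ⟨sameCycle_of_eqOn h hA hz, sameCycle_of_eqOn (fun x hx => (h x hx).symm)
      (fun x hx => h x hx ▸ hA x hx) hz⟩

theorem two_mul_numCycles_le {σ : Perm Ω} {A : Finset Ω} (hA : ∀ x ∈ A, σ x ∈ A)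
    (h : ∀ x ∈ A, σ x ≠ x) : 2 * numCycles σ A ≤ A.card := by
  classical
  unfold numCycles
  refine Finset.mul_card_image_le_card_of_maps_to (f := fun x => {z | σ.SameCycle x z})
    (fun x hx => Finset.mem_image_of_mem (fun x => {z | σ.SameCycle x z}) hx) 2 ?_
  intro c hc
  obtain ⟨x, hx, rfl⟩ := Finset.mem_image.mp hc
  rw [← Finset.card_pair (h x hx).symm]
  refine Finset.card_le_card ?_
  intro y hy
  rw [Finset.mem_filter, setOf_sameCycle_eq_iff]
  rcases Finset.mem_insert.mp hy with rfl | hy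
  · exact ⟨hx, Perm.SameCycle.refl _ _⟩
  · rw [Finset.mem_singleton.mp hy]
    exact ⟨hA x hx, (sameCycle_self_apply σ x).symm⟩

end Cycles

/-! ### Counting isomorphism classes -/

section Classes

/-- A correspondence `R` between `P` and `Q` that respects and reflects equivalence induces a
bijection of the sets of equivalence classes. -/
theorem ncard_classes_eq {A B : Type*} (r : Setoid A) (s : Setoid B) {P : Set A} {Q : Set B}
    (R : A → B → Prop) (hP : ∀ p ∈ P, ∃ q ∈ Q, R p q) (hQ : ∀ q ∈ Q, ∃ p ∈ P, R p q)
    (h : ∀ p ∈ P, ∀ q ∈ Q, ∀ p' ∈ P, ∀ q' ∈ Q, R p q → R p' q' → (r p p' ↔ s q q')) :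
    (Quotient.mk r '' P).ncard = (Quotient.mk s '' Q).ncard := by
  have hex : ∀ k ∈ Quotient.mk r '' P, ∃ p ∈ P, Quotient.mk r p = k := fun k hk => hk
  choose a haP hak using hex
  choose b hbQ hab using hP
  refine Set.ncard_congr (fun k hk => Quotient.mk s (b (a k hk) (haP k hk))) ?_ ?_ ?_
  · intro k hk
    exact ⟨_, hbQ _ _, rfl⟩
  · intro k k' hk hk' e
    have := (h _ (haP k hk) _ (hbQ _ _) _ (haP k' hk') _ (hbQ _ _) (hab _ _) (hab _ _)).mpr
      (Quotient.exact e)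
    rw [← hak k hk, ← hak k' hk']
    exact Quotient.sound this
  · rintro _ ⟨q, hq, rfl⟩
    obtain ⟨p, hp, hpq⟩ := hQ q hq
    have hk : Quotient.mk r p ∈ Quotient.mk r '' P := ⟨p, hp, rfl⟩
    refine ⟨_, hk, Quotient.sound ?_⟩
    exact (h _ (haP _ hk) _ (hbQ _ _) p hp q hq (hab _ _) hpq).mp (Quotient.exact (hak _ hk))

theorem ncard_classes_add {A : Type*} (r : Setoid A) {P : Set A} (Q : A → Prop)
    (hfin : (Quotient.mk r '' P).Finite) (hQ : ∀ p q, r p q → Q p → Q q) :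
    (Quotient.mk r '' P).ncard = (Quotient.mk r '' {p | p ∈ P ∧ Q p}).ncard +
      (Quotient.mk r '' {p | p ∈ P ∧ ¬ Q p}).ncard := by
  rw [← Set.ncard_union_eq ?_ (hfin.subset (Set.image_mono fun p hp => hp.1))
    (hfin.subset (Set.image_mono fun p hp => hp.1)), ← Set.image_union]
  · congr 2
    ext p
    simp only [Set.mem_union, Set.mem_ofPred_eq]
    tauto
  · rw [Set.disjoint_left]
    rintro _ ⟨p, ⟨-, hp⟩, rfl⟩ ⟨q, ⟨-, hq⟩, h⟩
    exact hq (hQ p q (r.symm (Quotient.exact h)) hp)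

theorem ncard_classes_sum {A ι : Type*} (r : Setoid A) {P : Set A} (J : Finset ι)
    (Q : ι → A → Prop) (hfin : (Quotient.mk r '' P).Finite)
    (hQ : ∀ j p q, r p q → Q j p → Q j q) (hdisj : ∀ i j p, Q i p → Q j p → i = j) :
    (Quotient.mk r '' {p | p ∈ P ∧ ∃ j ∈ J, Q j p}).ncard =
      ∑ j ∈ J, (Quotient.mk r '' {p | p ∈ P ∧ Q j p}).ncard := by
  classical
  induction J using Finset.induction_on with
  | empty => simp
  | insert i J hi ih =>
    rw [Finset.sum_insert hi, ← ih, ncard_classes_add r (Q i)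
      (hfin.subset (Set.image_mono fun p hp => hp.1)) (hQ i)]
    congr 4
    · ext p
      simp only [Finset.mem_insert, exists_eq_or_imp, Set.mem_ofPred_eq]
      tauto
    · ext p
      simp only [Finset.mem_insert, exists_eq_or_imp, Set.mem_ofPred_eq]
      constructor
      · tauto
      · rintro ⟨hp, j, hj, hjp⟩
        exact ⟨⟨hp, Or.inr ⟨j, hj, hjp⟩⟩, fun h => hi (hdisj _ _ _ h hjp ▸ hj)⟩

end Classes

/-! ### Diagrams as pairs of permutations of the edges -/

section PermPairs

open Equiv

variable {Ω : Type*}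

theorem apply_inv_self' (σ : Perm Ω) (z : Ω) : σ (σ⁻¹ z) = z := σ.apply_symm_apply z

theorem exists_perm_extending [DecidableEq Ω] (A : Finset Ω) (f : Ω → Ω)
    (hf : Set.InjOn f A) : ∃ π : Perm Ω, ∀ z ∈ A, π z = f z := by
  induction A using Finset.induction_on with
  | empty => exact ⟨1, by simp⟩
  | insert a A ha ih =>
    obtain ⟨π, hπ⟩ := ih (hf.mono (by simp))
    refine ⟨swap (π a) (f a) * π, fun z hz => ?_⟩
    rcases Finset.mem_insert.mp hz with rfl | hz'
    · simp
    · have hza : z ≠ a := fun h => ha (h ▸ hz')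
      rw [Perm.mul_apply, swap_apply_of_ne_of_ne (fun h => hza (π.injective h)), hπ z hz']
      rw [hπ z hz']
      exact fun h => hza (hf hz (Finset.mem_insert_self _ _) h)

/-- A permutation of `T ∪ X` each of whose cycles contains exactly one element of `T`. -/
structure Rooted (T X : Finset Ω) (γ : Perm Ω) : Prop where
  fixed : ∀ z, z ∉ T → z ∉ X → γ z = z
  root : ∀ x ∈ X, ∃ j ∈ T, γ.SameCycle j x
  inj : ∀ i ∈ T, ∀ j ∈ T, γ.SameCycle i j → i = j

namespace Rooted

variable {T X : Finset Ω} {γ : Perm Ω}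

theorem inv (h : Rooted T X γ) : Rooted T X γ⁻¹ where
  fixed z hT hX := by rw [Perm.inv_eq_iff_eq, h.fixed z hT hX]
  root x hx := by simpa using h.root x hx
  inj i hi j hj hij := h.inj i hi j hj (by simpa using hij)

theorem apply_mem (h : Rooted T X γ) {z : Ω} (hz : z ∈ T ∨ z ∈ X) : γ z ∈ T ∨ γ z ∈ X := by
  by_contra! hc
  have := γ.injective (h.fixed _ hc.1 hc.2)
  rw [this] at hc
  tauto

theorem inv_apply_mem (h : Rooted T X γ) {z : Ω} (hz : z ∈ T ∨ z ∈ X) :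
    γ⁻¹ z ∈ T ∨ γ⁻¹ z ∈ X := h.inv.apply_mem hz

theorem apply_ne (h : Rooted T X γ) {x : Ω} (hx : x ∈ X) (hT : x ∉ T) : γ x ≠ x := by
  intro hxx
  obtain ⟨j, hj, hjx⟩ := h.root x hx
  exact hT (hjx.eq_of_right hxx ▸ hj)

theorem eq_of_apply_mem (h : Rooted T X γ) {j : Ω} (hj : j ∈ T) (hj' : γ j ∈ T) : γ j = j :=
  (h.inj _ hj _ hj' (sameCycle_self_apply γ j)).symm

variable [DecidableEq Ω]

theorem conj (h : Rooted T X γ) (π : Perm Ω) : Rooted (T.image π) (X.image π) (π * γ * π⁻¹) where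
  fixed z hT hX := by
    have hz : ∀ A : Finset Ω, z ∉ A.image π → π⁻¹ z ∉ A := fun A hA hz =>
      hA (Finset.mem_image.mpr ⟨_, hz, by simp⟩)
    rw [Perm.mul_apply, Perm.mul_apply, h.fixed _ (hz _ hT) (hz _ hX)]
    simp
  root x hx := by
    obtain ⟨x, hx', rfl⟩ := Finset.mem_image.mp hx
    obtain ⟨j, hj, hjx⟩ := h.root x hx'
    exact ⟨π j, Finset.mem_image_of_mem _ hj, sameCycle_conj_iff.mpr hjx⟩
  inj i hi j hj hij := by
    obtain ⟨i, hi', rfl⟩ := Finset.mem_image.mp hi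
    obtain ⟨j, hj', rfl⟩ := Finset.mem_image.mp hj
    rw [h.inj i hi' j hj' (sameCycle_conj_iff.mp hij)]

/-- Insertion of a new element `y` into the cycle of `u`. -/
theorem mul_swap_iff {y u : Ω} (hy : γ y = y) (hT : y ∉ T) (hX : y ∉ X) (hu : u ≠ y) :
    Rooted T (insert y X) (γ * swap y u) ↔ Rooted T X γ ∧ (u ∈ T ∨ u ∈ X) := by
  have hne : ∀ z, z ∈ T ∨ z ∈ X → z ≠ y := by
    rintro z hz rfl
    tauto
  have hne' : ∀ z, z ∈ insert y X → z ≠ y → z ∈ X := fun z hz hzy =>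
    (Finset.mem_insert.mp hz).resolve_left hzy
  constructor
  · intro h
    have huTX : u ∈ T ∨ u ∈ X := by
      by_contra! hc
      have := h.fixed u hc.1 (by simp [hu, hc.2])
      simp only [Perm.mul_apply, swap_apply_right, hy] at this
      exact hu this.symm
    refine ⟨⟨fun z hzT hzX => ?_, fun x hx => ?_, fun i hi j hj hij => ?_⟩, huTX⟩
    · by_cases hzy : z = y
      · rw [hzy, hy]
      · have := h.fixed z hzT (by simp [hzy, hzX])
        rwa [Perm.mul_apply, swap_apply_of_ne_of_ne hzy] at this
        rintro rfl
        tauto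
    · obtain ⟨j, hj, hjx⟩ := h.root x (Finset.mem_insert_of_mem hx)
      exact ⟨j, hj, (sameCycle_mul_swap_iff hy hu (hne j (Or.inl hj)) (hne x (Or.inr hx))).mp hjx⟩
    · exact h.inj i hi j hj
        ((sameCycle_mul_swap_iff hy hu (hne i (Or.inl hi)) (hne j (Or.inl hj))).mpr hij)
  · rintro ⟨h, huTX⟩
    have hroot : ∀ x, x ∈ T ∨ x ∈ X → ∃ j ∈ T, (γ * swap y u).SameCycle j x := by
      rintro x (hx | hx)
      · exact ⟨x, hx, Perm.SameCycle.refl _ _⟩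
      · obtain ⟨j, hj, hjx⟩ := h.root x hx
        exact ⟨j, hj, (sameCycle_mul_swap_iff hy hu (hne j (Or.inl hj))
          (hne x (Or.inr hx))).mpr hjx⟩
    refine ⟨fun z hzT hzX => ?_, fun x hx => ?_, fun i hi j hj hij => ?_⟩
    · rw [Finset.mem_insert, not_or] at hzX
      rw [Perm.mul_apply, swap_apply_of_ne_of_ne hzX.1, h.fixed z hzT hzX.2]
      rintro rfl
      tauto
    · by_cases hxy : x = y
      · obtain ⟨j, hj, hju⟩ := hroot u huTX
        refine ⟨j, hj, hju.trans ?_⟩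
        have := sameCycle_self_apply (γ * swap y u) u
        rw [Perm.mul_apply, swap_apply_right, hy] at this
        rwa [hxy]
      · exact hroot x (Or.inr (hne' x hx hxy))
    · exact h.inj i hi j hj
        ((sameCycle_mul_swap_iff hy hu (hne i (Or.inl hi)) (hne j (Or.inl hj))).mp hij)

theorem erase_iff {t : Ω} (ht : t ∈ T) (hγ : γ t = t) (htX : t ∉ X) :
    Rooted (T.erase t) X γ ↔ Rooted T X γ := by
  constructor
  · intro h
    refine ⟨fun z hzT hzX => h.fixed z (fun h => hzT (Finset.mem_of_mem_erase h)) hzX,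
      fun x hx => ?_, fun i hi j hj hij => ?_⟩
    · obtain ⟨j, hj, hjx⟩ := h.root x hx
      exact ⟨j, Finset.mem_of_mem_erase hj, hjx⟩
    · by_cases hit : i = t
      · subst hit
        exact hij.eq_of_left hγ
      · by_cases hjt : j = t
        · subst hjt
          exact hij.eq_of_right hγ
        · exact h.inj i (Finset.mem_erase.mpr ⟨hit, hi⟩) j (Finset.mem_erase.mpr ⟨hjt, hj⟩) hij
  · intro h
    refine ⟨fun z hzT hzX => ?_, fun x hx => ?_, fun i hi j hj hij => ?_⟩
    · by_cases hzt : z = t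
      · rw [hzt, hγ]
      · exact h.fixed z (fun h => hzT (Finset.mem_erase.mpr ⟨hzt, h⟩)) hzX
    · obtain ⟨j, hj, hjx⟩ := h.root x hx
      refine ⟨j, Finset.mem_erase.mpr ⟨?_, hj⟩, hjx⟩
      rintro rfl
      exact htX (hjx.eq_of_left hγ ▸ hx)
    · exact h.inj i (Finset.mem_of_mem_erase hi) j (Finset.mem_of_mem_erase hj) hij

end Rooted

variable (Ω) in
/-- A diagram in terms of its edges, which are elements of an ambient type `Ω`. The labels `j` of
the leaves are elements of `Ω` and stand for the edges at these leaves; `inner` is the set of the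
other edges. The permutation `solid` takes every edge to the next one along its solid side, and
`dashed` to the next one along its dashed side; both lead from the end of a boundary segment back
to its start. -/
@[ext]
structure PermPair where
  inner : Finset Ω
  solid : Perm Ω
  dashed : Perm Ω

namespace PermPair

/-- On the inner edges, this permutation goes around the vertices at which they start. -/
def vertexPerm (p : PermPair Ω) : Perm Ω := p.dashed * p.solid⁻¹

/-- The pair of permutations comes from a unitary diagram with set `T` of labels and target
permutation `τ`. That no inner edge is fixed by `vertexPerm` means that no internal vertex has
degree two. -/
structure IsDiagram (T : Finset Ω) (τ : Perm Ω) (p : PermPair Ω) : Prop where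
  disj : ∀ x ∈ p.inner, x ∉ T
  solid : Rooted T p.inner p.solid
  dashed : Rooted T p.inner p.dashed
  target : ∀ j ∈ T, p.vertexPerm j = τ j
  ne : ∀ x ∈ p.inner, p.vertexPerm x ≠ x

variable {T : Finset Ω} {τ : Perm Ω} {p q : PermPair Ω}

theorem vertexPerm_solid (p : PermPair Ω) (z : Ω) : p.vertexPerm (p.solid z) = p.dashed z := by
  simp [vertexPerm]

theorem IsDiagram.vertexPerm_mem_inner (hτ : ∀ z, z ∉ T → τ z = z) (h : p.IsDiagram T τ)
    {x : Ω} (hx : x ∈ p.inner) : p.vertexPerm x ∈ p.inner := by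
  rcases h.dashed.apply_mem (h.solid.inv_apply_mem (Or.inr hx)) with h1 | h1
  · exfalso
    have hmem : τ⁻¹ (p.vertexPerm x) ∈ T := by
      by_contra hc
      have := hτ _ hc
      rw [apply_inv_self'] at this
      exact hc (this ▸ h1)
    have h2 := h.target _ hmem
    rw [apply_inv_self'] at h2
    exact h.disj x hx (p.vertexPerm.injective h2 ▸ hmem)
  · exact h1

variable [DecidableEq Ω]

/-- Relabelling of the edges. -/
def map (π : Perm Ω) (p : PermPair Ω) : PermPair Ω :=
  ⟨p.inner.image π, π * p.solid * π⁻¹, π * p.dashed * π⁻¹⟩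

theorem map_map (π ρ : Perm Ω) (p : PermPair Ω) : (p.map π).map ρ = p.map (ρ * π) := by
  ext <;> simp [map, mul_assoc, Finset.image_image]

theorem map_one (p : PermPair Ω) : p.map 1 = p := by
  ext <;> simp [map]

theorem vertexPerm_map (π : Perm Ω) (p : PermPair Ω) :
    (p.map π).vertexPerm = π * p.vertexPerm * π⁻¹ := by
  simp [map, vertexPerm, mul_assoc]

theorem map_solid_apply (π : Perm Ω) (p : PermPair Ω) (z : Ω) :
    (p.map π).solid (π z) = π (p.solid z) := by simp [map]

theorem map_dashed_apply (π : Perm Ω) (p : PermPair Ω) (z : Ω) :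
    (p.map π).dashed (π z) = π (p.dashed z) := by simp [map]

theorem map_vertexPerm_apply (π : Perm Ω) (p : PermPair Ω) (z : Ω) :
    (p.map π).vertexPerm (π z) = π (p.vertexPerm z) := by simp [vertexPerm_map]

theorem map_solid_inv_apply (π : Perm Ω) (p : PermPair Ω) (z : Ω) :
    (p.map π).solid⁻¹ (π z) = π (p.solid⁻¹ z) := by
  rw [Perm.inv_eq_iff_eq, map_solid_apply, apply_inv_self']

theorem map_dashed_inv_apply (π : Perm Ω) (p : PermPair Ω) (z : Ω) :
    (p.map π).dashed⁻¹ (π z) = π (p.dashed⁻¹ z) := by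
  rw [Perm.inv_eq_iff_eq, map_dashed_apply, apply_inv_self']

theorem mem_map_inner {π : Perm Ω} {p : PermPair Ω} {z : Ω} :
    π z ∈ (p.map π).inner ↔ z ∈ p.inner := by
  simp [map]

/-- Isomorphism: the edges at the labelled leaves have to keep their labels. -/
def Iso (T : Finset Ω) (p q : PermPair Ω) : Prop :=
  ∃ π : Perm Ω, (∀ j ∈ T, π j = j) ∧ p.map π = q

variable (T) in
/-- Isomorphism as an equivalence relation. -/
def isoSetoid : Setoid (PermPair Ω) where
  r := Iso T
  iseqv := by
    refine ⟨fun p => ⟨1, by simp, map_one p⟩, ?_, ?_⟩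
    · rintro p q ⟨π, h, rfl⟩
      refine ⟨π⁻¹, fun j hj => by rw [Perm.inv_eq_iff_eq, h j hj], ?_⟩
      rw [map_map, inv_mul_cancel, map_one]
    · rintro p q r ⟨π, h, rfl⟩ ⟨ρ, h', rfl⟩
      exact ⟨ρ * π, fun j hj => by rw [Perm.mul_apply, h j hj, h' j hj], (map_map _ _ _).symm⟩

theorem Iso.symm (h : Iso T p q) : Iso T q p := (isoSetoid T).symm h

theorem Iso.trans {r : PermPair Ω} (h : Iso T p q) (h' : Iso T q r) : Iso T p r :=
  (isoSetoid T).trans h h'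

theorem image_eq_self_of_fixes {π : Perm Ω} (h : ∀ j ∈ T, π j = j) : T.image π = T := by
  conv_rhs => rw [← Finset.image_id (s := T)]
  exact Finset.image_congr fun j hj => h j hj

theorem IsDiagram.map (h : p.IsDiagram T τ) (hτ : ∀ z, z ∉ T → τ z = z) {π : Perm Ω}
    (hπ : ∀ j ∈ T, π j = j) : (p.map π).IsDiagram T τ where
  disj x hx := by
    obtain ⟨x, hx', rfl⟩ := Finset.mem_image.mp hx
    intro hT
    have := π.injective (hπ _ hT)
    rw [this] at hT
    exact h.disj x hx' hT
  solid := by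
    have := h.solid.conj π
    rwa [image_eq_self_of_fixes hπ] at this
  dashed := by
    have := h.dashed.conj π
    rwa [image_eq_self_of_fixes hπ] at this
  target j hj := by
    have := map_vertexPerm_apply π p j
    rw [hπ j hj, h.target j hj] at this
    rw [this, hπ]
    by_contra hc
    exact hc ((τ.injective (hτ _ hc)).symm ▸ hj)
  ne x hx := by
    obtain ⟨x, hx', rfl⟩ := Finset.mem_image.mp hx
    rw [map_vertexPerm_apply]
    exact fun hc => h.ne x hx' (π.injective hc)

/-- The number of internal vertices. -/
noncomputable def numVertices (p : PermPair Ω) : ℕ := numCycles p.vertexPerm p.inner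

theorem numVertices_map (π : Perm Ω) (p : PermPair Ω) :
    (p.map π).numVertices = p.numVertices := by
  rw [numVertices, vertexPerm_map]
  exact numCycles_conj _ _ _

theorem card_inner_map (π : Perm Ω) (p : PermPair Ω) :
    (p.map π).inner.card = p.inner.card := Finset.card_image_of_injective _ π.injective

/-- An element of `Ω` that is not used by the pair of permutations. -/
structure Fresh (p : PermPair Ω) (y : Ω) : Prop where
  notMem : y ∉ p.inner
  solid : p.solid y = y
  dashed : p.dashed y = y

theorem Fresh.map {y : Ω} (h : p.Fresh y) (π : Perm Ω) : (p.map π).Fresh (π y) where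
  notMem := by rw [mem_map_inner]; exact h.notMem
  solid := by rw [map_solid_apply, h.solid]
  dashed := by rw [map_dashed_apply, h.dashed]

omit [DecidableEq Ω] in
theorem IsDiagram.fresh (h : p.IsDiagram T τ) {y : Ω} (hT : y ∉ T) (hy : y ∉ p.inner) :
    p.Fresh y := ⟨hy, h.solid.fixed y hT hy, h.dashed.fixed y hT hy⟩

theorem map_swap_of_fresh {y y' : Ω} (h : p.Fresh y) (h' : p.Fresh y') :
    p.map (swap y y') = p := by
  have key : ∀ γ : Perm Ω, γ y = y → γ y' = y' → swap y y' * γ * (swap y y')⁻¹ = γ := by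
    intro γ h1 h2
    have := swap_mul_eq_mul_swap γ y y'
    rw [Perm.inv_eq_iff_eq.mpr h1.symm, Perm.inv_eq_iff_eq.mpr h2.symm] at this
    rw [this, mul_inv_cancel_right]
  ext1
  · refine image_eq_self_of_fixes fun x hx => swap_apply_of_ne_of_ne ?_ ?_
    · exact fun e => h.notMem (e ▸ hx)
    · exact fun e => h'.notMem (e ▸ hx)
  · exact key _ h.solid h'.solid
  · exact key _ h.dashed h'.dashed

/-- A relabelling can be changed so that it takes one given unused element to another. -/
theorem exists_map_eq_of_fresh {π : Perm Ω} (hpq : p.map π = q) {y y' : Ω} (hy : p.Fresh y)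
    (hy' : q.Fresh y') : ∃ π' : Perm Ω, p.map π' = q ∧ π' y = y' ∧
      ∀ z, z ≠ y → π z ≠ y' → π' z = π z := by
  subst hpq
  refine ⟨swap (π y) y' * π, ?_, by simp, fun z hz hz' => ?_⟩
  · rw [← map_map, map_swap_of_fresh (hy.map π) hy']
  · rw [Perm.mul_apply, swap_apply_of_ne_of_ne (fun h => hz (π.injective h)) hz']

/-- Insertion of a new edge `y` after `u` along the solid sides and after `w` along the dashed
sides. -/
def insertEdge (y u w : Ω) (p : PermPair Ω) : PermPair Ω :=
  ⟨insert y p.inner, p.solid * swap y u, p.dashed * swap y w⟩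

/-- The inverse of `insertEdge y u w`. -/
def eraseEdge (y u w : Ω) (p : PermPair Ω) : PermPair Ω :=
  ⟨p.inner.erase y, p.solid * swap y u, p.dashed * swap y w⟩

theorem eraseEdge_insertEdge {y : Ω} (h : y ∉ p.inner) (u w : Ω) :
    (p.insertEdge y u w).eraseEdge y u w = p := by
  ext1
  · exact Finset.erase_insert h
  · exact mul_swap_mul_self y u p.solid
  · exact mul_swap_mul_self y w p.dashed

theorem insertEdge_eraseEdge {y : Ω} (h : y ∈ p.inner) (u w : Ω) :
    (p.eraseEdge y u w).insertEdge y u w = p := by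
  ext1
  · exact Finset.insert_erase h
  · exact mul_swap_mul_self y u p.solid
  · exact mul_swap_mul_self y w p.dashed

theorem conj_mul_swap (γ π : Perm Ω) (y u : Ω) :
    π * (γ * swap y u) * π⁻¹ = π * γ * π⁻¹ * swap (π y) (π u) := by
  have : swap (π y) (π u) = π * swap y u * π⁻¹ := by
    rw [mul_swap_eq_swap_mul, mul_inv_cancel_right]
  rw [this]
  group

theorem insertEdge_map (π : Perm Ω) (y u w : Ω) (p : PermPair Ω) :
    (p.insertEdge y u w).map π = (p.map π).insertEdge (π y) (π u) (π w) := by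
  ext1
  · exact Finset.image_insert _ _ _
  · exact conj_mul_swap _ _ _ _
  · exact conj_mul_swap _ _ _ _

theorem eraseEdge_map (π : Perm Ω) (y u w : Ω) (p : PermPair Ω) :
    (p.eraseEdge y u w).map π = (p.map π).eraseEdge (π y) (π u) (π w) := by
  ext1
  · exact Finset.image_erase π.injective _ _
  · exact conj_mul_swap _ _ _ _
  · exact conj_mul_swap _ _ _ _

/-- Insertion of an edge is compatible with isomorphisms. -/
theorem insertEdge_iso {π : Perm Ω} (hπ : ∀ j ∈ T, π j = j) (hpq : p.map π = q) {y y' u w : Ω}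
    (hy : p.Fresh y) (hyT : y ∉ T) (hy' : q.Fresh y') (hyT' : y' ∉ T)
    (hu : u ≠ y) (hw : w ≠ y) (hu' : π u ≠ y') (hw' : π w ≠ y') :
    Iso T (p.insertEdge y u w) (q.insertEdge y' (π u) (π w)) := by
  obtain ⟨π', h1, h2, h3⟩ := exists_map_eq_of_fresh hpq hy hy'
  refine ⟨π', fun j hj => ?_, ?_⟩
  · rw [h3 j (fun h => hyT (h ▸ hj)), hπ j hj]
    rw [hπ j hj]
    exact fun h => hyT' (h ▸ hj)
  · rw [insertEdge_map, h1, h2, h3 u hu hu', h3 w hw hw']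

end PermPair

end PermPairs

/-! ### Contraction of the edge opposite to a leaf at a vertex of degree four -/

section Contraction

open Equiv

variable {Ω : Type*}

theorem inv_apply_self' (σ : Perm Ω) (z : Ω) : σ⁻¹ (σ z) = z := σ.symm_apply_apply z

theorem apply_mem_of_fixes {T : Finset Ω} {τ : Perm Ω} (hτ : ∀ z, z ∉ T → τ z = z) {j : Ω}
    (hj : j ∈ T) : τ j ∈ T := by
  by_contra hc
  exact hc ((τ.injective (hτ _ hc)).symm ▸ hj)

variable [DecidableEq Ω]

/-- If the fixed point `y` of `σ` is split off together with the pair `a`, `b` of consecutive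
elements of a cycle, in such a way that `y` takes the place of this pair, then there is one cycle
more. -/
theorem numCycles_split {σ : Perm Ω} {X : Finset Ω} {y a b : Ω} (hy : σ y = y) (hyX : y ∉ X)
    (ha : a ∈ X) (hb : b ∈ X) (hab : σ a = b) (hne : a ≠ b) :
    numCycles (swap y a * σ * swap y b) (insert y X) = numCycles σ X + 1 := by
  have hay : a ≠ y := fun h => hyX (h ▸ ha)
  have hby : b ≠ y := fun h => hyX (h ▸ hb)
  set κ := swap y a * σ * swap y b with hκ
  have hκa : κ a = b := by
    simp only [hκ, Perm.mul_apply]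
    rw [swap_apply_of_ne_of_ne hay hne, hab, swap_apply_of_ne_of_ne hby hne.symm]
  have hκb : κ b = a := by
    simp only [hκ, Perm.mul_apply]
    rw [swap_apply_right, hy, swap_apply_left]
  set l := κ * swap a b with hl
  have hla : l a = a := by rw [hl, Perm.mul_apply, swap_apply_left, hκb]
  have hlb : l b = b := by rw [hl, Perm.mul_apply, swap_apply_right, hκa]
  set A := (insert y X).erase a with hA
  have hbA : b ∈ A := by simp [hA, hne.symm, hb]
  have hyA : y ∈ A.erase b := by simp [hA, hay.symm, hby.symm]
  have haA : a ∉ A := by simp [hA]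
  have h1 : numCycles κ (insert y X) = numCycles l A := by
    rw [← numCycles_mul_swap_insert hla haA hbA, hl, mul_swap_mul_self, hA,
      Finset.insert_erase (Finset.mem_insert_of_mem ha)]
  have h2 : numCycles l A = numCycles l (A.erase b) + 1 := by
    rw [← numCycles_insert_of_fixed hlb (Finset.notMem_erase _ _), Finset.insert_erase hbA]
  have h3 : numCycles (l * swap b y) A = numCycles l (A.erase b) := by
    rw [← numCycles_mul_swap_insert hlb (Finset.notMem_erase _ _) hyA, Finset.insert_erase hbA]
  have h4 : A = X.image (swap y a) := by
    ext z
    rw [Finset.mem_image]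
    constructor
    · intro hz
      simp only [hA, Finset.mem_erase, Finset.mem_insert] at hz
      rcases hz with ⟨hza, rfl | hz⟩
      · exact ⟨a, ha, swap_apply_right _ _⟩
      · exact ⟨z, hz, swap_apply_of_ne_of_ne (fun h => hyX (h ▸ hz)) hza⟩
    · rintro ⟨x, hx, rfl⟩
      by_cases hxa : x = a
      · rw [hxa, swap_apply_right]
        exact Finset.mem_of_mem_erase hyA
      · rw [swap_apply_of_ne_of_ne (ne_of_mem_of_not_mem hx hyX) hxa]
        simp [hA, hxa, hx]
  have h5 : l * swap b y = swap y a * σ * (swap y a)⁻¹ := by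
    have h6 : swap y b * swap a b * swap b y = swap y a := by
      rw [swap_comm y b]
      exact swap_mul_swap_mul_swap hne hay
    rw [hl, hκ, mul_assoc, mul_assoc _ (swap y b), ← mul_assoc (swap y b), h6, swap_inv]
  rw [h1, h2, ← h3, h5, h4, numCycles_conj]

namespace PermPair

variable {T : Finset Ω} {τ : Perm Ω} {p q : PermPair Ω} {t : Ω}

theorem vertexPerm_insertEdge {y : Ω} (hy : p.Fresh y) (u w : Ω) :
    (p.insertEdge y u w).vertexPerm =
      swap y (p.dashed w) * p.vertexPerm * swap y (p.solid u) := by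
  simp only [vertexPerm, insertEdge]
  rw [mul_swap_eq_swap_mul, mul_swap_eq_swap_mul, hy.solid, hy.dashed, mul_inv_rev, swap_inv]
  group

/-- The edge at the leaf `t` leads to an internal vertex, but not to one of degree four. -/
structure AtLargeVertex (t : Ω) (p : PermPair Ω) : Prop where
  mem : p.solid t ∈ p.inner
  ne : p.vertexPerm (p.dashed t) ≠ p.solid t

/-- The edge at the leaf `t` leads to an internal vertex of degree four, and the opposite edge at
that vertex leads to another internal vertex. -/
structure AtContractibleVertex (t : Ω) (p : PermPair Ω) : Prop where
  mem : p.solid t ∈ p.inner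
  eq : p.vertexPerm (p.dashed t) = p.solid t
  opp_mem : p.solid⁻¹ (p.dashed t) ∈ p.inner

/-- Contraction of the edge that is opposite to the leaf `t` at a vertex of degree four. -/
def contract (t : Ω) (p : PermPair Ω) : PermPair Ω :=
  p.eraseEdge (p.solid⁻¹ (p.dashed t)) (p.solid⁻¹ (p.solid⁻¹ (p.dashed t)))
    (p.dashed⁻¹ (p.solid⁻¹ (p.dashed t)))

/-- The inverse of `contract`: a vertex of degree four is split off, and the new edge is `y`. -/
def expand (t y : Ω) (p : PermPair Ω) : PermPair Ω :=
  p.insertEdge y (p.solid⁻¹ (p.dashed t)) (p.dashed⁻¹ (p.solid t))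

theorem contract_map {π : Perm Ω} (hπ : π t = t) (p : PermPair Ω) :
    (p.contract t).map π = (p.map π).contract t := by
  have h : (p.map π).dashed t = π (p.dashed t) := by rw [← map_dashed_apply, hπ]
  rw [contract, contract, eraseEdge_map, h]
  simp only [map_solid_inv_apply, map_dashed_inv_apply]

section Expand

variable (hτ : ∀ z, z ∉ T → τ z = z) (ht : t ∈ T)
include hτ ht

omit [DecidableEq Ω] ht in
theorem IsDiagram.dashed_mem_inner (hp : p.IsDiagram T τ) (hmem : p.solid t ∈ p.inner) :
    p.dashed t ∈ p.inner := by
  rw [← vertexPerm_solid]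
  exact hp.vertexPerm_mem_inner hτ hmem

omit [DecidableEq Ω] hτ ht in
theorem IsDiagram.dashed_ne_solid (hp : p.IsDiagram T τ) (hmem : p.solid t ∈ p.inner) :
    p.dashed t ≠ p.solid t := by
  rw [← vertexPerm_solid]
  exact hp.ne _ hmem

/-- Expansion takes the diagrams with the leaf `t` at a large vertex to those with `t` at a
contractible vertex, adds one internal vertex, and is undone by contraction. -/
theorem expand_spec (hp : p.IsDiagram T τ) (h : p.AtLargeVertex t) {y : Ω} (hyT : y ∉ T)
    (hy : y ∉ p.inner) :
    (p.expand t y).IsDiagram T τ ∧ (p.expand t y).AtContractibleVertex t ∧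
      (p.expand t y).numVertices = p.numVertices + 1 ∧ (p.expand t y).contract t = p := by
  have hf := hp.fresh hyT hy
  have hb := hp.dashed_mem_inner hτ h.mem
  have hne := hp.dashed_ne_solid h.mem
  set a := p.solid t with ha
  set b := p.dashed t with hbdef
  set u := p.solid⁻¹ b with hu
  set w := p.dashed⁻¹ a with hw
  have hsu : p.solid u = b := apply_inv_self' _ _
  have hdw : p.dashed w = a := apply_inv_self' _ _
  have hay : a ≠ y := fun e => hy (e ▸ h.mem)
  have hby : b ≠ y := fun e => hy (e ▸ hb)
  have huy : u ≠ y := fun e => hby (by rw [← hsu, e, hf.solid])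
  have hwy : w ≠ y := fun e => hay (by rw [← hdw, e, hf.dashed])
  have hty : t ≠ y := fun e => hyT (e ▸ ht)
  have htu : t ≠ u := fun e => hne (by rw [← hsu, ← e])
  have htw : t ≠ w := fun e => hne (by rw [← hdw, ← e])
  have hv : (p.expand t y).vertexPerm = swap y a * p.vertexPerm * swap y b := by
    rw [expand, vertexPerm_insertEdge hf, hdw, hsu]
  have hqt : (p.expand t y).solid t = a := by
    change p.solid (swap y u t) = a
    rw [swap_apply_of_ne_of_ne hty htu]
  have hqt' : (p.expand t y).dashed t = b := by
    change p.dashed (swap y w t) = b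
    rw [swap_apply_of_ne_of_ne hty htw]
  have hqy : (p.expand t y).solid y = b := by
    simp only [expand, insertEdge, Perm.mul_apply, swap_apply_left]
    exact hsu
  have hqy' : (p.expand t y).dashed y = a := by
    simp only [expand, insertEdge, Perm.mul_apply, swap_apply_left]
    exact hdw
  have hqu : (p.expand t y).solid u = y := by
    simp only [expand, insertEdge, Perm.mul_apply]
    rw [swap_apply_right, hf.solid]
  have hqw : (p.expand t y).dashed w = y := by
    simp only [expand, insertEdge, Perm.mul_apply]
    rw [swap_apply_right, hf.dashed]
  have hab : p.vertexPerm a = b := vertexPerm_solid p t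
  have hvy : p.vertexPerm y = y := by
    have := vertexPerm_solid p y
    rwa [hf.solid, hf.dashed] at this
  refine ⟨⟨?_, ?_, ?_, ?_, ?_⟩, ⟨?_, ?_, ?_⟩, ?_, ?_⟩
  · intro x hx
    rcases Finset.mem_insert.mp hx with rfl | hx
    · exact hyT
    · exact hp.disj x hx
  · exact (Rooted.mul_swap_iff hf.solid hyT hy huy).mpr
      ⟨hp.solid, hp.solid.inv_apply_mem (Or.inr hb)⟩
  · exact (Rooted.mul_swap_iff hf.dashed hyT hy hwy).mpr
      ⟨hp.dashed, hp.dashed.inv_apply_mem (Or.inr h.mem)⟩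
  · intro j hj
    rw [hv, Perm.mul_apply, Perm.mul_apply, swap_apply_of_ne_of_ne (ne_of_mem_of_not_mem hj hyT)
      (ne_of_mem_of_not_mem hj (hp.disj _ hb)), hp.target j hj]
    have := apply_mem_of_fixes hτ hj
    exact swap_apply_of_ne_of_ne (ne_of_mem_of_not_mem this hyT)
      (ne_of_mem_of_not_mem this (hp.disj _ h.mem))
  · intro x hx
    rw [hv, Perm.mul_apply, Perm.mul_apply]
    by_cases hxy : x = y
    · rw [hxy, swap_apply_left]
      -- `b` is not taken to `a`, so its image is not moved
      rw [swap_apply_of_ne_of_ne _ h.ne]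
      · exact fun e => hby (p.vertexPerm.injective (e.trans hvy.symm))
      · exact fun e => hby (p.vertexPerm.injective (e.trans hvy.symm))
    · have hxX : x ∈ p.inner := (Finset.mem_insert.mp hx).resolve_left hxy
      by_cases hxb : x = b
      · rw [hxb, swap_apply_right, hvy, swap_apply_left]
        exact hne.symm
      · rw [swap_apply_of_ne_of_ne hxy hxb]
        by_cases hxa : p.vertexPerm x = a
        · rw [hxa, swap_apply_right]
          exact fun e => hxy e.symm
        · rw [swap_apply_of_ne_of_ne _ hxa]
          · exact hp.ne x hxX
          · exact fun e => hxy (p.vertexPerm.injective (e.trans hvy.symm))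
  · rw [hqt]
    exact Finset.mem_insert_of_mem h.mem
  · rw [hqt, hqt', ← hqy, vertexPerm_solid, hqy']
  · rw [hqt', ← hqy, inv_apply_self']
    exact Finset.mem_insert_self _ _
  · rw [numVertices, hv]
    exact numCycles_split hvy hy h.mem hb hab hne.symm
  · have h1 : (p.expand t y).solid⁻¹ ((p.expand t y).dashed t) = y := by
      rw [hqt', ← hqy, inv_apply_self']
    have h2 : (p.expand t y).solid⁻¹ y = u := by
      rw [Perm.inv_eq_iff_eq, hqu]
    have h3 : (p.expand t y).dashed⁻¹ y = w := by
      rw [Perm.inv_eq_iff_eq, hqw]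
    rw [contract, h1, h2, h3]
    exact eraseEdge_insertEdge hy u w

/-- Contraction takes the diagrams with the leaf `t` at a contractible vertex to those with `t` at a
large vertex, and is undone by expansion. -/
theorem contract_spec (hq : q.IsDiagram T τ) (h : q.AtContractibleVertex t) :
    (q.contract t).IsDiagram T τ ∧ (q.contract t).AtLargeVertex t ∧
      q.solid⁻¹ (q.dashed t) ∉ (q.contract t).inner ∧
      (q.contract t).expand t (q.solid⁻¹ (q.dashed t)) = q := by
  have hb := hq.dashed_mem_inner hτ h.mem
  have hne := hq.dashed_ne_solid h.mem
  have hyT := hq.disj _ h.opp_mem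
  have hyX := h.opp_mem
  have heq := h.eq
  have hmem := h.mem
  set a := q.solid t with ha
  set b := q.dashed t with hbdef
  set y := q.solid⁻¹ b with hy
  set u := q.solid⁻¹ y with hu
  set w := q.dashed⁻¹ y with hw
  have hsy : q.solid y = b := apply_inv_self' _ _
  have hdy : q.dashed y = a := by rw [← vertexPerm_solid, hsy, heq]
  have hsu : q.solid u = y := apply_inv_self' _ _
  have hdw : q.dashed w = y := apply_inv_self' _ _
  have hay : a ≠ y := fun e => hq.dashed.apply_ne hyX hyT (hdy.trans e)
  have hby : b ≠ y := fun e => hq.solid.apply_ne hyX hyT (hsy.trans e)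
  have hty : t ≠ y := fun e => hyT (e ▸ ht)
  have htu : t ≠ u := fun e => hay (by rw [← hsu, ← e])
  have htw : t ≠ w := fun e => hby (by rw [← hdw, ← e])
  have huy : u ≠ y := fun e => hq.solid.apply_ne hyX hyT (by rw [← e, hsu, e])
  have hwy : w ≠ y := fun e => hq.dashed.apply_ne hyX hyT (by rw [← e, hdw, e])
  have hp : q.contract t = q.eraseEdge y u w := rfl
  set p := q.contract t with hpdef
  have hqp : p.insertEdge y u w = q := insertEdge_eraseEdge hyX u w
  have hpy : p.solid y = y := by
    simp only [hp, eraseEdge, Perm.mul_apply]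
    rw [swap_apply_left, hsu]
  have hpy' : p.dashed y = y := by
    simp only [hp, eraseEdge, Perm.mul_apply]
    rw [swap_apply_left, hdw]
  have hpu : p.solid u = b := by
    simp only [hp, eraseEdge, Perm.mul_apply]
    rw [swap_apply_right, hsy]
  have hpw : p.dashed w = a := by
    simp only [hp, eraseEdge, Perm.mul_apply]
    rw [swap_apply_right, hdy]
  have hpt : p.solid t = a := by
    simp only [hp, eraseEdge, Perm.mul_apply]
    rw [swap_apply_of_ne_of_ne hty htu]
  have hpt' : p.dashed t = b := by
    simp only [hp, eraseEdge, Perm.mul_apply]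
    rw [swap_apply_of_ne_of_ne hty htw]
  have hynp : y ∉ p.inner := Finset.notMem_erase _ _
  have hf : p.Fresh y := ⟨hynp, hpy, hpy'⟩
  have hins : insert y p.inner = q.inner := Finset.insert_erase hyX
  have hv : p.vertexPerm = swap y a * q.vertexPerm * swap y b := by
    rw [← hqp, vertexPerm_insertEdge hf, hpu, hpw, ← mul_assoc, ← mul_assoc, swap_mul_self,
      one_mul, mul_assoc, swap_mul_self, mul_one]
  have hab : q.vertexPerm a = b := vertexPerm_solid q t
  have h1 : q.vertexPerm y ≠ a := fun e => hby (q.vertexPerm.injective (heq.trans e.symm))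
  have h2 : q.vertexPerm y ≠ b := fun e => hay (q.vertexPerm.injective (hab.trans e.symm))
  have hpb : p.vertexPerm b = q.vertexPerm y := by
    rw [hv, Perm.mul_apply, Perm.mul_apply, swap_apply_right,
      swap_apply_of_ne_of_ne (hq.ne y hyX) h1]
  refine ⟨⟨?_, ?_, ?_, ?_, ?_⟩, ⟨?_, ?_⟩, hynp, ?_⟩
  · exact fun x hx => hq.disj x (Finset.mem_of_mem_erase hx)
  · refine ((Rooted.mul_swap_iff hpy hyT hynp huy).mp ?_).1
    have := hq.solid
    rwa [← hqp] at this
  · refine ((Rooted.mul_swap_iff hpy' hyT hynp hwy).mp ?_).1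
    have := hq.dashed
    rwa [← hqp] at this
  · intro j hj
    rw [hv, Perm.mul_apply, Perm.mul_apply, swap_apply_of_ne_of_ne (ne_of_mem_of_not_mem hj hyT)
      (ne_of_mem_of_not_mem hj (hq.disj _ hb)), hq.target j hj]
    have := apply_mem_of_fixes hτ hj
    exact swap_apply_of_ne_of_ne (ne_of_mem_of_not_mem this hyT)
      (ne_of_mem_of_not_mem this (hq.disj _ hmem))
  · intro x hx
    by_cases hxb : x = b
    · rw [hxb, hpb]
      exact h2
    · have hxy : x ≠ y := fun e => hynp (e ▸ hx)
      rw [hv, Perm.mul_apply, Perm.mul_apply, swap_apply_of_ne_of_ne hxy hxb]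
      by_cases hxv : q.vertexPerm x = y
      · rw [hxv, swap_apply_left]
        rintro rfl
        exact hby (hab.symm.trans hxv)
      · rw [swap_apply_of_ne_of_ne hxv]
        · exact hq.ne x (Finset.mem_of_mem_erase hx)
        · exact fun e => hxb (q.vertexPerm.injective (e.trans heq.symm))
  · rw [hpt]
    exact Finset.mem_erase.mpr ⟨hay, hmem⟩
  · rw [hpt, hpt', hpb]
    exact h1
  · have h3 : p.solid⁻¹ b = u := by rw [← hpu, inv_apply_self']
    have h4 : p.dashed⁻¹ a = w := by rw [← hpw, inv_apply_self']
    rw [expand, hpt, hpt', h3, h4, hqp]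

end Expand

end PermPair

end Contraction

/-! ### Untying two leaves from a vertex of degree four -/

section Untying

open Equiv

variable {Ω : Type*} [DecidableEq Ω]

namespace PermPair

variable {T : Finset Ω} {τ : Perm Ω} {p q : PermPair Ω} {t j : Ω}

/-- The edges at the leaves `t` and `j` are opposite to each other at a vertex of degree four. -/
structure TiedTo (t j : Ω) (p : PermPair Ω) : Prop where
  mem : p.solid t ∈ p.inner
  eq : p.vertexPerm (p.dashed t) = p.solid t
  opp : p.solid⁻¹ (p.dashed t) = j

/-- Exchange of the dashed sides of the edges at the leaves `t` and `j`. -/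
def twist (t j : Ω) (p : PermPair Ω) : PermPair Ω :=
  ⟨p.inner, p.solid, swap t j * p.dashed * swap t j⟩

theorem twist_twist (t j : Ω) (p : PermPair Ω) : (p.twist t j).twist t j = p := by
  ext1
  · rfl
  · rfl
  · simp [twist, mul_assoc]

theorem twist_map {π : Perm Ω} (ht : π t = t) (hj : π j = j) (p : PermPair Ω) :
    (p.twist t j).map π = (p.map π).twist t j := by
  ext1
  · rfl
  · rfl
  · have h : π * swap t j = swap t j * π := by rw [mul_swap_eq_swap_mul, ht, hj]
    have h' : swap t j * π⁻¹ = π⁻¹ * swap t j := by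
      rw [eq_inv_mul_iff_mul_eq, ← mul_assoc, h, mul_inv_cancel_right]
    simp only [map, twist]
    rw [← mul_assoc, ← mul_assoc, h, mul_assoc _ (swap t j), h']
    simp only [mul_assoc]

/-- The edges at the leaves `t` and `j` are tied together at a new vertex of degree four, where
they continue as `a` and `b`. -/
def tie (t j a b : Ω) (p : PermPair Ω) : PermPair Ω :=
  ((p.insertEdge b j j).insertEdge a t t).twist t j

/-- The inverse of `tie`. -/
def untie (t j : Ω) (p : PermPair Ω) : PermPair Ω :=
  ((p.twist t j).eraseEdge (p.solid t) t t).eraseEdge (p.solid j) j j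

theorem untie_map {π : Perm Ω} (ht : π t = t) (hj : π j = j) (p : PermPair Ω) :
    (p.untie t j).map π = (p.map π).untie t j := by
  have h1 : (p.map π).solid t = π (p.solid t) := by rw [← map_solid_apply, ht]
  have h2 : (p.map π).solid j = π (p.solid j) := by rw [← map_solid_apply, hj]
  rw [untie, untie, eraseEdge_map, eraseEdge_map, twist_map ht hj, h1, h2, ht, hj]

theorem twist_vertexPerm (t j : Ω) (p : PermPair Ω) :
    (p.twist t j).vertexPerm =
      swap t j * p.vertexPerm * swap (p.solid t) (p.solid j) := by
  have h : swap t j * p.solid⁻¹ = p.solid⁻¹ * swap (p.solid t) (p.solid j) := by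
    rw [eq_inv_mul_iff_mul_eq, ← mul_assoc, mul_swap_eq_swap_mul, mul_inv_cancel_right]
  simp only [vertexPerm, twist]
  rw [mul_assoc, h]
  simp only [mul_assoc]

theorem insertEdge_vertexPerm_self (y u : Ω) (p : PermPair Ω) :
    (p.insertEdge y u u).vertexPerm = p.vertexPerm := by
  simp [vertexPerm, insertEdge, mul_assoc]

theorem Rooted.conj_swap {X : Finset Ω} {γ : Perm Ω} (h : Rooted T X γ) (ht : t ∈ T) (hj : j ∈ T)
    (hX : ∀ x ∈ X, x ∉ T) : Rooted T X (swap t j * γ * swap t j) := by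
  have h1 : T.image (swap t j) = T := by
    refine Finset.eq_of_subset_of_card_le (fun z hz => ?_)
      (by rw [Finset.card_image_of_injective _ (swap t j).injective])
    obtain ⟨x, hx, rfl⟩ := Finset.mem_image.mp hz
    rw [swap_apply_def]
    split_ifs <;> assumption
  have h2 : X.image (swap t j) = X := image_eq_self_of_fixes fun x hx =>
    swap_apply_of_ne_of_ne (fun e => hX x hx (e ▸ ht)) (fun e => hX x hx (e ▸ hj))
  have := h.conj (swap t j)
  rwa [h1, h2, swap_inv] at this

section Tie

variable (hτ : ∀ z, z ∉ T → τ z = z) (ht : t ∈ T) (hj : j ∈ T) (htj : j ≠ t)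
include hτ ht hj htj

/-- Tying the leaves `t` and `j` together changes the target permutation by a transposition, adds
one internal vertex, and is undone by untying. -/
theorem tie_spec (hp : p.IsDiagram T (swap t j * τ)) {a b : Ω} (haT : a ∉ T) (hbT : b ∉ T)
    (ha : a ∉ p.inner) (hb : b ∉ p.inner) (hab : a ≠ b) :
    (p.tie t j a b).IsDiagram T τ ∧ (p.tie t j a b).TiedTo t j ∧
      (p.tie t j a b).numVertices = p.numVertices + 1 ∧ (p.tie t j a b).untie t j = p := by
  have hfb := hp.fresh hbT hb
  have hfa := hp.fresh haT ha
  have hta : t ≠ a := ne_of_mem_of_not_mem ht haT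
  have htb : t ≠ b := ne_of_mem_of_not_mem ht hbT
  have hja : j ≠ a := ne_of_mem_of_not_mem hj haT
  have hjb : j ≠ b := ne_of_mem_of_not_mem hj hbT
  set p1 := p.insertEdge b j j with hp1
  set p2 := p1.insertEdge a t t with hp2
  have hq : p.tie t j a b = p2.twist t j := rfl
  have h1a : p1.Fresh a := by
    refine ⟨?_, ?_, ?_⟩
    · simp [hp1, insertEdge, hab, ha]
    · change p.solid (swap b j a) = a
      rw [swap_apply_of_ne_of_ne hab hja.symm, hfa.solid]
    · change p.dashed (swap b j a) = a
      rw [swap_apply_of_ne_of_ne hab hja.symm, hfa.dashed]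
  have hst : p2.solid t = a := by
    change p1.solid (swap a t t) = a
    rw [swap_apply_right, h1a.solid]
  have hsj : p2.solid j = b := by
    change p.solid (swap b j (swap a t j)) = b
    rw [swap_apply_of_ne_of_ne hja htj, swap_apply_right, hfb.solid]
  have hdj : p2.dashed j = b := by
    change p.dashed (swap b j (swap a t j)) = b
    rw [swap_apply_of_ne_of_ne hja htj, swap_apply_right, hfb.dashed]
  have hv : (p.tie t j a b).vertexPerm = swap t j * p.vertexPerm * swap a b := by
    rw [hq, twist_vertexPerm, hst, hsj, hp2, insertEdge_vertexPerm_self, hp1,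
      insertEdge_vertexPerm_self]
  have hva : p.vertexPerm a = a := by
    have := vertexPerm_solid p a
    rwa [hfa.solid, hfa.dashed] at this
  have hvb : p.vertexPerm b = b := by
    have := vertexPerm_solid p b
    rwa [hfb.solid, hfb.dashed] at this
  have hmem : ∀ x ∈ p.inner, p.vertexPerm x ∈ p.inner :=
    fun x hx => hp.vertexPerm_mem_inner (T := T) (τ := swap t j * τ) (fun z hz => by
      rw [Perm.mul_apply, hτ z hz, swap_apply_of_ne_of_ne (ne_of_mem_of_not_mem ht hz).symm
        (ne_of_mem_of_not_mem hj hz).symm]) hx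
  have hinner : (p.tie t j a b).inner = insert a (insert b p.inner) := rfl
  have hdisj : ∀ x ∈ (p.tie t j a b).inner, x ∉ T := by
    intro x hx
    rw [hinner, Finset.mem_insert, Finset.mem_insert] at hx
    rcases hx with rfl | rfl | hx
    · exact haT
    · exact hbT
    · exact hp.disj x hx
  have hfix : ∀ x, x ∉ T → swap t j x = x := fun x hx =>
    swap_apply_of_ne_of_ne (fun e => hx (e ▸ ht)) (fun e => hx (e ▸ hj))
  -- on the inner edges the exchange of the leaves is not visible
  have hv' : ∀ x ∈ (p.tie t j a b).inner, (p.tie t j a b).vertexPerm x =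
      (p.vertexPerm * swap a b) x ∧ (p.vertexPerm * swap a b) x ∈ (p.tie t j a b).inner := by
    intro x hx
    have key : (p.vertexPerm * swap a b) x ∈ (p.tie t j a b).inner := by
      rw [hinner] at hx ⊢
      rw [Perm.mul_apply]
      rcases Finset.mem_insert.mp hx with rfl | hx
      · rw [swap_apply_left, hvb]
        simp
      · rcases Finset.mem_insert.mp hx with rfl | hx
        · rw [swap_apply_right, hva]
          simp
        · rw [swap_apply_of_ne_of_ne (ne_of_mem_of_not_mem hx ha) (ne_of_mem_of_not_mem hx hb)]
          simp [hmem x hx]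
    refine ⟨?_, key⟩
    rw [hv, mul_assoc, Perm.mul_apply]
    exact hfix _ (hdisj _ key)
  have hr1 : Rooted T p1.inner p1.solid :=
    (Rooted.mul_swap_iff hfb.solid hbT hb hjb).mpr ⟨hp.solid, Or.inl hj⟩
  have hr2 : Rooted T p1.inner p1.dashed :=
    (Rooted.mul_swap_iff hfb.dashed hbT hb hjb).mpr ⟨hp.dashed, Or.inl hj⟩
  refine ⟨⟨hdisj, ?_, ?_, ?_, ?_⟩, ⟨?_, ?_, ?_⟩, ?_, ?_⟩
  · exact (Rooted.mul_swap_iff h1a.solid haT h1a.notMem hta).mpr ⟨hr1, Or.inl ht⟩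
  · exact Rooted.conj_swap ((Rooted.mul_swap_iff h1a.dashed haT h1a.notMem hta).mpr
      ⟨hr2, Or.inl ht⟩) ht hj hdisj
  · intro i hi
    rw [hv, Perm.mul_apply, Perm.mul_apply, swap_apply_of_ne_of_ne (ne_of_mem_of_not_mem hi haT)
      (ne_of_mem_of_not_mem hi hbT), hp.target i hi, Perm.mul_apply, swap_apply_self]
  · intro x hx
    rw [(hv' x hx).1, Perm.mul_apply]
    rw [hinner] at hx
    rcases Finset.mem_insert.mp hx with rfl | hx
    · rw [swap_apply_left, hvb]
      exact hab.symm
    · rcases Finset.mem_insert.mp hx with rfl | hx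
      · rw [swap_apply_right, hva]
        exact hab
      · rw [swap_apply_of_ne_of_ne (ne_of_mem_of_not_mem hx ha) (ne_of_mem_of_not_mem hx hb)]
        exact hp.ne x hx
  · change p2.solid t ∈ _
    rw [hst, hinner]
    exact Finset.mem_insert_self _ _
  · have h : (p.tie t j a b).dashed t = b := by
      change swap t j (p2.dashed (swap t j t)) = b
      rw [swap_apply_left, hdj, hfix _ hbT]
    have h' : b ∈ (p.tie t j a b).inner := by simp [hinner]
    rw [h, (hv' b h').1, Perm.mul_apply, swap_apply_right, hva]
    exact hst.symm
  · change p2.solid⁻¹ (swap t j (p2.dashed (swap t j t))) = j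
    rw [swap_apply_left, hdj, hfix _ hbT, Perm.inv_eq_iff_eq, hsj]
  · rw [numVertices, numCycles_eqOn (fun x hx => (hv' x hx).1)
      (fun x hx => by rw [(hv' x hx).1]; exact (hv' x hx).2), hinner,
      numCycles_mul_swap_insert hva (by simp [hab, ha]) (Finset.mem_insert_self _ _),
      numCycles_insert_of_fixed hvb hb]
    rfl
  · have h1 : (p.tie t j a b).solid t = a := hst
    have h2 : (p.tie t j a b).solid j = b := hsj
    rw [untie, h1, h2, tie, twist_twist, eraseEdge_insertEdge h1a.notMem,
      eraseEdge_insertEdge hb]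

theorem untie_spec (hq : q.IsDiagram T τ) (h : q.TiedTo t j) :
    (q.untie t j).IsDiagram T (swap t j * τ) ∧ q.solid t ∉ (q.untie t j).inner ∧
      q.solid j ∉ (q.untie t j).inner ∧ q.solid t ∉ T ∧ q.solid j ∉ T ∧ q.solid t ≠ q.solid j ∧
      (q.untie t j).tie t j (q.solid t) (q.solid j) = q := by
  have hb := hq.dashed_mem_inner hτ h.mem
  have hne := hq.dashed_ne_solid h.mem
  have ha := h.mem
  have heq := h.eq
  have hjb : q.solid j = q.dashed t := by rw [← h.opp, apply_inv_self']
  have hdj : q.dashed j = q.solid t := by rw [← vertexPerm_solid, hjb, heq]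
  rw [← hjb] at hb hne heq
  set a := q.solid t with hadef
  set b := q.solid j with hbdef
  have haT := hq.disj a ha
  have hbT := hq.disj b hb
  have hta : t ≠ a := ne_of_mem_of_not_mem ht haT
  have htb : t ≠ b := ne_of_mem_of_not_mem ht hbT
  have hja : j ≠ a := ne_of_mem_of_not_mem hj haT
  have hjb' : j ≠ b := ne_of_mem_of_not_mem hj hbT
  have hfix : ∀ x, x ∉ T → swap t j x = x := fun x hx =>
    swap_apply_of_ne_of_ne (fun e => hx (e ▸ ht)) (fun e => hx (e ▸ hj))
  set r := q.twist t j with hr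
  set p1 := r.eraseEdge a t t with hp1
  have hp : q.untie t j = p1.eraseEdge b j j := rfl
  set p := q.untie t j with hpdef
  have hrdt : r.dashed t = a := by
    change swap t j (q.dashed (swap t j t)) = a
    rw [swap_apply_left, hdj, hfix _ haT]
  have hrdj : r.dashed j = b := by
    change swap t j (q.dashed (swap t j j)) = b
    rw [swap_apply_right, ← hjb, hfix _ hbT]
  have hbp1 : b ∈ p1.inner := Finset.mem_erase.mpr ⟨hne, hb⟩
  have hins1 : p1.insertEdge a t t = r := insertEdge_eraseEdge (p := r) ha t t
  have hins2 : p.insertEdge b j j = p1 := insertEdge_eraseEdge hbp1 j j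
  have htie : p.tie t j a b = q := by rw [tie, hins2, hins1, hr, twist_twist]
  have hap1 : a ∉ p1.inner := Finset.notMem_erase _ _
  have hbp : b ∉ p.inner := Finset.notMem_erase _ _
  have hap : a ∉ p.inner := fun e => hap1 (Finset.mem_of_mem_erase e)
  have h1s : p1.solid a = a := by
    change q.solid (swap a t a) = a
    rw [swap_apply_left]
  have h1d : p1.dashed a = a := by
    change r.dashed (swap a t a) = a
    rw [swap_apply_left, hrdt]
  have h2s : p.solid b = b := by
    change q.solid (swap a t (swap b j b)) = b
    rw [swap_apply_left, swap_apply_of_ne_of_ne hja htj]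
  have h2d : p.dashed b = b := by
    change r.dashed (swap a t (swap b j b)) = b
    rw [swap_apply_left, swap_apply_of_ne_of_ne hja htj, hrdj]
  have hv : p.vertexPerm = swap t j * q.vertexPerm * swap a b := by
    rw [← insertEdge_vertexPerm_self b j p, hins2, ← insertEdge_vertexPerm_self a t p1, hins1,
      hr, twist_vertexPerm]
  have hr1 : Rooted T p1.inner p1.solid := by
    refine ((Rooted.mul_swap_iff h1s haT hap1 hta).mp ?_).1
    have := hq.solid
    change Rooted T r.inner r.solid at this
    rwa [← hins1] at this
  have hr2 : Rooted T p1.inner p1.dashed := by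
    refine ((Rooted.mul_swap_iff h1d haT hap1 hta).mp ?_).1
    have := Rooted.conj_swap hq.dashed ht hj hq.disj
    change Rooted T r.inner r.dashed at this
    rwa [← hins1] at this
  have hsub : ∀ x ∈ p.inner, x ∈ q.inner := fun x hx =>
    Finset.mem_of_mem_erase (Finset.mem_of_mem_erase hx)
  refine ⟨⟨?_, ?_, ?_, ?_, ?_⟩, hap, hbp, haT, hbT, hne.symm, htie⟩
  · exact fun x hx => hq.disj x (hsub x hx)
  · refine ((Rooted.mul_swap_iff h2s hbT hbp hjb').mp ?_).1
    rwa [← hins2] at hr1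
  · refine ((Rooted.mul_swap_iff h2d hbT hbp hjb').mp ?_).1
    rwa [← hins2] at hr2
  · intro i hi
    rw [hv, Perm.mul_apply, Perm.mul_apply, swap_apply_of_ne_of_ne (ne_of_mem_of_not_mem hi haT)
      (ne_of_mem_of_not_mem hi hbT), hq.target i hi, Perm.mul_apply]
  · intro x hx
    rw [hv, Perm.mul_apply, Perm.mul_apply, swap_apply_of_ne_of_ne (ne_of_mem_of_not_mem hx hap)
      (ne_of_mem_of_not_mem hx hbp),
      hfix _ (hq.disj _ (hq.vertexPerm_mem_inner hτ (hsub x hx)))]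
    exact hq.ne x (hsub x hx)

end Tie

end PermPair

end Untying

/-! ### The recursion for the number of diagrams -/

section Recursion

open Equiv

variable {Ω : Type*}

namespace PermPair

variable [DecidableEq Ω] {T : Finset Ω} {τ : Perm Ω} {p q : PermPair Ω} {t j : Ω}

/-- The diagrams with a given number `n` of inner edges and `v` of internal vertices. -/
def diagrams (T : Finset Ω) (τ : Perm Ω) (n v : ℕ) : Set (PermPair Ω) :=
  {p | p.IsDiagram T τ ∧ p.inner.card = n ∧ p.numVertices = v}

/-- The number of isomorphism classes of diagrams with the property `P`. -/
noncomputable def numClasses (T : Finset Ω) (P : Set (PermPair Ω)) : ℕ :=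
  (Quotient.mk (isoSetoid T) '' P).ncard

/-- Up to isomorphism, the set of inner edges can be prescribed. -/
theorem exists_map_inner_eq (hp : p.IsDiagram T τ) {X : Finset Ω} (hX : ∀ x ∈ X, x ∉ T)
    (hcard : p.inner.card = X.card) :
    ∃ π : Perm Ω, (∀ j ∈ T, π j = j) ∧ (p.map π).inner = X := by
  have e := Finset.equivOfCardEq hcard
  obtain ⟨π, hπ⟩ := exists_perm_extending (T ∪ p.inner)
    (fun z => if h : z ∈ p.inner then (e ⟨z, h⟩ : Ω) else z) (by
      intro z hz w hw hzw
      simp only [Finset.coe_union, Set.mem_union, Finset.mem_coe] at hz hw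
      by_cases hz' : z ∈ p.inner <;> by_cases hw' : w ∈ p.inner <;>
        simp only [hz', hw', dif_pos, dif_neg, not_false_eq_true] at hzw
      · simpa using e.injective (Subtype.ext hzw)
      · exact absurd (hw.resolve_right hw') (hzw ▸ hX _ (e ⟨z, hz'⟩).2)
      · exact absurd (hz.resolve_right hz') (hzw ▸ hX _ (e ⟨w, hw'⟩).2)
      · exact hzw)
  refine ⟨π, fun j hj => ?_, ?_⟩
  · rw [hπ j (Finset.mem_union_left _ hj), dif_neg (fun h => hp.disj j h hj)]
  · refine Finset.eq_of_subset_of_card_le (fun z hz => ?_) (by rw [card_inner_map, hcard])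
    obtain ⟨x, hx, rfl⟩ := Finset.mem_image.mp hz
    rw [hπ x (Finset.mem_union_right _ hx), dif_pos hx]
    exact (e ⟨x, hx⟩).2

omit [DecidableEq Ω] in
theorem finite_perms_fixing_compl (A : Finset Ω) :
    {γ : Perm Ω | ∀ z, z ∉ A → γ z = z}.Finite := by
  classical
  refine (Set.finite_range fun e : Perm A => Perm.ofSubtype e).subset ?_
  intro γ hγ
  refine ⟨γ.subtypePerm fun x => ?_, Perm.ofSubtype_subtypePerm _ fun x hx => ?_⟩
  · constructor
    · intro h
      by_contra hc
      exact hc (hγ x hc ▸ h)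
    · intro h
      by_contra hc
      exact hc ((γ.injective (hγ _ hc)).symm ▸ h)
  · by_contra hc
    exact hx (hγ x hc)

theorem mem_diagrams_map (hτ : ∀ z, z ∉ T → τ z = z) {n v : ℕ} (hp : p ∈ diagrams T τ n v)
    {π : Perm Ω} (hπ : ∀ j ∈ T, π j = j) : p.map π ∈ diagrams T τ n v :=
  ⟨hp.1.map hτ hπ, by rw [card_inner_map, hp.2.1], by rw [numVertices_map, hp.2.2]⟩

/-- There are finitely many isomorphism classes because the inner edges may be taken from a fixed
set, and both permutations are the identity apart from these and the edges at the leaves. -/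
theorem finite_classes [Infinite Ω] (hτ : ∀ z, z ∉ T → τ z = z) (n v : ℕ) :
    (Quotient.mk (isoSetoid T) '' diagrams T τ n v).Finite := by
  obtain ⟨X, hX, hXn⟩ := (T.finite_toSet.infinite_compl).exists_subset_card_eq n
  have hX' : ∀ x ∈ X, x ∉ T := fun x hx => by simpa using hX hx
  have hfin : {p : PermPair Ω | p.inner = X ∧ (∀ z, z ∉ T ∪ X → p.solid z = z) ∧
      ∀ z, z ∉ T ∪ X → p.dashed z = z}.Finite := by
    have h := finite_perms_fixing_compl (T ∪ X)
    refine ((h.prod h).image fun s => (⟨X, s.1, s.2⟩ : PermPair Ω)).subset ?_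
    rintro ⟨i, s, d⟩ ⟨rfl, hs, hd⟩
    exact ⟨(s, d), ⟨hs, hd⟩, rfl⟩
  refine (hfin.image (Quotient.mk (isoSetoid T))).subset ?_
  rintro _ ⟨p, hp, rfl⟩
  obtain ⟨π, hπ, hi⟩ := exists_map_inner_eq hp.1 hX' (hp.2.1.trans hXn.symm)
  have hq := mem_diagrams_map hτ hp hπ
  refine ⟨p.map π, ⟨hi, fun z hz => ?_, fun z hz => ?_⟩,
    Quotient.sound ((isoSetoid T).symm ⟨π, hπ, rfl⟩)⟩
  · rw [Finset.mem_union, not_or] at hz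
    exact hq.1.solid.fixed z hz.1 (hi ▸ hz.2)
  · rw [Finset.mem_union, not_or] at hz
    exact hq.1.dashed.fixed z hz.1 (hi ▸ hz.2)

section Invariance

variable {π : Perm Ω}

theorem map_solid_apply_fixed (ht : π t = t) (p : PermPair Ω) :
    (p.map π).solid t = π (p.solid t) := by rw [← map_solid_apply, ht]

theorem map_dashed_apply_fixed (ht : π t = t) (p : PermPair Ω) :
    (p.map π).dashed t = π (p.dashed t) := by rw [← map_dashed_apply, ht]

end Invariance

theorem solid_eq_self_of_iso (ht : t ∈ T) (h : Iso T p q) (hp : p.solid t = t) :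
    q.solid t = t := by
  obtain ⟨π, hπ, rfl⟩ := h
  rw [map_solid_apply_fixed (hπ t ht), hp, hπ t ht]

theorem vertexPerm_dashed_eq_of_iso (ht : t ∈ T) (h : Iso T p q)
    (hp : p.vertexPerm (p.dashed t) = p.solid t) : q.vertexPerm (q.dashed t) = q.solid t := by
  obtain ⟨π, hπ, rfl⟩ := h
  rw [map_solid_apply_fixed (hπ t ht), map_dashed_apply_fixed (hπ t ht), map_vertexPerm_apply, hp]

theorem opp_mem_of_iso (ht : t ∈ T) (h : Iso T p q)
    (hp : p.solid⁻¹ (p.dashed t) ∈ p.inner) : q.solid⁻¹ (q.dashed t) ∈ q.inner := by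
  obtain ⟨π, hπ, rfl⟩ := h
  rwa [map_dashed_apply_fixed (hπ t ht), map_solid_inv_apply, mem_map_inner]

theorem opp_eq_of_iso (ht : t ∈ T) (hj : j ∈ T) (h : Iso T p q)
    (hp : p.solid⁻¹ (p.dashed t) = j) : q.solid⁻¹ (q.dashed t) = j := by
  obtain ⟨π, hπ, rfl⟩ := h
  rw [map_dashed_apply_fixed (hπ t ht), map_solid_inv_apply, hp, hπ j hj]

/-- Contraction is a bijection of isomorphism classes. It lowers the numbers of edges and of
internal vertices by one. -/
theorem numClasses_contractible [Infinite Ω] (hτ : ∀ z, z ∉ T → τ z = z) (ht : t ∈ T)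
    (n v : ℕ) :
    numClasses T {p | p ∈ diagrams T τ n v ∧ p.AtLargeVertex t} =
      numClasses T {q | q ∈ diagrams T τ (n + 1) (v + 1) ∧ q.AtContractibleVertex t} := by
  refine ncard_classes_eq _ _ (fun p q => ∃ y, y ∉ T ∧ y ∉ p.inner ∧ q = p.expand t y) ?_ ?_ ?_
  · rintro p ⟨⟨hp, hn, hv⟩, hl⟩
    obtain ⟨y, hy⟩ := Infinite.exists_notMem_finset (T ∪ p.inner)
    rw [Finset.mem_union, not_or] at hy
    obtain ⟨h1, h2, h3, -⟩ := expand_spec hτ ht hp hl hy.1 hy.2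
    refine ⟨_, ⟨⟨h1, ?_, by rw [h3, hv]⟩, h2⟩, y, hy.1, hy.2, rfl⟩
    rw [← hn]
    exact Finset.card_insert_of_notMem hy.2
  · rintro q ⟨⟨hq, hn, hv⟩, hc⟩
    obtain ⟨h1, h2, h3, h4⟩ := contract_spec hτ ht hq hc
    have hyT := hq.disj _ hc.opp_mem
    refine ⟨q.contract t, ⟨⟨h1, ?_, ?_⟩, h2⟩, _, hyT, h3, h4.symm⟩
    · have := Finset.card_erase_add_one hc.opp_mem
      rw [hn] at this
      exact Nat.succ_injective this
    · have := (expand_spec hτ ht h1 h2 hyT h3).2.2.1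
      rw [h4, hv] at this
      exact (Nat.succ_injective this).symm
  · rintro p ⟨⟨hp, -, -⟩, hl⟩ q - p' ⟨⟨hp', -, -⟩, hl'⟩ q' - ⟨y, hyT, hy, rfl⟩ ⟨y', hyT', hy', rfl⟩
    constructor
    · rintro ⟨π, hπ, rfl⟩
      have hf := hp.fresh hyT hy
      have hf' := hp'.fresh hyT' hy'
      have h1 : (p.map π).solid⁻¹ ((p.map π).dashed t) = π (p.solid⁻¹ (p.dashed t)) := by
        rw [map_dashed_apply_fixed (hπ t ht), map_solid_inv_apply]
      have h2 : (p.map π).dashed⁻¹ ((p.map π).solid t) = π (p.dashed⁻¹ (p.solid t)) := by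
        rw [map_solid_apply_fixed (hπ t ht), map_dashed_inv_apply]
      have key : ∀ {p : PermPair Ω} {y : Ω}, p.IsDiagram T τ → p.AtLargeVertex t → y ∉ T →
          y ∉ p.inner → p.solid⁻¹ (p.dashed t) ≠ y ∧ p.dashed⁻¹ (p.solid t) ≠ y := by
        intro p y hp hl hyT hy
        constructor
        · rintro rfl
          exact (hp.solid.inv_apply_mem (Or.inr (hp.dashed_mem_inner hτ hl.mem))).elim hyT hy
        · rintro rfl
          exact (hp.dashed.inv_apply_mem (Or.inr hl.mem)).elim hyT hy
      have h3 := key hp hl hyT hy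
      have h4 := key hp' hl' hyT' hy'
      rw [h1, h2] at h4
      change Iso T (p.expand t y) ((p.map π).expand t y')
      rw [expand, expand, h1, h2]
      exact insertEdge_iso hπ rfl hf hyT hf' hyT' h3.1 h3.2 h4.1 h4.2
    · rintro ⟨π, hπ, h⟩
      refine ⟨π, hπ, ?_⟩
      rw [← (expand_spec hτ ht hp hl hyT hy).2.2.2, contract_map (hπ t ht), h,
        (expand_spec hτ ht hp' hl' hyT' hy').2.2.2]

/-- Untying two leaves from a common vertex of degree four is a bijection of isomorphism
classes. -/
theorem numClasses_tied [Infinite Ω] (hτ : ∀ z, z ∉ T → τ z = z) (ht : t ∈ T) (hj : j ∈ T)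
    (htj : j ≠ t) (n v : ℕ) :
    numClasses T (diagrams T (swap t j * τ) n v) =
      numClasses T {q | q ∈ diagrams T τ (n + 2) (v + 1) ∧ q.TiedTo t j} := by
  refine ncard_classes_eq _ _ (fun p q => ∃ a b, a ∉ T ∧ b ∉ T ∧ a ∉ p.inner ∧ b ∉ p.inner ∧
    a ≠ b ∧ q = p.tie t j a b) ?_ ?_ ?_
  · rintro p ⟨hp, hn, hv⟩
    obtain ⟨a, ha⟩ := Infinite.exists_notMem_finset (T ∪ p.inner)
    obtain ⟨b, hb⟩ := Infinite.exists_notMem_finset (insert a (T ∪ p.inner))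
    rw [Finset.mem_union, not_or] at ha
    rw [Finset.mem_insert, not_or, Finset.mem_union, not_or] at hb
    have hab : a ≠ b := fun e => hb.1 e.symm
    obtain ⟨h1, h2, h3, -⟩ := tie_spec hτ ht hj htj hp ha.1 hb.2.1 ha.2 hb.2.2 hab
    refine ⟨_, ⟨⟨h1, ?_, by rw [h3, hv]⟩, h2⟩, a, b, ha.1, hb.2.1, ha.2, hb.2.2, hab, rfl⟩
    change (insert a (insert b p.inner)).card = n + 2
    rw [Finset.card_insert_of_notMem (by simp [hab, ha.2]), Finset.card_insert_of_notMem hb.2.2,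
      hn]
  · rintro q ⟨⟨hq, hn, hv⟩, hc⟩
    obtain ⟨h1, h2, h3, h4, h5, h6, h7⟩ := untie_spec hτ ht hj htj hq hc
    refine ⟨q.untie t j, ⟨h1, ?_, ?_⟩, _, _, h4, h5, h2, h3, h6, h7.symm⟩
    · have h8 : (insert (q.solid t) (insert (q.solid j) (q.untie t j).inner)).card = n + 2 := by
        rw [← hn]
        conv_rhs => rw [← h7]
        rfl
      rw [Finset.card_insert_of_notMem (by simp [h6, h2]), Finset.card_insert_of_notMem h3] at h8
      omega
    · have := (tie_spec hτ ht hj htj h1 h4 h5 h2 h3 h6).2.2.1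
      rw [h7, hv] at this
      exact (Nat.succ_injective this).symm
  · rintro p ⟨hp, -, -⟩ q - p' ⟨hp', -, -⟩ q' - ⟨a, b, haT, hbT, ha, hb, hab, rfl⟩
      ⟨a', b', haT', hbT', ha', hb', hab', rfl⟩
    constructor
    · rintro ⟨π, hπ, hpp'⟩
      have hne : ∀ {x i : Ω}, x ∉ T → i ∈ T → i ≠ x := fun hx hi => ne_of_mem_of_not_mem hi hx
      have h1 : Iso T (p.insertEdge b j j) (p'.insertEdge b' j j) := by
        have := insertEdge_iso (u := j) (w := j) hπ hpp' (hp.fresh hbT hb) hbT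
          (hp'.fresh hbT' hb') hbT' (hne hbT hj) (hne hbT hj) (by rw [hπ j hj]; exact hne hbT' hj)
          (by rw [hπ j hj]; exact hne hbT' hj)
        rwa [hπ j hj] at this
      have fresh_insert : ∀ {p : PermPair Ω} {a b : Ω}, p.IsDiagram T (swap t j * τ) → a ∉ T →
          a ∉ p.inner → a ≠ b → (p.insertEdge b j j).Fresh a := by
        intro p a b hp haT ha hab
        have hf := hp.fresh haT ha
        refine ⟨by simp [insertEdge, hab, ha], ?_, ?_⟩
        · change p.solid (swap b j a) = a
          rw [swap_apply_of_ne_of_ne hab (hne haT hj).symm, hf.solid]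
        · change p.dashed (swap b j a) = a
          rw [swap_apply_of_ne_of_ne hab (hne haT hj).symm, hf.dashed]
      obtain ⟨π₁, hπ₁, h1⟩ := h1
      have h2 : Iso T ((p.insertEdge b j j).insertEdge a t t)
          ((p'.insertEdge b' j j).insertEdge a' t t) := by
        have := insertEdge_iso (u := t) (w := t) hπ₁ h1 (fresh_insert hp haT ha hab) haT
          (fresh_insert hp' haT' ha' hab') haT' (hne haT ht) (hne haT ht)
          (by rw [hπ₁ t ht]; exact hne haT' ht) (by rw [hπ₁ t ht]; exact hne haT' ht)
        rwa [hπ₁ t ht] at this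
      obtain ⟨π₂, hπ₂, h2⟩ := h2
      refine ⟨π₂, hπ₂, ?_⟩
      rw [tie, tie, twist_map (hπ₂ t ht) (hπ₂ j hj), h2]
    · rintro ⟨π, hπ, h⟩
      refine ⟨π, hπ, ?_⟩
      rw [← (tie_spec hτ ht hj htj hp haT hbT ha hb hab).2.2.2, untie_map (hπ t ht) (hπ j hj), h,
        (tie_spec hτ ht hj htj hp' haT' hbT' ha' hb' hab').2.2.2]

/-- The diagrams in which the solid segment of the leaf `t` consists of a single edge are the
diagrams without the leaf `t`. In this case the dashed segment at `t` is also this edge, and `τ`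
fixes `t`. -/
theorem isDiagram_erase_iff (hτ : ∀ z, z ∉ T → τ z = z) (ht : t ∈ T) :
    (p.IsDiagram T τ ∧ p.solid t = t) ↔
      (τ t = t ∧ p.IsDiagram (T.erase t) τ ∧ t ∉ p.inner) := by
  constructor
  · rintro ⟨hp, hs⟩
    have htX : t ∉ p.inner := fun h => hp.disj t h ht
    have hd' : p.dashed t = τ t := by
      rw [← vertexPerm_solid, hs, hp.target t ht]
    have hd : p.dashed t = t :=
      hp.dashed.eq_of_apply_mem ht (hd' ▸ apply_mem_of_fixes hτ ht)
    exact ⟨hd'.symm.trans hd, ⟨fun x hx h => hp.disj x hx (Finset.mem_of_mem_erase h),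
      (Rooted.erase_iff ht hs htX).mpr hp.solid, (Rooted.erase_iff ht hd htX).mpr hp.dashed,
      fun j hj => hp.target j (Finset.mem_of_mem_erase hj), hp.ne⟩, htX⟩
  · rintro ⟨hτt, hp, htX⟩
    have hs : p.solid t = t := hp.solid.fixed t (Finset.notMem_erase _ _) htX
    have hd : p.dashed t = t := hp.dashed.fixed t (Finset.notMem_erase _ _) htX
    refine ⟨⟨fun x hx h => hp.disj x hx (Finset.mem_erase.mpr ⟨fun e => htX (e ▸ hx), h⟩),
      (Rooted.erase_iff ht hs htX).mp hp.solid, (Rooted.erase_iff ht hd htX).mp hp.dashed,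
      fun j hj => ?_, hp.ne⟩, hs⟩
    by_cases hjt : j = t
    · rw [hjt, hτt]
      have := vertexPerm_solid p t
      rwa [hs, hd] at this
    · exact hp.target j (Finset.mem_erase.mpr ⟨hjt, hj⟩)

/-- A leaf `t` that is directly connected to its partner can be removed. -/
theorem numClasses_solid_eq_self [Infinite Ω] (hτ : ∀ z, z ∉ T → τ z = z) (ht : t ∈ T)
    (n v : ℕ) :
    numClasses T {p | p ∈ diagrams T τ n v ∧ p.solid t = t} =
      if τ t = t then numClasses (T.erase t) (diagrams (T.erase t) τ n v) else 0 := by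
  split_ifs with hτt
  · have hτ' : ∀ z, z ∉ T.erase t → τ z = z := by
      intro z hz
      by_cases hzt : z = t
      · rw [hzt, hτt]
      · exact hτ z fun h => hz (Finset.mem_erase.mpr ⟨hzt, h⟩)
    symm
    refine ncard_classes_eq _ _ (Iso (T.erase t)) ?_ ?_ ?_
    · intro p hp
      obtain ⟨X, hX, hXn⟩ := (T.finite_toSet.infinite_compl).exists_subset_card_eq n
      have hX' : ∀ x ∈ X, x ∉ T := fun x hx => by simpa using hX hx
      obtain ⟨π, hπ, hi⟩ := exists_map_inner_eq hp.1
        (fun x hx h => hX' x hx (Finset.mem_of_mem_erase h)) (hp.2.1.trans hXn.symm)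
      have hq := mem_diagrams_map hτ' hp hπ
      have := (isDiagram_erase_iff hτ ht).mpr ⟨hτt, hq.1, fun h => hX' t (hi ▸ h) ht⟩
      exact ⟨p.map π, ⟨⟨this.1, hq.2⟩, this.2⟩, π, hπ, rfl⟩
    · rintro q ⟨hq, hqt⟩
      exact ⟨q, ⟨((isDiagram_erase_iff hτ ht).mp ⟨hq.1, hqt⟩).2.1, hq.2⟩,
        (isoSetoid (T.erase t)).refl q⟩
    · rintro p - q ⟨hq, hqt⟩ p' - q' ⟨hq', hqt'⟩ hpq hpq'
      have hf : ∀ {q : PermPair Ω}, q ∈ diagrams T τ n v → q.solid t = t → q.Fresh t := by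
        intro q hq hqt
        have := (isDiagram_erase_iff hτ ht).mp ⟨hq.1, hqt⟩
        exact this.2.1.fresh (Finset.notMem_erase _ _) this.2.2
      constructor
      · intro h
        obtain ⟨π, hπ, hqq⟩ := (hpq.symm.trans h).trans hpq'
        obtain ⟨π', h1, h2, h3⟩ := exists_map_eq_of_fresh hqq (hf hq hqt) (hf hq' hqt')
        refine ⟨π', fun j hj => ?_, h1⟩
        by_cases hjt : j = t
        · rw [hjt, h2]
        · have hπj := hπ j (Finset.mem_erase.mpr ⟨hjt, hj⟩)
          rw [h3 j hjt (by rwa [hπj]), hπj]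
      · rintro ⟨π, hπ, hqq⟩
        exact (hpq.trans ⟨π, fun j hj => hπ j (Finset.mem_of_mem_erase hj), hqq⟩).trans hpq'.symm
  · have : {p | p ∈ diagrams T τ n v ∧ p.solid t = t} = ∅ := by
      rw [Set.eq_empty_iff_forall_notMem]
      rintro p ⟨hp, hpt⟩
      exact hτt ((isDiagram_erase_iff hτ ht).mp ⟨hp.1, hpt⟩).1
    rw [this, numClasses, Set.image_empty, Set.ncard_empty]

/-- The number of isomorphism classes of diagrams with `n` inner edges and `v` internal
vertices. -/
noncomputable def numDiagrams (T : Finset Ω) (τ : Perm Ω) (n v : ℕ) : ℕ :=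
  numClasses T (diagrams T τ n v)

/-- Either the leaf `t` is directly connected to its partner, or it sits at an internal vertex.
There, either the degree is more than four, or the opposite edge leads to an internal vertex, or the
opposite edge leads to another leaf `j`. -/
theorem numDiagrams_eq_cases [Infinite Ω] (hτ : ∀ z, z ∉ T → τ z = z) (ht : t ∈ T) (n v : ℕ) :
    numDiagrams T τ n v =
      (if τ t = t then numDiagrams (T.erase t) τ n v else 0) +
      (numClasses T {p | p ∈ diagrams T τ n v ∧ p.AtLargeVertex t} +
      (numClasses T {p | p ∈ diagrams T τ n v ∧ p.AtContractibleVertex t} +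
      ∑ j ∈ T.erase t, numClasses T {p | p ∈ diagrams T τ n v ∧ p.TiedTo t j})) := by
  have hfin := finite_classes hτ n v
  have hmem : ∀ {p : PermPair Ω}, p.IsDiagram T τ → (¬ p.solid t = t ↔ p.solid t ∈ p.inner) := by
    intro p hp
    constructor
    · intro h
      exact (hp.solid.apply_mem (Or.inl ht)).resolve_left fun h' =>
        h (hp.solid.eq_of_apply_mem ht h')
    · intro h e
      exact hp.disj _ h (e.symm ▸ ht)
  have e1 := ncard_classes_add (isoSetoid T) (fun p : PermPair Ω => p.solid t = t) hfin
    (fun p q h => solid_eq_self_of_iso ht h)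
  have hfin1 : (Quotient.mk (isoSetoid T) ''
      {p | p ∈ diagrams T τ n v ∧ ¬ p.solid t = t}).Finite :=
    hfin.subset (Set.image_mono fun p hp => hp.1)
  have e2 := ncard_classes_add (isoSetoid T)
    (fun p : PermPair Ω => ¬ p.vertexPerm (p.dashed t) = p.solid t) hfin1
    (fun p q h h1 h2 => h1 (vertexPerm_dashed_eq_of_iso ht h.symm h2))
  have hfin2 : (Quotient.mk (isoSetoid T) ''
      {p | p ∈ {p | p ∈ diagrams T τ n v ∧ ¬ p.solid t = t} ∧
        ¬¬ p.vertexPerm (p.dashed t) = p.solid t}).Finite :=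
    hfin1.subset (Set.image_mono fun p hp => hp.1)
  have e3 := ncard_classes_add (isoSetoid T)
    (fun p : PermPair Ω => p.solid⁻¹ (p.dashed t) ∈ p.inner) hfin2
    (fun p q h => opp_mem_of_iso ht h)
  rw [numDiagrams, numClasses, e1, e2, e3]
  have e4 : ∑ j ∈ T.erase t, numClasses T {p | p ∈ diagrams T τ n v ∧ p.TiedTo t j} =
      (Quotient.mk (isoSetoid T) '' {p | p ∈ diagrams T τ n v ∧
        ∃ j ∈ T.erase t, j ∈ T ∧ p.TiedTo t j}).ncard := by
    rw [ncard_classes_sum (isoSetoid T) (T.erase t) (fun j p => j ∈ T ∧ p.TiedTo t j) hfin]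
    · refine Finset.sum_congr rfl fun j hj => ?_
      rw [numClasses]
      congr 3
      ext p
      have := Finset.mem_of_mem_erase hj
      tauto
    · rintro j p q hpq ⟨hj, h1, h2, h3⟩
      have h4 : Iso T p q := hpq
      refine ⟨hj, ?_, vertexPerm_dashed_eq_of_iso ht hpq h2, opp_eq_of_iso ht hj hpq h3⟩
      obtain ⟨π, hπ, rfl⟩ := h4
      rwa [map_solid_apply_fixed (hπ t ht), mem_map_inner]
    · rintro i j p ⟨-, hi⟩ ⟨-, hj⟩
      exact hi.opp.symm.trans hj.opp
  rw [e4]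
  congr 1
  · exact numClasses_solid_eq_self hτ ht n v
  congr 1
  · rw [numClasses]
    congr 2
    ext p
    simp only [Set.mem_ofPred_eq]
    constructor
    · rintro ⟨⟨hp, h1⟩, h2⟩
      exact ⟨hp, (hmem hp.1).mp h1, h2⟩
    · rintro ⟨hp, h1, h2⟩
      exact ⟨⟨hp, (hmem hp.1).mpr h1⟩, h2⟩
  congr 1
  · rw [numClasses]
    congr 2
    ext p
    simp only [Set.mem_ofPred_eq, not_not]
    constructor
    · rintro ⟨⟨⟨hp, h1⟩, h2⟩, h3⟩
      exact ⟨hp, (hmem hp.1).mp h1, h2, h3⟩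
    · rintro ⟨hp, h1, h2, h3⟩
      exact ⟨⟨⟨hp, (hmem hp.1).mpr h1⟩, h2⟩, h3⟩
  · congr 2
    ext p
    simp only [Set.mem_ofPred_eq, not_not]
    constructor
    · rintro ⟨⟨⟨hp, h1⟩, h2⟩, h3⟩
      have h4 := (hmem hp.1).mp h1
      have h5 := (hp.1.solid.inv_apply_mem
        (Or.inr (hp.1.dashed_mem_inner hτ h4))).resolve_right h3
      refine ⟨hp, _, Finset.mem_erase.mpr ⟨fun e => ?_, h5⟩, h5, h4, h2, rfl⟩
      rw [Perm.inv_eq_iff_eq] at e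
      exact hp.1.dashed_ne_solid h4 e
    · rintro ⟨hp, j, -, hjT, h1, h2, h3⟩
      exact ⟨⟨⟨hp, (hmem hp.1).mpr h1⟩, h2⟩, fun h => hp.1.disj _ h (h3 ▸ hjT)⟩

/-- Two edges or more start at every internal vertex, and they are all inner edges. -/
theorem two_mul_le_of_mem_diagrams (hτ : ∀ z, z ∉ T → τ z = z) {n v : ℕ}
    (hp : p ∈ diagrams T τ n v) : 2 * v ≤ n := by
  rw [← hp.2.1, ← hp.2.2]
  exact two_mul_numCycles_le (fun x hx => hp.1.vertexPerm_mem_inner hτ hx) hp.1.ne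

theorem numDiagrams_eq_zero (hτ : ∀ z, z ∉ T → τ z = z) {n v : ℕ} (h : n < 2 * v) :
    numDiagrams T τ n v = 0 := by
  have : diagrams T τ n v = ∅ := by
    rw [Set.eq_empty_iff_forall_notMem]
    intro p hp
    have := two_mul_le_of_mem_diagrams hτ hp
    omega
  rw [numDiagrams, numClasses, this, Set.image_empty, Set.ncard_empty]

theorem numClasses_eq_zero {P : Set (PermPair Ω)} (h : ∀ p, p ∉ P) : numClasses T P = 0 := by
  rw [numClasses, Set.eq_empty_iff_forall_notMem.mpr h, Set.image_empty, Set.ncard_empty]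

omit [DecidableEq Ω] in
theorem not_mem_diagrams_zero {n : ℕ} (hp : p ∈ diagrams T τ n 0) {x : Ω}
    (hx : x ∈ p.inner) : False := by
  have h := hp.2.2
  unfold numVertices numCycles at h
  rw [Finset.card_eq_zero, Finset.image_eq_empty] at h
  rw [h] at hx
  exact absurd hx (Finset.notMem_empty _)

/-- The sum of the signs `(-1) ^ v` of the diagrams for which the number of inner edges exceeds the
number `v` of internal vertices by `r`. Larger `v` do not occur because internal vertices have
degree at least four. -/
noncomputable def signedCount (T : Finset Ω) (τ : Perm Ω) (r : ℕ) : ℤ :=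
  ∑ v ∈ Finset.range (r + 1), (-1) ^ v * (numDiagrams T τ (v + r) v : ℤ)

theorem signedCount_empty (τ : Perm Ω) (r : ℕ) :
    signedCount ∅ τ r = if r = 0 then 1 else 0 := by
  have key : ∀ p : PermPair Ω, p.IsDiagram ∅ τ ↔ p = ⟨∅, 1, 1⟩ := by
    intro p
    constructor
    · intro hp
      have hi : p.inner = ∅ := by
        rw [Finset.eq_empty_iff_forall_notMem]
        intro x hx
        obtain ⟨j, hj, -⟩ := hp.solid.root x hx
        exact absurd hj (Finset.notMem_empty _)
      ext1
      · exact hi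
      · exact Equiv.ext fun z => hp.solid.fixed z (Finset.notMem_empty _) (by simp [hi])
      · exact Equiv.ext fun z => hp.dashed.fixed z (Finset.notMem_empty _) (by simp [hi])
    · rintro rfl
      refine ⟨by simp, ⟨by simp, by simp, by simp⟩, ⟨by simp, by simp, by simp⟩, by simp, by simp⟩
  have hnum : ∀ n v, numDiagrams (∅ : Finset Ω) τ n v = if n = 0 ∧ v = 0 then 1 else 0 := by
    intro n v
    have h0 : (⟨∅, 1, 1⟩ : PermPair Ω).numVertices = 0 := by
      simp [numVertices, numCycles]
    split_ifs with h
    · obtain ⟨rfl, rfl⟩ := h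
      have : diagrams (∅ : Finset Ω) τ 0 0 = {⟨∅, 1, 1⟩} := by
        ext p
        simp only [diagrams, Set.mem_ofPred_eq, key, Set.mem_singleton_iff]
        constructor
        · exact fun h => h.1
        · rintro rfl
          exact ⟨rfl, rfl, h0⟩
      rw [numDiagrams, numClasses, this, Set.image_singleton, Set.ncard_singleton]
    · refine numClasses_eq_zero ?_
      rintro p ⟨hp, hn, hv⟩
      rw [key] at hp
      subst hp
      exact h ⟨hn.symm, hv.symm.trans h0⟩
  unfold signedCount
  rw [Finset.sum_eq_single 0]
  · rw [hnum]
    simp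
  · intro v _ hv
    rw [hnum, if_neg (fun h => hv h.2)]
    simp
  · simp

/-- The diagrams in which the leaf `t` sits at an internal vertex cancel each other, apart from
those in which another leaf is opposite to it at a vertex of degree four. The cancelling pairs
differ by the contraction of an edge, which changes the number of vertices by one and keeps its
difference from the number of edges. -/
theorem signedCount_cancel [Infinite Ω] (hτ : ∀ z, z ∉ T → τ z = z) (ht : t ∈ T) (r : ℕ) :
    ∑ v ∈ Finset.range (r + 1), ((-1 : ℤ) ^ v *
        (numClasses T {p | p ∈ diagrams T τ (v + r) v ∧ p.AtLargeVertex t} : ℤ) + (-1) ^ v *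
        (numClasses T {p | p ∈ diagrams T τ (v + r) v ∧ p.AtContractibleVertex t} : ℤ)) = 0 := by
  rw [Finset.sum_add_distrib, Finset.sum_range_succ, Finset.sum_range_succ' (fun v => _ * _)]
  have h1 : numClasses T {p | p ∈ diagrams T τ (r + r) r ∧ p.AtLargeVertex t} = 0 := by
    -- these diagrams could be expanded to diagrams with too many internal vertices
    rw [numClasses_contractible hτ ht]
    refine numClasses_eq_zero ?_
    rintro p ⟨hp, -⟩
    have := two_mul_le_of_mem_diagrams hτ hp
    omega
  have h2 : numClasses T {p | p ∈ diagrams T τ (0 + r) 0 ∧ p.AtContractibleVertex t} = 0 := by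
    refine numClasses_eq_zero ?_
    rintro p ⟨hp, h⟩
    exact not_mem_diagrams_zero hp h.mem
  rw [h1, h2]
  have h3 : ∀ v, numClasses T {p | p ∈ diagrams T τ (v + 1 + r) (v + 1) ∧
      p.AtContractibleVertex t} =
      numClasses T {p | p ∈ diagrams T τ (v + r) v ∧ p.AtLargeVertex t} := by
    intro v
    rw [numClasses_contractible hτ ht, show v + 1 + r = v + r + 1 by omega]
  simp only [h3, pow_succ]
  rw [Nat.cast_zero, mul_zero, mul_zero, add_zero, add_zero, ← Finset.sum_add_distrib]
  exact Finset.sum_eq_zero fun v _ => by ring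

theorem signedCount_tied_succ [Infinite Ω] (hτ : ∀ z, z ∉ T → τ z = z) (ht : t ∈ T) (hj : j ∈ T)
    (htj : j ≠ t) (r : ℕ) :
    ∑ v ∈ Finset.range (r + 1 + 1), (-1 : ℤ) ^ v *
        (numClasses T {p | p ∈ diagrams T τ (v + (r + 1)) v ∧ p.TiedTo t j} : ℤ) =
      - signedCount T (swap t j * τ) r := by
  rw [Finset.sum_range_succ']
  have h2 : numClasses T {p | p ∈ diagrams T τ (0 + (r + 1)) 0 ∧ p.TiedTo t j} = 0 := by
    refine numClasses_eq_zero ?_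
    rintro p ⟨hp, h⟩
    exact not_mem_diagrams_zero hp h.mem
  rw [h2, Nat.cast_zero, mul_zero, add_zero, signedCount, ← Finset.sum_neg_distrib]
  refine Finset.sum_congr rfl fun v _ => ?_
  rw [numDiagrams, numClasses_tied hτ ht hj htj, show v + 1 + (r + 1) = v + r + 2 by omega,
    pow_succ]
  ring

theorem signedCount_eq_sum [Infinite Ω] (hτ : ∀ z, z ∉ T → τ z = z) (ht : t ∈ T) (r : ℕ) :
    signedCount T τ r = (if τ t = t then signedCount (T.erase t) τ r else 0) +
      ∑ j ∈ T.erase t, ∑ v ∈ Finset.range (r + 1), (-1 : ℤ) ^ v *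
        (numClasses T {p | p ∈ diagrams T τ (v + r) v ∧ p.TiedTo t j} : ℤ) := by
  have h1 : (if τ t = t then signedCount (T.erase t) τ r else 0) =
      ∑ v ∈ Finset.range (r + 1), (-1 : ℤ) ^ v *
        ((if τ t = t then numDiagrams (T.erase t) τ (v + r) v else 0 : ℕ) : ℤ) := by
    split_ifs <;> simp [signedCount]
  rw [h1, Finset.sum_comm, signedCount]
  refine Eq.trans ?_ (add_zero _)
  rw [← signedCount_cancel hτ ht r, ← Finset.sum_add_distrib, ← Finset.sum_add_distrib]
  refine Finset.sum_congr rfl fun v _ => ?_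
  rw [numDiagrams_eq_cases hτ ht, ← Finset.mul_sum]
  push_cast
  ring

/-- The recursion for the signed numbers of diagrams. -/
theorem signedCount_succ [Infinite Ω] (hτ : ∀ z, z ∉ T → τ z = z) (ht : t ∈ T) (r : ℕ) :
    signedCount T τ (r + 1) = (if τ t = t then signedCount (T.erase t) τ (r + 1) else 0) -
      ∑ j ∈ T.erase t, signedCount T (swap t j * τ) r := by
  rw [signedCount_eq_sum hτ ht, sub_eq_add_neg, ← Finset.sum_neg_distrib]
  congr 1
  refine Finset.sum_congr rfl fun j hj => ?_
  exact signedCount_tied_succ hτ ht (Finset.mem_of_mem_erase hj) (Finset.ne_of_mem_erase hj) r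

/-- The recursion at leading order, to which tied leaves do not contribute. -/
theorem signedCount_zero [Infinite Ω] (hτ : ∀ z, z ∉ T → τ z = z) (ht : t ∈ T) :
    signedCount T τ 0 = if τ t = t then signedCount (T.erase t) τ 0 else 0 := by
  rw [signedCount_eq_sum hτ ht, Finset.sum_eq_zero, add_zero]
  intro j _
  rw [Finset.sum_range_one, numClasses_eq_zero]
  · simp
  · rintro p ⟨hp, h⟩
    exact not_mem_diagrams_zero hp h.mem

end PermPair

end Recursion

/-! ### Labelling the edges of a ribbon graph -/

section Labelling

open Equiv

variable {Ω : Type*} {t : ℕ}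

/-- The edges at the leaves. -/
def leafLabels (s : Fin t ↪ Ω) : Finset Ω := Finset.univ.map s

theorem mem_leafLabels {s : Fin t ↪ Ω} {z : Ω} : z ∈ leafLabels s ↔ ∃ j, s j = z := by
  simp [leafLabels]

theorem apply_mem_leafLabels (s : Fin t ↪ Ω) (j : Fin t) : s j ∈ leafLabels s :=
  mem_leafLabels.mpr ⟨j, rfl⟩

/-- A labelling `lab` of the edges of a ribbon graph with marked sides, under which the graph is
described by the pair of permutations `p`. Both halves of an edge have the same label. -/
structure IsLabelling {H : Type} (s : Fin t ↪ Ω) (p : PermPair Ω) (G : RibbonGraph H)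
    (leaf : Fin t ⊕ Fin t → H) (solid : Set H) (lab : H → Ω) : Prop where
  inj : ∀ h h', lab h = lab h' → (h ∈ solid ↔ h' ∈ solid) → h = h'
  mem : ∀ h, lab h ∈ leafLabels s ∨ lab h ∈ p.inner
  surj : ∀ z, z ∈ leafLabels s ∨ z ∈ p.inner → ∃ h ∈ solid, lab h = z
  edge : ∀ h, lab (G.edge h) = lab h
  two_sides : ∀ h, G.edge h ∈ solid ↔ h ∉ solid
  rot_leaf : ∀ z, G.rot (leaf z) = leaf z
  inl_mem : ∀ j, leaf (Sum.inl j) ∈ solid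
  inr_notMem : ∀ j, leaf (Sum.inr j) ∉ solid
  inl : ∀ j, lab (leaf (Sum.inl j)) = s j
  inr : ∀ j, p.solid (lab (leaf (Sum.inr j))) = s j
  rot_solid : ∀ h ∈ solid, lab h ∈ p.inner → G.rot h ∉ solid ∧ p.dashed (lab (G.rot h)) = lab h
  rot_dashed : ∀ h, h ∉ solid → p.solid (lab h) ∈ p.inner →
    G.rot h ∈ solid ∧ lab (G.rot h) = p.solid (lab h)

theorem exists_pow_eq_self_of_mapsTo {γ : Perm Ω} {A : Finset Ω} (hA : ∀ z ∈ A, γ z ∈ A) {x : Ω}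
    (hx : x ∈ A) : ∃ k : ℕ, 0 < k ∧ (γ ^ k) x = x := by
  have hmem : ∀ n : ℕ, (γ ^ n) x ∈ A := by
    intro n
    induction n with
    | zero => simpa
    | succ n ih => rw [pow_succ', Perm.mul_apply]; exact hA _ ih
  obtain ⟨m, n, hmn, h⟩ := Set.Finite.exists_lt_map_eq_of_forall_mem (t := (A : Set Ω))
    (f := fun n : ℕ => (γ ^ n) x) hmem A.finite_toSet
  refine ⟨n - m, by omega, ?_⟩
  have h1 : γ ^ n = γ ^ m * γ ^ (n - m) := by rw [← pow_add]; congr 1; omega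
  have h2 : (γ ^ m) x = (γ ^ n) x := h
  rw [h1, Perm.mul_apply] at h2
  exact ((γ ^ m).injective h2).symm

/-- A walk that follows a cycle of a rooted permutation from its root returns to the root, and it
has run through the whole cycle by then. -/
theorem exists_chain {H : Type*} {T X : Finset Ω} {γ : Perm Ω} (hγ : Rooted T X γ)
    {w : Perm H} {lab : H → Ω} {D : Set H}
    (hstep : ∀ h ∈ D, γ (lab h) ∈ X → w h ∈ D ∧ lab (w h) = γ (lab h)) {h₀ : H} (hD : h₀ ∈ D)
    (hT : lab h₀ ∈ T) :
    ∃ k : ℕ, 0 < k ∧ (γ ^ k) (lab h₀) = lab h₀ ∧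
      (∀ i < k, (w ^ i) h₀ ∈ D ∧ lab ((w ^ i) h₀) = (γ ^ i) (lab h₀)) ∧
      (∀ i, 0 < i → i < k → (γ ^ i) (lab h₀) ∈ X) ∧
      ∀ z, γ.SameCycle (lab h₀) z → ∃ i < k, (γ ^ i) (lab h₀) = z := by
  classical
  have hex := exists_pow_eq_self_of_mapsTo (γ := γ) (A := T ∪ X) (fun z hz => by
    rw [Finset.mem_union] at hz ⊢; exact hγ.apply_mem hz) (Finset.mem_union_left _ hT)
  set k := Nat.find hex with hk
  have hk0 : 0 < k := (Nat.find_spec hex).1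
  have hkx : (γ ^ k) (lab h₀) = lab h₀ := (Nat.find_spec hex).2
  have hmin : ∀ i, 0 < i → i < k → (γ ^ i) (lab h₀) ≠ lab h₀ := fun i hi hik h =>
    Nat.find_min hex hik ⟨hi, h⟩
  have hmem : ∀ n : ℕ, (γ ^ n) (lab h₀) ∈ T ∨ (γ ^ n) (lab h₀) ∈ X := by
    intro n
    induction n with
    | zero => exact Or.inl hT
    | succ n ih => rw [pow_succ', Perm.mul_apply]; exact hγ.apply_mem ih
  have hX : ∀ i, 0 < i → i < k → (γ ^ i) (lab h₀) ∈ X := by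
    intro i hi hik
    refine (hmem i).resolve_left fun h => hmin i hi hik ?_
    exact (hγ.inj _ hT _ h ⟨i, by simp⟩).symm
  refine ⟨k, hk0, hkx, ?_, hX, ?_⟩
  · intro i
    induction i with
    | zero => intro _; exact ⟨hD, rfl⟩
    | succ i ih =>
      intro hi
      obtain ⟨h1, h2⟩ := ih (by omega)
      have h3 := hX (i + 1) (by omega) hi
      rw [pow_succ', Perm.mul_apply] at h3 ⊢
      rw [← h2] at h3
      obtain ⟨h4, h5⟩ := hstep _ h1 h3
      exact ⟨h4, by rw [h5, h2, pow_succ', Perm.mul_apply]⟩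
  · intro z hz
    have hk' : (0 : ℤ) < k := by exact_mod_cast hk0
    obtain ⟨n, rfl⟩ := hz
    refine ⟨(n % k).toNat, ?_, ?_⟩
    · have := Int.emod_lt_of_pos n hk'
      have := Int.emod_nonneg n hk'.ne'
      omega
    · have h1 : ((n % k).toNat : ℤ) = n % k := Int.toNat_of_nonneg (Int.emod_nonneg n hk'.ne')
      have h2 : γ ^ n = γ ^ (n % k) * (γ ^ k) ^ (n / k) := by
        conv_lhs => rw [← Int.emod_add_mul_ediv n k]
        rw [zpow_add, zpow_mul, zpow_natCast]
      rw [h2, Perm.mul_apply, Perm.zpow_apply_eq_self_of_apply_eq_self hkx, ← h1, zpow_natCast,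
        h1]

theorem two_mem_cycleType {H : Type*} [Fintype H] [DecidableEq H] {σ : Perm H} {x : H}
    (h1 : σ x ≠ x) (h2 : σ (σ x) = x) : 2 ∈ σ.cycleType := by
  have hx : σ.cycleOf x ∈ σ.cycleFactorsFinset :=
    Perm.cycleOf_mem_cycleFactorsFinset_iff.mpr (Perm.mem_support.mpr h1)
  have hc := Perm.isCycle_cycleOf σ h1
  have hne : σ.cycleOf x x ≠ x := by rwa [Perm.cycleOf_apply_self]
  have hord : orderOf (σ.cycleOf x) = 2 := by
    refine orderOf_eq_prime ?_ hc.ne_one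
    rw [hc.pow_eq_one_iff]
    refine ⟨x, hne, ?_⟩
    rw [Perm.cycleOf_pow_apply_self, pow_two, Perm.mul_apply, h2]
  rw [Perm.cycleType_def, Multiset.mem_map]
  exact ⟨_, hx, by rw [Function.comp_apply, ← hc.orderOf, hord]⟩

theorem exists_of_mem_cycleType {H : Type*} [Fintype H] [DecidableEq H] {σ : Perm H} {d : ℕ}
    (hd : d ∈ σ.cycleType) : 2 ≤ d ∧ ∃ x, σ x ≠ x ∧ (σ ^ d) x = x := by
  refine ⟨Perm.two_le_of_mem_cycleType hd, ?_⟩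
  rw [Perm.cycleType_def, Multiset.mem_map] at hd
  obtain ⟨c, hc, rfl⟩ := hd
  have hcyc := (Perm.mem_cycleFactorsFinset_iff.mp hc).1
  obtain ⟨x, hx, -⟩ := id hcyc
  have hxc := Perm.mem_support.mpr hx
  have hcx : c = σ.cycleOf x := Perm.cycle_is_cycleOf hxc hc
  refine ⟨x, ?_, ?_⟩
  · rw [hcx, Perm.cycleOf_apply_self] at hx
    exact hx
  · rw [Function.comp_apply, ← hcyc.orderOf]
    conv_lhs => rw [hcx, ← Perm.cycleOf_pow_apply_self, pow_orderOf_eq_one, Perm.one_apply]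

theorem card_cycleType_eq_numCycles {H : Type*} [Fintype H] [DecidableEq H] (σ : Perm H) :
    σ.cycleType.card = numCycles σ σ.support := by
  classical
  have h : σ.cycleFactorsFinset = σ.support.image σ.cycleOf := by
    ext c
    rw [Finset.mem_image]
    constructor
    · intro hc
      obtain ⟨x, hx, -⟩ := (Perm.mem_cycleFactorsFinset_iff.mp hc).1
      have hxc := Perm.mem_support.mpr hx
      have hcx : c = σ.cycleOf x := Perm.cycle_is_cycleOf hxc hc
      refine ⟨x, ?_, hcx.symm⟩
      rw [hcx, Perm.cycleOf_apply_self] at hx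
      exact Perm.mem_support.mpr hx
    · rintro ⟨x, hx, rfl⟩
      exact Perm.cycleOf_mem_cycleFactorsFinset_iff.mpr hx
  rw [Perm.cycleType_def, Multiset.card_map, ← Finset.card_def, h, numCycles]
  refine card_image_congr id (fun x hx => hx) (fun x hx => ⟨x, hx, rfl⟩) fun x hx y hy => ?_
  rw [← Perm.sameCycle_iff_cycleOf_eq_of_mem_support hx hy]
  exact setOf_sameCycle_eq_iff.symm

namespace IsLabelling

variable {H : Type} {s : Fin t ↪ Ω} {p : PermPair Ω} {G : RibbonGraph H}
  {leaf : Fin t ⊕ Fin t → H} {solid : Set H} {lab : H → Ω}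
  (L : IsLabelling s p G leaf solid lab)
include L

theorem edge_mem {h : H} (hh : h ∉ solid) : G.edge h ∈ solid := (L.two_sides h).mpr hh

theorem edge_notMem {h : H} (hh : h ∈ solid) : G.edge h ∉ solid := fun h' =>
  (L.two_sides h).mp h' hh

theorem eq_leaf_inl {h : H} (hh : h ∈ solid) {j : Fin t} (hj : lab h = s j) :
    h = leaf (Sum.inl j) :=
  L.inj _ _ (by rw [hj, L.inl]) (by simp [hh, L.inl_mem])

theorem eq_leaf_inr {h : H} (hh : h ∉ solid) {j : Fin t} (hj : p.solid (lab h) = s j) :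
    h = leaf (Sum.inr j) :=
  L.inj _ _ (p.solid.injective (by rw [hj, L.inr])) (by simp [hh, L.inr_notMem])

theorem walk_solid {h : H} (hh : h ∈ solid) (hp : p.solid (lab h) ∈ p.inner) :
    G.walk h ∈ solid ∧ lab (G.walk h) = p.solid (lab h) := by
  have := L.rot_dashed _ (L.edge_notMem hh) (by rwa [L.edge])
  rwa [L.edge] at this

theorem walk_dashed {h : H} (hh : h ∉ solid) (hp : lab h ∈ p.inner) :
    G.walk h ∉ solid ∧ p.dashed (lab (G.walk h)) = lab h := by
  have := L.rot_solid _ (L.edge_mem hh) (by rwa [L.edge])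
  rwa [L.edge] at this

theorem walk_solid_leaf {h : H} (hh : h ∈ solid) {j : Fin t} (hj : p.solid (lab h) = s j) :
    G.walk h = leaf (Sum.inr j) := by
  have : G.edge h = leaf (Sum.inr j) := L.eq_leaf_inr (L.edge_notMem hh) (by rwa [L.edge])
  rw [RibbonGraph.walk, Perm.mul_apply, this, L.rot_leaf]

theorem walk_dashed_leaf {h : H} (hh : h ∉ solid) {j : Fin t} (hj : lab h = s j) :
    G.walk h = leaf (Sum.inl j) := by
  have : G.edge h = leaf (Sum.inl j) := L.eq_leaf_inl (L.edge_mem hh) (by rwa [L.edge])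
  rw [RibbonGraph.walk, Perm.mul_apply, this, L.rot_leaf]

section Diagram

variable {τ : Perm Ω} {τ₀ : Perm (Fin t)} (hp : p.IsDiagram (leafLabels s) τ)
include hp

theorem eq_leaf_of_notMem {h : H} (hh : h ∉ solid) (h' : p.solid (lab h) ∉ p.inner) :
    ∃ j, h = leaf (Sum.inr j) := by
  obtain ⟨j, hj⟩ := mem_leafLabels.mp ((hp.solid.apply_mem (L.mem h)).resolve_right h')
  exact ⟨j, L.eq_leaf_inr hh hj.symm⟩

omit hp in
theorem eq_leaf_of_mem {h : H} (hh : h ∈ solid) (h' : lab h ∉ p.inner) :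
    ∃ j, h = leaf (Sum.inl j) := by
  obtain ⟨j, hj⟩ := mem_leafLabels.mp ((L.mem h).resolve_right h')
  exact ⟨j, L.eq_leaf_inl hh hj.symm⟩

theorem inl_notMem_inner (j : Fin t) : lab (leaf (Sum.inl j)) ∉ p.inner := by
  rw [L.inl]
  exact fun h => hp.disj _ h (apply_mem_leafLabels s j)

theorem inr_notMem_inner (j : Fin t) : p.solid (lab (leaf (Sum.inr j))) ∉ p.inner := by
  rw [L.inr]
  exact fun h => hp.disj _ h (apply_mem_leafLabels s j)

omit hp in
theorem leaf_injective : Function.Injective leaf := by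
  rintro (i | i) (j | j) h
  · have := congrArg lab h
    rw [L.inl, L.inl] at this
    rw [s.injective this]
  · exact absurd (h ▸ L.inl_mem i) (L.inr_notMem j)
  · exact absurd (h ▸ L.inl_mem j) (L.inr_notMem i)
  · have := congrArg (fun h => p.solid (lab h)) h
    simp only [L.inr] at this
    rw [s.injective this]

theorem rot_eq_self_iff (h : H) : G.rot h = h ↔ h ∈ Set.range leaf := by
  constructor
  · intro hr
    by_cases hh : h ∈ solid
    · by_cases h' : lab h ∈ p.inner
      · exact absurd hh (hr ▸ (L.rot_solid h hh h').1)
      · obtain ⟨j, hj⟩ := L.eq_leaf_of_mem hh h'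
        exact ⟨_, hj.symm⟩
    · by_cases h' : p.solid (lab h) ∈ p.inner
      · exact absurd (hr ▸ (L.rot_dashed h hh h').1) hh
      · obtain ⟨j, hj⟩ := L.eq_leaf_of_notMem hp hh h'
        exact ⟨_, hj.symm⟩
  · rintro ⟨z, rfl⟩
    exact L.rot_leaf z

theorem lab_mem_inner {h : H} (hh : h ∈ solid) (hr : G.rot h ≠ h) : lab h ∈ p.inner := by
  by_contra h'
  obtain ⟨j, hj⟩ := L.eq_leaf_of_mem hh h'
  exact hr ((L.rot_eq_self_iff hp h).mpr ⟨_, hj.symm⟩)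

theorem solid_lab_mem_inner {h : H} (hh : h ∉ solid) (hr : G.rot h ≠ h) :
    p.solid (lab h) ∈ p.inner := by
  by_contra h'
  obtain ⟨j, hj⟩ := L.eq_leaf_of_notMem hp hh h'
  exact hr ((L.rot_eq_self_iff hp h).mpr ⟨_, hj.symm⟩)

theorem rot_mem_iff {h : H} (hr : G.rot h ≠ h) : G.rot h ∈ solid ↔ h ∉ solid := by
  by_cases hh : h ∈ solid
  · simp [hh, (L.rot_solid h hh (L.lab_mem_inner hp hh hr)).1]
  · simp [hh, (L.rot_dashed h hh (L.solid_lab_mem_inner hp hh hr)).1]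

theorem rot_rot_ne {h : H} (hr : G.rot h ≠ h) : G.rot (G.rot h) ≠ h := by
  have key : ∀ h ∈ solid, G.rot h ≠ h → G.rot (G.rot h) ≠ h := by
    intro h hh hr hrr
    have h1 := L.lab_mem_inner hp hh hr
    obtain ⟨h2, h3⟩ := L.rot_solid h hh h1
    have hr' : G.rot (G.rot h) ≠ G.rot h := fun e => hr (G.rot.injective e)
    obtain ⟨-, h4⟩ := L.rot_dashed _ h2 (L.solid_lab_mem_inner hp h2 hr')
    refine hp.ne _ h1 ?_
    rw [hrr] at h4
    rw [h4, PermPair.vertexPerm_solid, h3, h4]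
  intro hrr
  by_cases hh : h ∈ solid
  · exact key h hh hr hrr
  · have hr' : G.rot (G.rot h) ≠ G.rot h := fun e => hr (G.rot.injective e)
    exact key _ ((L.rot_mem_iff hp hr).mpr hh) hr' (by rw [hrr])

theorem internal_degree [Fintype H] [DecidableEq H] (d : ℕ) (hd : d ∈ G.rot.cycleType) :
    Even d ∧ 2 < d := by
  obtain ⟨h2, x, hx, hdx⟩ := exists_of_mem_cycleType hd
  have hne : ∀ n : ℕ, G.rot ((G.rot ^ n) x) ≠ (G.rot ^ n) x := by
    intro n e
    rw [← Perm.mul_apply, ← pow_succ', pow_succ, Perm.mul_apply] at e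
    exact hx ((G.rot ^ n).injective e)
  have halt : ∀ n : ℕ, ((G.rot ^ n) x ∈ solid ↔ x ∈ solid) ↔ Even n := by
    intro n
    induction n with
    | zero => simp
    | succ n ih =>
      have h3 := L.rot_mem_iff hp (hne n)
      rw [← Perm.mul_apply, ← pow_succ'] at h3
      rw [Nat.even_add_one, ← ih, h3]
      tauto
  refine ⟨(halt d).mp (by rw [hdx]), lt_of_le_of_ne h2 ?_⟩
  rintro rfl
  rw [pow_two, Perm.mul_apply] at hdx
  exact L.rot_rot_ne hp hx hdx

variable (hτ : ∀ j, τ (s j) = s (τ₀ j))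
include hτ

theorem dashed_inr (j : Fin t) : p.dashed (lab (leaf (Sum.inr j))) = s (τ₀ j) := by
  rw [← PermPair.vertexPerm_solid, L.inr, hp.target _ (apply_mem_leafLabels s j), hτ]

omit hτ in
/-- The boundary walk from the leaf `j` follows the cycle of `s j` under `p.solid`. -/
theorem solid_chain (j : Fin t) :
    ∃ k : ℕ, 0 < k ∧ (G.walk ^ k) (leaf (Sum.inl j)) = leaf (Sum.inr j) ∧
      (∀ i, 0 < i → i < k → (G.walk ^ i) (leaf (Sum.inl j)) ∉ Set.range leaf) ∧
      (∀ i, i < k → (G.walk ^ i) (leaf (Sum.inl j)) ∈ solid) ∧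
      ∀ h ∈ solid, p.solid.SameCycle (s j) (lab h) →
        ∃ i < k, (G.walk ^ i) (leaf (Sum.inl j)) = h := by
  obtain ⟨k, h1, h2, h3, h4, h5⟩ := exists_chain hp.solid (w := G.walk) (lab := lab)
    (D := solid) (fun h hh hX => L.walk_solid hh hX) (L.inl_mem j)
    (by rw [L.inl]; exact apply_mem_leafLabels s j)
  refine ⟨k, h1, ?_, ?_, fun i hi => (h3 i hi).1, ?_⟩
  · obtain ⟨h6, h7⟩ := h3 (k - 1) (by omega)
    have h8 : k = k - 1 + 1 := by omega
    rw [h8, pow_succ', Perm.mul_apply]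
    refine L.walk_solid_leaf h6 ?_
    rw [h7, ← Perm.mul_apply, ← pow_succ', ← h8, h2, L.inl]
  · rintro i hi hik ⟨z, hz⟩
    obtain ⟨h6, h7⟩ := h3 i hik
    have h8 := h4 i hi hik
    rw [← h7, ← hz] at h8
    rw [← hz] at h6
    cases z with
    | inl j => exact L.inl_notMem_inner hp j h8
    | inr j => exact L.inr_notMem j h6
  · intro h hh hc
    rw [← L.inl] at hc
    obtain ⟨i, hi, h6⟩ := h5 _ hc
    obtain ⟨h7, h8⟩ := h3 i hi
    exact ⟨i, hi, L.inj _ _ (by rw [h8, h6]) (by simp [h7, hh])⟩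

/-- The boundary walk from the partner of the leaf `j` runs backwards through the cycle of
`s (τ₀ j)` under `p.dashed`. -/
theorem dashed_chain (j : Fin t) :
    ∃ k : ℕ, 0 < k ∧ (G.walk ^ k) (leaf (Sum.inr j)) = leaf (Sum.inl (τ₀ j)) ∧
      (∀ i, 0 < i → i < k → (G.walk ^ i) (leaf (Sum.inr j)) ∉ Set.range leaf) ∧
      (∀ i, i < k → (G.walk ^ i) (leaf (Sum.inr j)) ∈ solidᶜ) ∧
      ∀ h ∉ solid, p.dashed.SameCycle (s (τ₀ j)) (p.dashed (lab h)) →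
        ∃ i < k, (G.walk ^ i) (leaf (Sum.inr j)) = h := by
  have hinr := L.dashed_inr hp hτ
  obtain ⟨k, h1, h2, h3, h4, h5⟩ := exists_chain hp.dashed.inv (w := G.walk)
    (lab := fun h => p.dashed (lab h)) (D := solidᶜ) (fun h hh hX => by
      rw [inv_apply_self'] at hX ⊢
      exact L.walk_dashed hh hX) (L.inr_notMem j)
    (by rw [hinr]; exact apply_mem_leafLabels s _)
  refine ⟨k, h1, ?_, ?_, fun i hi => (h3 i hi).1, ?_⟩
  · obtain ⟨h6, h7⟩ := h3 (k - 1) (by omega)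
    have h8 : k = k - 1 + 1 := by omega
    rw [h8, pow_succ', Perm.mul_apply]
    refine L.walk_dashed_leaf h6 ?_
    rw [← inv_apply_self' p.dashed (lab _), h7, ← Perm.mul_apply, ← pow_succ', ← h8, h2, hinr]
  · rintro i hi hik ⟨z, hz⟩
    obtain ⟨h6, h7⟩ := h3 i hik
    have h8 := h4 i hi hik
    rw [← h7, ← hz] at h8
    rw [← hz] at h6
    cases z with
    | inl j => exact h6 (L.inl_mem j)
    | inr j =>
      rw [hinr] at h8
      exact hp.disj _ h8 (apply_mem_leafLabels s _)
  · intro h hh hc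
    rw [← hinr] at hc
    obtain ⟨i, hi, h6⟩ := h5 _ (Perm.sameCycle_inv.mpr hc)
    obtain ⟨h7, h8⟩ := h3 i hi
    have h9 : (G.walk ^ i) (leaf (Sum.inr j)) ∉ solid := h7
    exact ⟨i, hi, L.inj _ _ (p.dashed.injective (h8.trans h6)) (by simp [h9, hh])⟩

/-- A ribbon graph with marked sides that is described by a pair of permutations is a unitary
diagram. -/
def toUnitaryDiagram [Fintype H] [DecidableEq H] : UnitaryDiagram H τ₀ where
  toRibbonGraph := G
  leaf := leaf
  leaf_injective := L.leaf_injective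
  rot_eq_self_iff := L.rot_eq_self_iff hp
  internal_degree := L.internal_degree hp
  solid := solid
  solid_segment j := by
    obtain ⟨k, h1, h2, h3, h4, -⟩ := L.solid_chain hp j
    exact ⟨⟨_, rfl⟩, ⟨_, rfl⟩, k, h1, h2, h3, h4⟩
  dashed_segment j := by
    obtain ⟨k, h1, h2, h3, h4, -⟩ := L.dashed_chain hp hτ j
    exact ⟨⟨_, rfl⟩, ⟨_, rfl⟩, k, h1, h2, h3, h4⟩
  marked h := by
    have hroot : ∀ {γ : Perm Ω}, Rooted (leafLabels s) p.inner γ → ∀ z,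
        z ∈ leafLabels s ∨ z ∈ p.inner → ∃ j, γ.SameCycle (s j) z := by
      rintro γ hγ z (hz | hz)
      · obtain ⟨j, rfl⟩ := mem_leafLabels.mp hz
        exact ⟨j, Perm.SameCycle.refl _ _⟩
      · obtain ⟨i, hi, hiz⟩ := hγ.root z hz
        obtain ⟨j, rfl⟩ := mem_leafLabels.mp hi
        exact ⟨j, hiz⟩
    by_cases hh : h ∈ solid
    · obtain ⟨j, hj⟩ := hroot hp.solid _ (L.mem h)
      obtain ⟨k, -, -, -, -, h5⟩ := L.solid_chain hp j
      obtain ⟨i, -, hi⟩ := h5 h hh hj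
      exact ⟨_, i, hi⟩
    · obtain ⟨j, hj⟩ := hroot hp.dashed _ (hp.dashed.apply_mem (L.mem h))
      obtain ⟨k, -, -, -, -, h5⟩ := L.dashed_chain hp hτ (τ₀⁻¹ j)
      rw [apply_inv_self'] at h5
      obtain ⟨i, -, hi⟩ := h5 h hh hj
      exact ⟨_, i, hi⟩
  two_sides := L.two_sides

end Diagram

/-- The cycles of `vertexPerm` correspond to the internal vertices. -/
theorem card_cycleType_rot [Fintype H] [DecidableEq H] [DecidableEq Ω] {τ : Perm Ω}
    (hp : p.IsDiagram (leafLabels s) τ) (hτ : ∀ z, z ∉ leafLabels s → τ z = z) :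
    G.rot.cycleType.card = p.numVertices := by
  classical
  rw [card_cycleType_eq_numCycles, PermPair.numVertices]
  -- a dashed half-edge is sent to the next half-edge at the same vertex, which is solid
  let g : H → Ω := fun h => if h ∈ solid then lab h else p.solid (lab h)
  have hg : ∀ h, G.rot h ≠ h → g h ∈ p.inner ∧ ∃ h' ∈ solid, lab h' = g h ∧ G.rot h' ≠ h' ∧
      G.rot.SameCycle h h' := by
    intro h hr
    by_cases hh : h ∈ solid
    · simp only [g, if_pos hh]
      exact ⟨L.lab_mem_inner hp hh hr, h, hh, rfl, hr, Perm.SameCycle.refl _ _⟩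
    · simp only [g, if_neg hh]
      have h1 := L.solid_lab_mem_inner hp hh hr
      obtain ⟨h2, h3⟩ := L.rot_dashed h hh h1
      exact ⟨h1, G.rot h, h2, h3, fun e => hr (G.rot.injective e), sameCycle_self_apply _ _⟩
  have hrot : ∀ h ∈ solid, lab h ∈ p.inner → G.rot h ≠ h := by
    intro h hh h' e
    exact (e ▸ (L.rot_solid h hh h').1) hh
  have hback : ∀ x y, p.vertexPerm.SameCycle x y → x ∈ p.inner → ∀ h ∈ solid, ∀ h' ∈ solid,
      lab h = x → lab h' = y → G.rot.SameCycle h h' := by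
    intro x y hxy
    refine (sameCycle_induction (R := fun x y => (x ∈ p.inner ↔ y ∈ p.inner) ∧
      (x ∈ p.inner → ∀ h ∈ solid, ∀ h' ∈ solid, lab h = x → lab h' = y → G.rot.SameCycle h h'))
      ⟨?_, ?_, ?_⟩ ?_ hxy).2
    · refine fun x => ⟨Iff.rfl, fun _ h hh h' hh' e e' => ?_⟩
      rw [L.inj h h' (e.trans e'.symm) (by simp [hh, hh'])]
    · exact fun hR => ⟨hR.1.symm, fun hy h hh h' hh' e e' =>
        (hR.2 (hR.1.mpr hy) h' hh' h hh e' e).symm⟩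
    · intro x y z h1 h2
      refine ⟨h1.1.trans h2.1, fun hx h hh h' hh' e e' => ?_⟩
      obtain ⟨h'', hh'', e''⟩ := L.surj y (Or.inr (h1.1.mp hx))
      exact (h1.2 hx h hh h'' hh'' e e'').trans (h2.2 (h1.1.mp hx) h'' hh'' h' hh' e'' e')
    · intro x
      refine ⟨⟨fun hx => hp.vertexPerm_mem_inner hτ hx, fun hx => ?_⟩, ?_⟩
      · by_contra hc
        have h1 : p.vertexPerm x ∉ p.inner := by
          by_cases hT : x ∈ leafLabels s
          · rw [hp.target x hT]
            exact fun h => hp.disj _ h (apply_mem_of_fixes hτ hT)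
          · have := PermPair.vertexPerm_solid p x
            rw [hp.solid.fixed x hT hc, hp.dashed.fixed x hT hc] at this
            rwa [this]
        exact h1 hx
      · intro hx h hh h' hh' e e'
        -- two steps of the rotation lead from `h'` to `h`
        have h1 := hp.vertexPerm_mem_inner hτ hx
        rw [← e'] at h1
        obtain ⟨h2, h3⟩ := L.rot_solid h' hh' h1
        have h4 : p.solid (lab (G.rot h')) = x := by
          refine p.vertexPerm.injective ?_
          rw [PermPair.vertexPerm_solid, h3, e']
        obtain ⟨h5, h6⟩ := L.rot_dashed _ h2 (h4 ▸ hx)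
        have h7 : G.rot (G.rot h') = h :=
          L.inj _ _ (by rw [h6, h4, e]) (by simp [h5, hh])
        rw [← h7]
        exact ((sameCycle_self_apply G.rot h').trans (sameCycle_self_apply G.rot _)).symm
  refine numCycles_congr g (fun h hh => (hg h (Perm.mem_support.mp hh)).1) ?_ ?_
  · intro x hx
    obtain ⟨h, hh, rfl⟩ := L.surj x (Or.inr hx)
    refine ⟨h, Perm.mem_support.mpr (hrot h hh hx), ?_⟩
    simp only [g, if_pos hh]
    exact Perm.SameCycle.refl _ _
  · intro h hh h' hh'
    constructor
    · refine SameCycle.map_of_step g fun w => ?_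
      by_cases hw : G.rot w = w
      · rw [hw]
      · by_cases hws : w ∈ solid
        · obtain ⟨h1, h2⟩ := L.rot_solid w hws (L.lab_mem_inner hp hws hw)
          simp only [g, if_pos hws, if_neg h1]
          rw [← h2, ← PermPair.vertexPerm_solid]
          exact (sameCycle_self_apply _ _).symm
        · obtain ⟨h1, h2⟩ := L.rot_dashed w hws (L.solid_lab_mem_inner hp hws hw)
          simp only [g, if_neg hws, if_pos h1, h2]
          exact Perm.SameCycle.refl _ _
    · intro hc
      obtain ⟨h1, h2, h3, h4, h5, h6⟩ := hg h (Perm.mem_support.mp hh)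
      obtain ⟨-, k2, k3, k4, k5, k6⟩ := hg h' (Perm.mem_support.mp hh')
      exact (h6.trans (hback _ _ hc h1 h2 h3 k2 k3 h4 k4)).trans k6.symm

end IsLabelling

end Labelling

/-! ### Every unitary diagram is described by a pair of permutations -/

section Describe

open Equiv

namespace UnitaryDiagram

variable {H : Type} [Fintype H] [DecidableEq H] {t : ℕ} {τ₀ : Perm (Fin t)}

/-- The label of the leaf at which the part of the boundary walk ends that starts at the given
leaf. -/
def nextLeaf (τ₀ : Perm (Fin t)) : Perm (Fin t ⊕ Fin t) :=
  (Equiv.sumComm _ _).trans (Equiv.sumCongr τ₀ (Equiv.refl _))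

variable (d : UnitaryDiagram H τ₀)

theorem exists_segment (z : Fin t ⊕ Fin t) : ∃ k : ℕ, 0 < k ∧
    (d.walk ^ k) (d.leaf z) = d.leaf (nextLeaf τ₀ z) ∧
    (∀ i : ℕ, 0 < i → i < k → (d.walk ^ i) (d.leaf z) ∉ Set.range d.leaf) ∧
    ∀ i : ℕ, i < k → ((d.walk ^ i) (d.leaf z) ∈ d.solid ↔ z.isLeft) := by
  cases z with
  | inl j =>
    obtain ⟨-, -, k, h1, h2, h3, h4⟩ := d.solid_segment j
    exact ⟨k, h1, h2, h3, fun i hi => by simp [h4 i hi]⟩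
  | inr j =>
    obtain ⟨-, -, k, h1, h2, h3, h4⟩ := d.dashed_segment j
    refine ⟨k, h1, h2, h3, fun i hi => ?_⟩
    have := h4 i hi
    simpa using this

/-- The boundary walk, but with every segment closed up: where the segment that starts at the
leaf `z` ends, one returns to the leaf `z`. -/
noncomputable def closedWalk : Perm H :=
  (nextLeaf τ₀)⁻¹.viaEmbedding ⟨d.leaf, d.leaf_injective⟩ * d.walk

theorem closedWalk_of_walk_eq {h : H} {z : Fin t ⊕ Fin t}
    (hz : d.walk h = d.leaf (nextLeaf τ₀ z)) : d.closedWalk h = d.leaf z := by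
  rw [closedWalk, Perm.mul_apply, hz]
  have := Perm.viaEmbedding_apply (nextLeaf τ₀)⁻¹ ⟨d.leaf, d.leaf_injective⟩ (nextLeaf τ₀ z)
  rw [inv_apply_self'] at this
  exact this

theorem closedWalk_of_walk_notMem {h : H} (hz : d.walk h ∉ Set.range d.leaf) :
    d.closedWalk h = d.walk h := by
  rw [closedWalk, Perm.mul_apply]
  exact Perm.viaEmbedding_apply_of_notMem _ _ _ hz

theorem closedWalk_mem_range_iff {h : H} :
    d.closedWalk h ∈ Set.range d.leaf ↔ d.walk h ∈ Set.range d.leaf := by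
  constructor
  · intro hh
    by_contra hc
    rw [d.closedWalk_of_walk_notMem hc] at hh
    exact hc hh
  · rintro ⟨z, hz⟩
    rw [d.closedWalk_of_walk_eq (z := (nextLeaf τ₀)⁻¹ z) (by rw [apply_inv_self', hz])]
    exact ⟨_, rfl⟩

/-- The sides of edges on the segment that starts at the leaf `z`. -/
def segment (z : Fin t ⊕ Fin t) : Set H :=
  {h | ∃ i : ℕ, (d.walk ^ i) (d.leaf z) = h ∧
    ∀ i' : ℕ, 0 < i' → i' ≤ i → (d.walk ^ i') (d.leaf z) ∉ Set.range d.leaf}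

variable {d}

theorem leaf_mem_segment (z : Fin t ⊕ Fin t) : d.leaf z ∈ d.segment z :=
  ⟨0, rfl, fun i hi hi' => by omega⟩

theorem mem_solid_iff_of_mem_segment {z : Fin t ⊕ Fin t} {h : H} (hh : h ∈ d.segment z) :
    h ∈ d.solid ↔ z.isLeft := by
  obtain ⟨i, rfl, hi⟩ := hh
  obtain ⟨k, h1, h2, -, h4⟩ := d.exists_segment z
  refine h4 i ?_
  by_contra! hc
  exact hi k h1 hc ⟨_, h2.symm⟩

theorem walk_mem_segment {z : Fin t ⊕ Fin t} {h : H} (hh : h ∈ d.segment z) :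
    (d.walk h ∈ d.segment z ∧ d.closedWalk h = d.walk h) ∨
      (d.walk h = d.leaf (nextLeaf τ₀ z) ∧ d.closedWalk h = d.leaf z) := by
  obtain ⟨i, rfl, hi⟩ := hh
  obtain ⟨k, h1, h2, h3, -⟩ := d.exists_segment z
  have hik : i < k := by
    by_contra! hc
    exact hi k h1 hc ⟨_, h2.symm⟩
  have e : d.walk ((d.walk ^ i) (d.leaf z)) = (d.walk ^ (i + 1)) (d.leaf z) := by
    rw [pow_succ', Perm.mul_apply]
  rcases eq_or_lt_of_le (Nat.succ_le_of_lt hik) with hk | hk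
  · right
    have h5 : d.walk ((d.walk ^ i) (d.leaf z)) = d.leaf (nextLeaf τ₀ z) := by
      rw [e, ← h2, ← hk]
    exact ⟨h5, d.closedWalk_of_walk_eq h5⟩
  · left
    refine ⟨⟨i + 1, e.symm, fun i' h4 h5 => h3 i' h4 (by omega)⟩, ?_⟩
    exact d.closedWalk_of_walk_notMem (e ▸ h3 (i + 1) (by omega) hk)

theorem closedWalk_mem_segment {z : Fin t ⊕ Fin t} {h : H} (hh : h ∈ d.segment z) :
    d.closedWalk h ∈ d.segment z := by
  rcases walk_mem_segment hh with h1 | h1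
  · rw [h1.2]
    exact h1.1
  · rw [h1.2]
    exact leaf_mem_segment z

theorem exists_mem_segment (h : H) : ∃ z, h ∈ d.segment z := by
  obtain ⟨z, n, rfl⟩ := d.marked h
  induction n with
  | zero => exact ⟨z, leaf_mem_segment z⟩
  | succ n ih =>
    obtain ⟨z', hz'⟩ := ih
    rw [pow_succ', Perm.mul_apply]
    rcases walk_mem_segment hz' with h1 | h1
    · exact ⟨z', h1.1⟩
    · exact ⟨_, h1.1 ▸ leaf_mem_segment _⟩

theorem sameCycle_of_mem_segment {z : Fin t ⊕ Fin t} {h : H} (hh : h ∈ d.segment z) :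
    d.closedWalk.SameCycle (d.leaf z) h := by
  obtain ⟨i, rfl, hi⟩ := hh
  induction i with
  | zero => exact Perm.SameCycle.refl _ _
  | succ i ih =>
    have h1 := ih fun i' h2 h3 => hi i' h2 (by omega)
    refine h1.trans ?_
    have h2 := hi (i + 1) (by omega) le_rfl
    rw [pow_succ', Perm.mul_apply] at h2 ⊢
    rw [← d.closedWalk_of_walk_notMem h2]
    exact sameCycle_self_apply _ _

theorem eq_of_sameCycle_leaf {z z' : Fin t ⊕ Fin t}
    (h : d.closedWalk.SameCycle (d.leaf z) (d.leaf z')) : z = z' := by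
  obtain ⟨n, hn⟩ := h.exists_nat_pow_eq
  have key : ∀ n : ℕ, (d.closedWalk ^ n) (d.leaf z) ∈ d.segment z := by
    intro n
    induction n with
    | zero => exact leaf_mem_segment z
    | succ n ih =>
      rw [pow_succ', Perm.mul_apply]
      exact closedWalk_mem_segment ih
  obtain ⟨i, h1, h2⟩ := hn ▸ key n
  cases i with
  | zero => exact d.leaf_injective h1
  | succ i => exact absurd ⟨z', h1.symm⟩ (h2 (i + 1) (by omega) le_rfl)

theorem closedWalk_mem_solid_iff (h : H) : d.closedWalk h ∈ d.solid ↔ h ∈ d.solid := by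
  obtain ⟨z, hz⟩ := exists_mem_segment (d := d) h
  rw [mem_solid_iff_of_mem_segment hz, mem_solid_iff_of_mem_segment (closedWalk_mem_segment hz)]

theorem leaf_inl_mem (j : Fin t) : d.leaf (Sum.inl j) ∈ d.solid := by
  rw [mem_solid_iff_of_mem_segment (leaf_mem_segment _)]; rfl

theorem leaf_inr_notMem (j : Fin t) : d.leaf (Sum.inr j) ∉ d.solid := by
  rw [mem_solid_iff_of_mem_segment (leaf_mem_segment _)]; simp

theorem rot_leaf (z : Fin t ⊕ Fin t) : d.rot (d.leaf z) = d.leaf z :=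
  (d.rot_eq_self_iff _).mpr ⟨z, rfl⟩

theorem rot_mem_range_iff {h : H} : d.rot h ∈ Set.range d.leaf ↔ h ∈ Set.range d.leaf := by
  constructor
  · rintro ⟨z, hz⟩
    exact ⟨z, d.rot.injective (by rw [rot_leaf, hz])⟩
  · rintro ⟨z, rfl⟩
    exact ⟨z, (rot_leaf z).symm⟩

theorem walk_edge (h : H) : d.walk (d.edge h) = d.rot h := by
  rw [RibbonGraph.walk, Perm.mul_apply, d.edge_edge]

theorem closedWalk_edge_leaf (z : Fin t ⊕ Fin t) :
    d.closedWalk (d.edge (d.leaf (nextLeaf τ₀ z))) = d.leaf z :=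
  d.closedWalk_of_walk_eq (by rw [walk_edge, rot_leaf])

theorem closedWalk_edge_of_notMem {h : H} (hh : h ∉ Set.range d.leaf) :
    d.closedWalk (d.edge h) = d.rot h := by
  rw [d.closedWalk_of_walk_notMem, walk_edge]
  rwa [walk_edge, rot_mem_range_iff]

theorem edge_inv : (d.edge)⁻¹ = d.edge := by
  rw [inv_eq_iff_mul_eq_one]
  exact Equiv.ext d.edge_edge

end UnitaryDiagram

/-- A permutation of `S` is transported along an injective map, and extended by the identity. -/
theorem exists_transport {H Ω : Type*} {S : Set H} {lab : H → Ω} (hlab : Set.InjOn lab S)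
    {γ : Perm H} (hγ : ∀ h, γ h ∈ S ↔ h ∈ S) :
    ∃ γ' : Perm Ω, (∀ h ∈ S, γ' (lab h) = lab (γ h)) ∧ (∀ z, z ∉ lab '' S → γ' z = z) ∧
      ∀ h ∈ S, ∀ h' ∈ S, γ'.SameCycle (lab h) (lab h') ↔ γ.SameCycle h h' := by
  classical
  let emb : S → Ω := fun h => lab h
  have hemb : Function.Injective emb := fun h h' e => Subtype.ext (hlab h.2 h'.2 e)
  have hrange : ∀ z, z ∈ Set.range emb ↔ z ∈ lab '' S := by
    intro z
    simp [emb]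
  refine ⟨(γ.subtypePerm hγ).extendDomain (Equiv.ofInjective emb hemb), ?_, ?_, ?_⟩
  · intro h hh
    exact Perm.extendDomain_apply_image (γ.subtypePerm hγ) (Equiv.ofInjective emb hemb) ⟨h, hh⟩
  · intro z hz
    exact Perm.extendDomain_apply_not_subtype _ _ (by rwa [hrange])
  · intro h hh h' hh'
    have h1 := Perm.sameCycle_extendDomain (g := γ.subtypePerm hγ)
      (f := Equiv.ofInjective emb hemb) (x := ⟨h, hh⟩) (y := ⟨h', hh'⟩)
    rw [Perm.sameCycle_subtypePerm] at h1
    exact h1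

theorem exists_injective_extending {ι H Ω : Type*} [Finite H] [Infinite Ω] {f : ι → H}
    (hf : Function.Injective f) (s : ι ↪ Ω) :
    ∃ lab : H → Ω, Function.Injective lab ∧ ∀ j, lab (f j) = s j := by
  classical
  have := Fintype.ofFinite H
  have := Finite.of_injective f hf
  have := Fintype.ofFinite ι
  let e : H ↪ Ω := (Fintype.equivFin H).toEmbedding.trans
    (Fin.valEmbedding.trans (Infinite.natEmbedding Ω))
  have hef : Function.Injective fun j => e (f j) := e.injective.comp hf
  obtain ⟨π, hπ⟩ := exists_perm_extending (Finset.univ.image fun j => e (f j))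
    (Function.extend (fun j => e (f j)) s id) (by
      intro z hz w hw h
      simp only [Finset.coe_image, Finset.coe_univ, Set.image_univ, Set.mem_range] at hz hw
      obtain ⟨i, rfl⟩ := hz
      obtain ⟨j, rfl⟩ := hw
      rw [hef.extend_apply, hef.extend_apply] at h
      rw [s.injective h])
  refine ⟨fun h => π (e h), π.injective.comp e.injective, fun j => ?_⟩
  have h := hπ (e (f j)) (Finset.mem_image_of_mem (fun j => e (f j)) (Finset.mem_univ j))
  exact h.trans (hef.extend_apply _ _ j)

namespace UnitaryDiagram

variable {H : Type} [Fintype H] [DecidableEq H] {t : ℕ} {τ₀ : Perm (Fin t)}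
  {Ω : Type*} [DecidableEq Ω]

/-- The unitary diagram `d` is described by the pair of permutations `p`. -/
def Describes (s : Fin t ↪ Ω) (d : UnitaryDiagram H τ₀) (p : PermPair Ω) : Prop :=
  ∃ lab, IsLabelling s p d.toRibbonGraph d.leaf d.solid lab

/-- An edge is labelled by way of its solid half. Conjugation with `d.edge` takes the closed-up walk
along the dashed sides to a permutation of the solid halves; as this walk runs against the direction
of the dashed segments, its inverse is the permutation `dashed`. -/
theorem exists_describes [Infinite Ω] (s : Fin t ↪ Ω) {τ : Perm Ω} (hτ : ∀ j, τ (s j) = s (τ₀ j))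
    (d : UnitaryDiagram H τ₀) : ∃ p, p.IsDiagram (leafLabels s) τ ∧ d.Describes s p := by
  classical
  obtain ⟨lab₀, hinj, hs⟩ := exists_injective_extending (f := fun j => d.leaf (Sum.inl j))
    (fun i j h => Sum.inl_injective (d.leaf_injective h)) s
  obtain ⟨α, hα, hαfix, hαcyc⟩ := exists_transport (S := d.solid) hinj.injOn
    (γ := d.closedWalk) closedWalk_mem_solid_iff
  -- `β` is the inverse of the permutation for the dashed sides
  obtain ⟨β, hβ, hβfix, hβcyc⟩ := exists_transport (S := d.solid) hinj.injOn
    (γ := d.edge * d.closedWalk * d.edge⁻¹) (fun h => by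
      rw [edge_inv, Perm.mul_apply, Perm.mul_apply, d.two_sides, closedWalk_mem_solid_iff,
        d.two_sides, not_not])
  let lab : H → Ω := fun h => if h ∈ d.solid then lab₀ h else lab₀ (d.edge h)
  have hlab : ∀ h ∈ d.solid, lab h = lab₀ h := fun h hh => if_pos hh
  have hlab' : ∀ h, h ∉ d.solid → lab h = lab₀ (d.edge h) := fun h hh => if_neg hh
  have hedge : ∀ h, lab (d.edge h) = lab h := by
    intro h
    by_cases hh : h ∈ d.solid
    · rw [hlab h hh, hlab' _ (fun h' => (d.two_sides h).mp h' hh), d.edge_edge]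
    · rw [hlab' h hh, hlab _ ((d.two_sides h).mpr hh)]
  have hα' : ∀ h ∈ d.solid, α (lab h) = lab (d.closedWalk h) := by
    intro h hh
    rw [hlab h hh, hα h hh, hlab _ ((closedWalk_mem_solid_iff h).mpr hh)]
  have hβ' : ∀ h, h ∉ d.solid → β (lab h) = lab (d.closedWalk h) := by
    intro h hh
    rw [hlab' h hh, hβ _ ((d.two_sides h).mpr hh),
      hlab' _ (fun h' => hh ((closedWalk_mem_solid_iff h).mp h')), edge_inv, Perm.mul_apply,
      Perm.mul_apply, d.edge_edge]
  let inner : Finset Ω :=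
    (Finset.univ.filter fun h => h ∈ d.solid ∧ h ∉ Set.range d.leaf).image lab₀
  have hinner : ∀ h ∈ d.solid, lab h ∈ inner ↔ h ∉ Set.range d.leaf := by
    intro h hh
    rw [hlab h hh]
    simp only [inner, Finset.mem_image, Finset.mem_filter, Finset.mem_univ, true_and]
    constructor
    · rintro ⟨h', h1, h2⟩
      rw [← hinj h2]
      exact h1.2
    · exact fun h' => ⟨h, ⟨hh, h'⟩, rfl⟩
  have hinner' : ∀ z ∈ inner, ∃ h ∈ d.solid, h ∉ Set.range d.leaf ∧ lab h = z := by
    intro z hz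
    obtain ⟨h, hh, rfl⟩ := Finset.mem_image.mp hz
    have hh := (Finset.mem_filter.mp hh).2
    exact ⟨h, hh.1, hh.2, hlab h hh.1⟩
  have hleaf : ∀ j, lab (d.leaf (Sum.inl j)) = s j := fun j => by
    rw [hlab _ (leaf_inl_mem j)]
    exact hs j
  have hleafmem : ∀ h ∈ d.solid, h ∈ Set.range d.leaf → ∃ j, h = d.leaf (Sum.inl j) := by
    rintro h hh ⟨j | j, rfl⟩
    · exact ⟨j, rfl⟩
    · exact absurd hh (leaf_inr_notMem j)
  have hmem : ∀ h ∈ d.solid, lab h ∈ leafLabels s ∨ lab h ∈ inner := by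
    intro h hh
    by_cases hl : h ∈ Set.range d.leaf
    · obtain ⟨j, rfl⟩ := hleafmem h hh hl
      rw [hleaf]
      exact Or.inl (apply_mem_leafLabels s j)
    · exact Or.inr ((hinner h hh).mpr hl)
  have himage : ∀ z, z ∉ leafLabels s → z ∉ inner → z ∉ lab₀ '' d.solid := by
    rintro z h1 h2 ⟨h, hh, rfl⟩
    have := hmem h hh
    rw [hlab h hh] at this
    tauto
  have hinr : ∀ j, α (lab (d.leaf (Sum.inr j))) = s j := by
    intro j
    rw [← hedge, hα' _ ((d.two_sides _).mpr (leaf_inr_notMem j)), ← hleaf]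
    exact congrArg lab (closedWalk_edge_leaf (d := d) (Sum.inl j))
  have hinl : ∀ j, β (s (τ₀ j)) = lab (d.leaf (Sum.inr j)) := by
    intro j
    rw [← hleaf, ← hedge, hβ' _ (fun h => (d.two_sides _).mp h (leaf_inl_mem _))]
    exact congrArg lab (closedWalk_edge_leaf (d := d) (Sum.inr j))
  let p : PermPair Ω := ⟨inner, α, β⁻¹⟩
  have hrot_solid : ∀ h ∈ d.solid, lab h ∈ inner →
      d.rot h ∉ d.solid ∧ p.dashed (lab (d.rot h)) = lab h := by
    intro h hh hin
    have h1 := closedWalk_edge_of_notMem ((hinner h hh).mp hin)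
    have h2 : d.edge h ∉ d.solid := fun h' => (d.two_sides h).mp h' hh
    rw [← h1]
    refine ⟨fun h' => h2 ((closedWalk_mem_solid_iff _).mp h'), ?_⟩
    rw [← hβ' _ h2, hedge]
    exact inv_apply_self' _ _
  have hrot_dashed : ∀ h, h ∉ d.solid → p.solid (lab h) ∈ inner →
      d.rot h ∈ d.solid ∧ lab (d.rot h) = p.solid (lab h) := by
    intro h hh hin
    have h2 : d.edge h ∈ d.solid := (d.two_sides h).mpr hh
    have h3 := (closedWalk_mem_solid_iff _).mpr h2
    change α (lab h) ∈ inner at hin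
    change _ ∧ _ = α (lab h)
    rw [← hedge h, hα' _ h2] at hin ⊢
    rw [hinner _ h3, d.closedWalk_mem_range_iff, walk_edge, rot_mem_range_iff] at hin
    rw [closedWalk_edge_of_notMem hin] at h3 ⊢
    exact ⟨h3, rfl⟩
  have hlabinj : ∀ h h', lab h = lab h' → (h ∈ d.solid ↔ h' ∈ d.solid) → h = h' := by
    intro h h' e hiff
    by_cases hh : h ∈ d.solid
    · rw [hlab h hh, hlab h' (hiff.mp hh)] at e
      exact hinj e
    · rw [hlab' h hh, hlab' h' (fun h1 => hh (hiff.mpr h1))] at e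
      exact d.edge.injective (hinj e)
  refine ⟨p, ⟨?_, ⟨?_, ?_, ?_⟩, Rooted.inv (γ := β) ⟨?_, ?_, ?_⟩, ?_, ?_⟩, lab,
    ⟨hlabinj, ?_, ?_, hedge, d.two_sides, rot_leaf, leaf_inl_mem, leaf_inr_notMem, hleaf, hinr,
      hrot_solid, hrot_dashed⟩⟩
  · intro x hx hT
    obtain ⟨h, hh, hl, rfl⟩ := hinner' x hx
    obtain ⟨j, hj⟩ := mem_leafLabels.mp hT
    rw [← hleaf, hlab _ (leaf_inl_mem j), hlab h hh] at hj
    exact hl ⟨_, hinj hj⟩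
  · exact fun z h1 h2 => hαfix z (himage z h1 h2)
  · intro x hx
    obtain ⟨h, hh, hl, rfl⟩ := hinner' x hx
    obtain ⟨z, hz⟩ := exists_mem_segment (d := d) h
    have hz' := (mem_solid_iff_of_mem_segment hz).mp hh
    obtain ⟨j, rfl⟩ := Sum.isLeft_iff.mp hz'
    refine ⟨s j, apply_mem_leafLabels s j, ?_⟩
    rw [← hleaf, hlab h hh, hlab _ (leaf_inl_mem j)]
    exact (hαcyc _ (leaf_inl_mem j) _ hh).mpr (sameCycle_of_mem_segment hz)
  · intro x hx y hy hxy
    obtain ⟨i, rfl⟩ := mem_leafLabels.mp hx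
    obtain ⟨j, rfl⟩ := mem_leafLabels.mp hy
    change α.SameCycle _ _ at hxy
    rw [← hleaf, ← hleaf, hlab _ (leaf_inl_mem i), hlab _ (leaf_inl_mem j),
      hαcyc _ (leaf_inl_mem i) _ (leaf_inl_mem j)] at hxy
    rw [Sum.inl_injective (eq_of_sameCycle_leaf hxy)]
  · exact fun z h1 h2 => hβfix z (himage z h1 h2)
  · intro x hx
    obtain ⟨h, hh, hl, rfl⟩ := hinner' x hx
    have h2 : d.edge h ∉ d.solid := fun h' => (d.two_sides h).mp h' hh
    obtain ⟨z, hz⟩ := exists_mem_segment (d := d) (d.edge h)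
    have hz' := (mem_solid_iff_of_mem_segment hz).not.mp h2
    obtain ⟨j, rfl⟩ : ∃ j, z = Sum.inr j := by
      cases z with
      | inl j => simp at hz'
      | inr j => exact ⟨j, rfl⟩
    refine ⟨s (τ₀ j), apply_mem_leafLabels s _, ?_⟩
    refine (sameCycle_self_apply β _).trans ?_
    rw [hinl, hlab' _ (leaf_inr_notMem j), hlab h hh,
      hβcyc _ ((d.two_sides _).mpr (leaf_inr_notMem j)) _ hh]
    have := (sameCycle_conj_iff (g := d.edge)).mpr (sameCycle_of_mem_segment hz)
    rwa [d.edge_edge] at this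
  · intro x hx y hy hxy
    obtain ⟨i, rfl⟩ := mem_leafLabels.mp hx
    obtain ⟨j, rfl⟩ := mem_leafLabels.mp hy
    have h3 : ∀ j, β.SameCycle (s j) (lab (d.leaf (Sum.inr (τ₀⁻¹ j)))) := by
      intro j
      rw [← hinl, apply_inv_self']
      exact sameCycle_self_apply β _
    have h4 := ((h3 i).symm.trans hxy).trans (h3 j)
    rw [hlab' _ (leaf_inr_notMem _), hlab' _ (leaf_inr_notMem _),
      hβcyc _ ((d.two_sides _).mpr (leaf_inr_notMem _)) _
        ((d.two_sides _).mpr (leaf_inr_notMem _)), sameCycle_conj_iff] at h4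
    have h5 := Sum.inr_injective (eq_of_sameCycle_leaf h4)
    rw [τ₀⁻¹.injective h5]
  · intro x hx
    obtain ⟨j, rfl⟩ := mem_leafLabels.mp hx
    have h1 : p.solid (lab (d.leaf (Sum.inr j))) = s j := hinr j
    rw [hτ, ← h1, PermPair.vertexPerm_solid]
    change β⁻¹ _ = _
    rw [Perm.inv_eq_iff_eq, hinl]
  · intro x hx hfix
    obtain ⟨h, hh, hl, rfl⟩ := hinner' x hx
    obtain ⟨h1, h2⟩ := hrot_solid h hh hx
    have h3 : p.solid (lab (d.rot h)) = lab h := by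
      refine p.vertexPerm.injective ?_
      rw [PermPair.vertexPerm_solid, h2, hfix]
    obtain ⟨h4, h5⟩ := hrot_dashed _ h1 (h3 ▸ hx)
    have h6 : d.rot (d.rot h) = h := hlabinj _ _ (h5.trans h3) (by simp [h4, hh])
    have h7 : d.rot h ≠ h := fun e => h1 (e.symm ▸ hh)
    exact absurd (d.internal_degree 2 (two_mem_cycleType h7 h6)).2 (lt_irrefl 2)
  · intro h
    by_cases hh : h ∈ d.solid
    · exact hmem h hh
    · rw [← hedge]
      exact hmem _ ((d.two_sides h).mpr hh)
  · rintro z (hz | hz)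
    · obtain ⟨j, rfl⟩ := mem_leafLabels.mp hz
      exact ⟨_, leaf_inl_mem j, hleaf j⟩
    · obtain ⟨h, hh, -, rfl⟩ := hinner' z hz
      exact ⟨h, hh, rfl⟩

/-! ### Every pair of permutations describes a unitary diagram -/

/-- The half-edges are the pairs of an edge and a mark, where `true` stands for the half on the
solid side. An edge `z` starts with its solid half, which is followed by the dashed half of the edge
preceding `z` along the dashed sides; the dashed half of `z` is followed by the solid half of the
edge that succeeds `z` along the solid sides. -/
theorem exists_describes_of_isDiagram (s : Fin t ↪ Ω) {τ : Perm Ω}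
    (hτ : ∀ j, τ (s j) = s (τ₀ j)) {p : PermPair Ω} (hp : p.IsDiagram (leafLabels s) τ)
    (hτ' : ∀ z, z ∉ leafLabels s → τ z = z)
    (hcard : Fintype.card H = 2 * (t + p.inner.card)) :
    ∃ d : UnitaryDiagram H τ₀, d.Describes s p := by
  classical
  let A : Finset Ω := leafLabels s ∪ p.inner
  have hA : ∀ {z}, z ∈ A ↔ z ∈ leafLabels s ∨ z ∈ p.inner := Finset.mem_union
  have hdisj : Disjoint (leafLabels s) p.inner := Finset.disjoint_left.mpr fun z h1 h2 =>
    hp.disj z h2 h1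
  have hAcard : A.card = t + p.inner.card := by
    rw [Finset.card_union_of_disjoint hdisj, leafLabels, Finset.card_map, Finset.card_univ,
      Fintype.card_fin]
  obtain ⟨c⟩ : Nonempty (H ≃ A × Bool) := by
    rw [← Fintype.card_eq, hcard, Fintype.card_prod, Fintype.card_coe, hAcard, Fintype.card_bool,
      mul_comm]
  let next : A → A := fun z => ⟨p.solid z, hA.mpr (hp.solid.apply_mem (hA.mp z.2))⟩
  let prev : A → A := fun z => ⟨p.dashed⁻¹ z, hA.mpr (hp.dashed.inv_apply_mem (hA.mp z.2))⟩
  let rot : A × Bool → A × Bool := fun x =>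
    if x.2 then (if (x.1 : Ω) ∈ p.inner then (prev x.1, false) else x)
    else (if p.solid x.1 ∈ p.inner then (next x.1, true) else x)
  have hrot1 : ∀ z : A, (z : Ω) ∈ p.inner → rot (z, true) = (prev z, false) := fun z hz => by
    simp [rot, hz]
  have hrot2 : ∀ z : A, (z : Ω) ∉ p.inner → rot (z, true) = (z, true) := fun z hz => by
    simp [rot, hz]
  have hrot3 : ∀ z : A, p.solid z ∈ p.inner → rot (z, false) = (next z, true) := fun z hz => by
    simp [rot, hz]
  have hrot4 : ∀ z : A, p.solid z ∉ p.inner → rot (z, false) = (z, false) := fun z hz => by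
    simp [rot, hz]
  have hnext : ∀ z w : A, next z = next w → z = w := fun z w e =>
    Subtype.ext (p.solid.injective (congrArg Subtype.val e))
  have hprev : ∀ z w : A, prev z = prev w → z = w := fun z w e =>
    Subtype.ext (p.dashed⁻¹.injective (congrArg Subtype.val e))
  have h13 : ∀ z w : A, (z : Ω) ∈ p.inner → p.solid w ∉ p.inner → prev z ≠ w := by
    rintro z w hz hw rfl
    obtain h1 := (hp.solid.apply_mem (hA.mp (prev z).2)).resolve_right hw
    have h2 := hp.target _ h1
    rw [PermPair.vertexPerm_solid] at h2
    have h3 : p.dashed (prev z) = z := apply_inv_self' _ _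
    rw [h3] at h2
    exact hp.disj _ hz (h2 ▸ apply_mem_of_fixes hτ' h1)
  have hrot : Function.Injective rot := by
    rintro ⟨z, b⟩ ⟨w, b'⟩ e
    cases b <;> cases b'
    · by_cases hz : p.solid z ∈ p.inner <;> by_cases hw : p.solid w ∈ p.inner <;>
        simp only [hrot3, hrot4, hz, hw, not_false_eq_true, Prod.mk.injEq, Bool.true_eq_false,
          Bool.false_eq_true, and_true, and_false] at e
      · rw [hnext _ _ e]
      · rw [e]
    · by_cases hz : p.solid z ∈ p.inner <;> by_cases hw : (w : Ω) ∈ p.inner <;>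
        simp only [hrot1, hrot2, hrot3, hrot4, hz, hw, not_false_eq_true, Prod.mk.injEq,
          Bool.true_eq_false, Bool.false_eq_true, and_true, and_false] at e
      · exact absurd (e ▸ hz : (w : Ω) ∈ p.inner) hw
      · exact absurd e.symm (h13 w z hw hz)
    · by_cases hz : (z : Ω) ∈ p.inner <;> by_cases hw : p.solid w ∈ p.inner <;>
        simp only [hrot1, hrot2, hrot3, hrot4, hz, hw, not_false_eq_true, Prod.mk.injEq,
          Bool.true_eq_false, Bool.false_eq_true, and_true, and_false] at e
      · exact absurd e (h13 z w hz hw)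
      · exact absurd (e ▸ hw : (z : Ω) ∈ p.inner) hz
    · by_cases hz : (z : Ω) ∈ p.inner <;> by_cases hw : (w : Ω) ∈ p.inner <;>
        simp only [hrot1, hrot2, hz, hw, not_false_eq_true, Prod.mk.injEq, Bool.true_eq_false,
          Bool.false_eq_true, and_true, and_false] at e
      · rw [hprev _ _ e]
      · rw [e]
  let flip : A × Bool ≃ A × Bool := Equiv.prodCongr (Equiv.refl _) Equiv.boolNot
  let G : RibbonGraph H :=
    { edge := (c.trans flip).trans c.symm
      rot := Equiv.ofBijective (fun h => c.symm (rot (c h)))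
        (Finite.injective_iff_bijective.mp (c.symm.injective.comp (hrot.comp c.injective)))
      edge_edge := fun h => by
        change c.symm (flip (c (c.symm (flip (c h))))) = h
        rw [c.apply_symm_apply, Equiv.symm_apply_eq]
        exact Prod.ext rfl (Bool.not_not _)
      edge_ne := fun h e => by
        have := congrArg (fun h => (c h).2) e
        simp [flip] at this }
  let sA : Fin t → A := fun j => ⟨s j, hA.mpr (Or.inl (apply_mem_leafLabels s j))⟩
  let sA' : Fin t → A := fun j => ⟨p.solid⁻¹ (s j), hA.mpr (hp.solid.inv_apply_mem
    (Or.inl (apply_mem_leafLabels s j)))⟩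
  let leaf : Fin t ⊕ Fin t → H := Sum.elim (fun j => c.symm (sA j, true))
    (fun j => c.symm (sA' j, false))
  have hsj : ∀ j, s j ∉ p.inner := fun j h => hp.disj _ h (apply_mem_leafLabels s j)
  have hGrot : ∀ x, G.rot (c.symm x) = c.symm (rot x) := fun x => by
    change c.symm (rot (c (c.symm x))) = _
    rw [c.apply_symm_apply]
  have hform : ∀ h, ∃ x, h = c.symm x := fun h => ⟨c h, (c.symm_apply_apply h).symm⟩
  have L : IsLabelling s p G leaf {h | (c h).2 = true} (fun h => ((c h).1 : Ω)) := by
    refine ⟨?_, ?_, ?_, ?_, ?_, ?_, ?_, ?_, ?_, ?_, ?_, ?_⟩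
    · intro h h' e e'
      refine c.injective (Prod.ext (Subtype.ext e) ?_)
      simp only [Set.mem_ofPred_eq] at e'
      exact Bool.eq_iff_iff.mpr e'
    · exact fun h => hA.mp (c h).1.2
    · intro z hz
      exact ⟨c.symm (⟨z, hA.mpr hz⟩, true), by simp, by simp⟩
    · intro h
      simp [G, flip]
    · intro h
      simp [G, flip]
    · rintro (j | j)
      · change G.rot (c.symm _) = c.symm _
        rw [hGrot, hrot2 _ (hsj j)]
      · change G.rot (c.symm _) = c.symm _
        have : p.solid (sA' j) = s j := apply_inv_self' _ _
        rw [hGrot, hrot4 _ (by rw [this]; exact hsj j)]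
    · intro j
      simp [leaf]
    · intro j
      simp [leaf]
    · intro j
      simp [leaf, sA]
    · intro j
      simp [leaf, sA']
    · intro h hh hin
      obtain ⟨⟨z, b⟩, rfl⟩ := hform h
      simp only [Set.mem_ofPred_eq, Equiv.apply_symm_apply] at hh hin
      subst hh
      rw [hGrot, hrot1 z hin]
      simp [prev]
    · intro h hh hin
      obtain ⟨⟨z, b⟩, rfl⟩ := hform h
      simp only [Set.mem_ofPred_eq, Equiv.apply_symm_apply, Bool.not_eq_true] at hh hin
      subst hh
      rw [hGrot, hrot3 z hin]
      simp [next]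
  exact ⟨L.toUnitaryDiagram hp hτ, _, L⟩

end UnitaryDiagram

end Describe

/-! ### Isomorphic diagrams and isomorphic pairs of permutations -/

section Isomorphisms

open Equiv

variable {Ω : Type*} {t : ℕ}

namespace IsLabelling

variable {H : Type} {s : Fin t ↪ Ω} {p : PermPair Ω} {G : RibbonGraph H}
  {leaf : Fin t ⊕ Fin t → H} {solid : Set H} {lab : H → Ω} {τ : Perm Ω}

theorem lab_mem_inner_iff (L : IsLabelling s p G leaf solid lab)
    (hp : p.IsDiagram (leafLabels s) τ) {h : H} (hh : h ∈ solid) :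
    lab h ∈ p.inner ↔ h ∉ Set.range leaf := by
  constructor
  · rintro h' ⟨z, rfl⟩
    cases z with
    | inl j => exact L.inl_notMem_inner hp j h'
    | inr j => exact L.inr_notMem j hh
  · intro h'
    by_contra hc
    obtain ⟨j, hj⟩ := L.eq_leaf_of_mem hh hc
    exact h' ⟨_, hj.symm⟩

theorem solid_lab_mem_inner_iff (L : IsLabelling s p G leaf solid lab)
    (hp : p.IsDiagram (leafLabels s) τ) {h : H} (hh : h ∉ solid) :
    p.solid (lab h) ∈ p.inner ↔ h ∉ Set.range leaf := by
  constructor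
  · rintro h' ⟨z, rfl⟩
    cases z with
    | inl j => exact hh (L.inl_mem j)
    | inr j => exact L.inr_notMem_inner hp j h'
  · intro h'
    by_contra hc
    obtain ⟨j, hj⟩ := L.eq_leaf_of_notMem hp hh hc
    exact h' ⟨_, hj.symm⟩

/-- Every edge has two halves. -/
theorem card_eq [Fintype H] (L : IsLabelling s p G leaf solid lab)
    (hp : p.IsDiagram (leafLabels s) τ) : Fintype.card H = 2 * (t + p.inner.card) := by
  classical
  have hdisj : Disjoint (leafLabels s) p.inner := Finset.disjoint_left.mpr fun z h1 h2 =>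
    hp.disj z h2 h1
  have hA : (leafLabels s ∪ p.inner).card = t + p.inner.card := by
    rw [Finset.card_union_of_disjoint hdisj, leafLabels, Finset.card_map, Finset.card_univ,
      Fintype.card_fin]
  rw [← hA, ← Fintype.card_coe, ← Fintype.card_bool, mul_comm, ← Fintype.card_prod]
  refine Fintype.card_of_bijective
    (f := fun h => (⟨lab h, Finset.mem_union.mpr (L.mem h)⟩, decide (h ∈ solid))) ⟨?_, ?_⟩
  · intro h h' e
    simp only [Prod.mk.injEq, Subtype.mk.injEq, decide_eq_decide] at e
    exact L.inj h h' e.1 e.2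
  · rintro ⟨⟨z, hz⟩, b⟩
    obtain ⟨h, hh, rfl⟩ := L.surj z (Finset.mem_union.mp hz)
    cases b
    · exact ⟨G.edge h, by simp [L.edge, L.edge_notMem hh]⟩
    · exact ⟨h, by simp [hh]⟩

end IsLabelling

namespace UnitaryDiagram

variable {H : Type} [Fintype H] [DecidableEq H] {τ₀ : Perm (Fin t)} [DecidableEq Ω]
  {s : Fin t ↪ Ω} {τ : Perm Ω} {d d' : UnitaryDiagram H τ₀} {p p' : PermPair Ω}

theorem iso_of_describes (hp : p.IsDiagram (leafLabels s) τ) (h : d.Describes s p)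
    (h' : d'.Describes s p') (hiso : PermPair.Iso (leafLabels s) p p') : d.Iso d' := by
  classical
  obtain ⟨lab, L⟩ := h
  obtain ⟨lab', L'⟩ := h'
  obtain ⟨π, hπ, rfl⟩ := hiso
  have hπs : ∀ j, π (s j) = s j := fun j => hπ _ (apply_mem_leafLabels s j)
  have hex : ∀ h, ∃ h', lab' h' = π (lab h) ∧ (h' ∈ d'.solid ↔ h ∈ d.solid) := by
    intro h
    have hmem : π (lab h) ∈ leafLabels s ∨ π (lab h) ∈ (p.map π).inner := by
      rcases L.mem h with h1 | h1
      · exact Or.inl (by rwa [hπ _ h1])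
      · exact Or.inr (PermPair.mem_map_inner.mpr h1)
    obtain ⟨h', hh', e⟩ := L'.surj _ hmem
    by_cases hh : h ∈ d.solid
    · exact ⟨h', e, by simp [hh, hh']⟩
    · exact ⟨d'.edge h', by rw [L'.edge, e], by simp [hh, L'.edge_notMem hh']⟩
  choose f hf1 hf2 using hex
  have hinj : Function.Injective f := by
    intro h h' e
    refine L.inj _ _ (π.injective ?_) ?_
    · rw [← hf1, ← hf1, e]
    · rw [← hf2, ← hf2, e]
  have hleaf : ∀ z, f (d.leaf z) = d'.leaf z := by
    rintro (j | j)
    · refine L'.eq_leaf_inl ((hf2 _).mpr (L.inl_mem j)) ?_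
      rw [hf1, L.inl, hπs]
    · refine L'.eq_leaf_inr (fun h => L.inr_notMem j ((hf2 _).mp h)) ?_
      rw [hf1, PermPair.map_solid_apply, L.inr, hπs]
  refine ⟨Equiv.ofBijective f (Finite.injective_iff_bijective.mp hinj), fun h => ?_, fun h => ?_,
    hleaf, fun h => (hf2 h).symm⟩
  · change f (d.edge h) = d'.edge (f h)
    refine L'.inj _ _ ?_ ?_
    · rw [hf1, L.edge, L'.edge, hf1]
    · rw [hf2, d.two_sides, d'.two_sides, hf2]
  · change f (d.rot h) = d'.rot (f h)
    by_cases hl : h ∈ Set.range d.leaf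
    · obtain ⟨z, rfl⟩ := hl
      rw [L.rot_leaf, hleaf, L'.rot_leaf]
    · by_cases hh : h ∈ d.solid
      · have h1 := (L.lab_mem_inner_iff hp hh).mpr hl
        obtain ⟨h2, h3⟩ := L.rot_solid h hh h1
        obtain ⟨h4, h5⟩ := L'.rot_solid (f h) ((hf2 h).mpr hh)
          (by rw [hf1]; exact PermPair.mem_map_inner.mpr h1)
        refine L'.inj _ _ ((p.map π).dashed.injective ?_) ?_
        · rw [h5, hf1, hf1, PermPair.map_dashed_apply, h3]
        · rw [hf2]
          simp [h2, h4]
      · have h1 := (L.solid_lab_mem_inner_iff hp hh).mpr hl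
        obtain ⟨h2, h3⟩ := L.rot_dashed h hh h1
        obtain ⟨h4, h5⟩ := L'.rot_dashed (f h) (fun h' => hh ((hf2 h).mp h'))
          (by rw [hf1, PermPair.map_solid_apply]; exact PermPair.mem_map_inner.mpr h1)
        refine L'.inj _ _ ?_ ?_
        · rw [h5, hf1, hf1, PermPair.map_solid_apply, h3]
        · rw [hf2]
          simp [h2, h4]

theorem iso_permPair_of_describes (hτ : ∀ j, τ (s j) = s (τ₀ j))
    (hp : p.IsDiagram (leafLabels s) τ) (hp' : p'.IsDiagram (leafLabels s) τ)
    (h : d.Describes s p) (h' : d'.Describes s p') (hiso : d.Iso d') :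
    PermPair.Iso (leafLabels s) p p' := by
  classical
  obtain ⟨lab, L⟩ := h
  obtain ⟨lab', L'⟩ := h'
  obtain ⟨f, hedge, hrot, hleaf, hsolid⟩ := hiso
  have hex : ∀ z, ∃ w, ∀ h ∈ d.solid, lab h = z → w = lab' (f h) := by
    intro z
    by_cases hz : ∃ h ∈ d.solid, lab h = z
    · obtain ⟨h, hh, rfl⟩ := hz
      exact ⟨lab' (f h), fun h' hh' e => by rw [L.inj h' h e (by simp [hh, hh'])]⟩
    · exact ⟨z, fun h hh e => absurd ⟨h, hh, e⟩ hz⟩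
  choose g hg using hex
  obtain ⟨π, hπ⟩ := exists_perm_extending (leafLabels s ∪ p.inner) g (by
    intro z hz w hw e
    simp only [Finset.coe_union, Set.mem_union, Finset.mem_coe] at hz hw
    obtain ⟨h, hh, rfl⟩ := L.surj z hz
    obtain ⟨h', hh', rfl⟩ := L.surj w hw
    rw [hg _ h hh rfl, hg _ h' hh' rfl] at e
    have := L'.inj _ _ e (by rw [← hsolid, ← hsolid]; simp [hh, hh'])
    rw [f.injective this])
  have hπlab : ∀ h, π (lab h) = lab' (f h) := by
    have key : ∀ h ∈ d.solid, π (lab h) = lab' (f h) := fun h hh => by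
      rw [hπ _ (Finset.mem_union.mpr (L.mem h)), hg _ h hh rfl]
    intro h
    by_cases hh : h ∈ d.solid
    · exact key h hh
    · rw [← L.edge, key _ (L.edge_mem hh), hedge, L'.edge]
  have hπs : ∀ j, π (s j) = s j := fun j => by rw [← L.inl, hπlab, hleaf, L'.inl, L.inl]
  have hrange : ∀ h, f h ∈ Set.range d'.leaf ↔ h ∈ Set.range d.leaf := by
    intro h
    constructor
    · rintro ⟨z, hz⟩
      exact ⟨z, f.injective (by rw [hleaf, hz])⟩
    · rintro ⟨z, rfl⟩
      exact ⟨z, (hleaf z).symm⟩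
  have hinner : ∀ h ∈ d.solid, π (lab h) ∈ p'.inner ↔ lab h ∈ p.inner := by
    intro h hh
    rw [hπlab, L'.lab_mem_inner_iff hp' ((hsolid h).mp hh), L.lab_mem_inner_iff hp hh, hrange]
  have himage : p.inner.image π = p'.inner := by
    ext z
    rw [Finset.mem_image]
    constructor
    · rintro ⟨x, hx, rfl⟩
      obtain ⟨h, hh, rfl⟩ := L.surj x (Or.inr hx)
      exact (hinner h hh).mpr hx
    · intro hz
      obtain ⟨h', hh', rfl⟩ := L'.surj z (Or.inr hz)
      have hh : f⁻¹ h' ∈ d.solid := (hsolid _).mpr (by rwa [apply_inv_self'])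
      refine ⟨lab (f⁻¹ h'), ?_, by rw [hπlab, apply_inv_self']⟩
      rw [← hinner _ hh, hπlab, apply_inv_self']
      exact hz
  have hout : ∀ x, x ∉ leafLabels s → x ∉ p.inner → π x ∉ leafLabels s ∧ π x ∉ p'.inner := by
    intro x h1 h2
    constructor
    · intro h3
      obtain ⟨j, hj⟩ := mem_leafLabels.mp h3
      rw [← hπs] at hj
      exact h1 (π.injective hj ▸ apply_mem_leafLabels s j)
    · rw [← himage, Finset.mem_image]
      rintro ⟨y, hy, e⟩
      exact h2 (π.injective e ▸ hy)
  have hsol : ∀ x, π (p.solid x) = p'.solid (π x) := by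
    intro x
    by_cases hx : x ∈ leafLabels s ∨ x ∈ p.inner
    · obtain ⟨h₀, hh₀, rfl⟩ := L.surj x hx
      obtain ⟨h, hh, e⟩ : ∃ h, h ∉ d.solid ∧ lab h = lab h₀ :=
        ⟨d.edge h₀, L.edge_notMem hh₀, L.edge _⟩
      have hfh : f h ∉ d'.solid := fun h' => hh ((hsolid h).mpr h')
      rw [← e]
      by_cases hl : h ∈ Set.range d.leaf
      · obtain ⟨z, rfl⟩ := hl
        cases z with
        | inl j => exact absurd (L.inl_mem j) hh
        | inr j => rw [L.inr, hπs, hπlab, hleaf, L'.inr]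
      · obtain ⟨-, h2⟩ := L.rot_dashed h hh ((L.solid_lab_mem_inner_iff hp hh).mpr hl)
        obtain ⟨-, h3⟩ := L'.rot_dashed (f h) hfh ((L'.solid_lab_mem_inner_iff hp' hfh).mpr
          (by rwa [hrange]))
        rw [← h2, hπlab, hπlab, hrot, h3]
    · rw [not_or] at hx
      have h1 := hout x hx.1 hx.2
      rw [hp.solid.fixed x hx.1 hx.2, hp'.solid.fixed _ h1.1 h1.2]
  have hdash : ∀ x, π (p.dashed x) = p'.dashed (π x) := by
    intro x
    by_cases hx : x ∈ leafLabels s ∨ x ∈ p.inner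
    · obtain ⟨h, hh, e⟩ := L.surj _ (hp.dashed.apply_mem hx)
      have hfh : f h ∈ d'.solid := (hsolid h).mp hh
      by_cases hl : h ∈ Set.range d.leaf
      · obtain ⟨z, rfl⟩ := hl
        cases z with
        | inr j => exact absurd hh (L.inr_notMem j)
        | inl j =>
          obtain ⟨i, rfl⟩ := τ₀.surjective j
          have h1 : x = lab (d.leaf (Sum.inr i)) := by
            refine p.dashed.injective ?_
            rw [L.dashed_inr hp hτ, ← e, L.inl]
          rw [h1, L.dashed_inr hp hτ, hπs, hπlab, hleaf, L'.dashed_inr hp' hτ]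
      · obtain ⟨-, h2⟩ := L.rot_solid h hh ((L.lab_mem_inner_iff hp hh).mpr hl)
        obtain ⟨-, h3⟩ := L'.rot_solid (f h) hfh ((L'.lab_mem_inner_iff hp' hfh).mpr
          (by rwa [hrange]))
        have h4 : x = lab (d.rot h) := p.dashed.injective (by rw [h2, e])
        rw [h4, h2, hπlab, hπlab, hrot, h3]
    · rw [not_or] at hx
      have h1 := hout x hx.1 hx.2
      rw [hp.dashed.fixed x hx.1 hx.2, hp'.dashed.fixed _ h1.1 h1.2]
  refine ⟨π, fun j hj => ?_, ?_⟩
  · obtain ⟨i, rfl⟩ := mem_leafLabels.mp hj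
    exact hπs i
  · refine PermPair.ext himage (Equiv.ext fun z => ?_) (Equiv.ext fun z => ?_)
    · have := hsol (π⁻¹ z)
      rwa [apply_inv_self'] at this
    · have := hdash (π⁻¹ z)
      rwa [apply_inv_self'] at this

end UnitaryDiagram

/-- Unitary diagrams correspond to pairs of permutations. The number of edges is `t + n` because the
`t` edges at the leaves `1, …, t` are not counted as inner edges. -/
theorem numUnitaryDiagrams_eq [Infinite Ω] [DecidableEq Ω] (s : Fin t ↪ Ω) {τ : Perm Ω}
    {τ₀ : Perm (Fin t)} (hτ : ∀ j, τ (s j) = s (τ₀ j)) (hτ' : ∀ z, z ∉ leafLabels s → τ z = z)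
    (v n : ℕ) :
    numUnitaryDiagrams v (t + n) τ₀ = PermPair.numDiagrams (leafLabels s) τ n v := by
  have hverts : ∀ {d : UnitaryDiagram (Fin (2 * (t + n))) τ₀} {p : PermPair Ω},
      p.IsDiagram (leafLabels s) τ → d.Describes s p →
      d.internalVertices = p.numVertices ∧ p.inner.card = n := by
    rintro d p hp ⟨lab, L⟩
    refine ⟨L.card_cycleType_rot hp hτ', ?_⟩
    have := L.card_eq hp
    rw [Fintype.card_fin] at this
    omega
  refine ncard_classes_eq _ _ (fun d p => p.IsDiagram (leafLabels s) τ ∧ d.Describes s p) ?_ ?_ ?_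
  · intro d hd
    obtain ⟨p, hp, hdp⟩ := d.exists_describes s hτ
    obtain ⟨h1, h2⟩ := hverts hp hdp
    exact ⟨p, ⟨hp, h2, h1.symm.trans hd⟩, hp, hdp⟩
  · rintro p ⟨hp, hn, hv⟩
    obtain ⟨d, hd⟩ := UnitaryDiagram.exists_describes_of_isDiagram
      (H := Fin (2 * (t + n))) s hτ hp hτ' (by rw [Fintype.card_fin, hn])
    exact ⟨d, (hverts hp hd).1.trans hv, hp, hd⟩
  · rintro d - p - d' - p' - ⟨hp, h⟩ ⟨hp', h'⟩
    exact ⟨UnitaryDiagram.iso_permPair_of_describes hτ hp hp' h h',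
      UnitaryDiagram.iso_of_describes hp h h'⟩

theorem numUnitaryDiagrams_eq_zero {τ₀ : Perm (Fin t)} {v e : ℕ} (he : e < t) :
    numUnitaryDiagrams v e τ₀ = 0 := by
  have : IsEmpty (UnitaryDiagram (Fin (2 * e)) τ₀) := by
    refine ⟨fun d => ?_⟩
    have := Fintype.card_le_of_injective _ d.leaf_injective
    simp only [Fintype.card_sum, Fintype.card_fin] at this
    omega
  rw [numUnitaryDiagrams, Set.eq_empty_of_isEmpty {d : UnitaryDiagram (Fin (2 * e)) τ₀ | _},
    Set.image_empty, Set.ncard_empty]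

end Isomorphisms

/-! ### Averages over the unitary group -/

section Averages

open Equiv MeasureTheory

namespace CUE

variable {N : ℕ}

instance isHaarMeasure_haar (N : ℕ) : (haar N).IsHaarMeasure := by
  unfold haar; infer_instance

instance isProbabilityMeasure_haar (N : ℕ) : IsProbabilityMeasure (haar N) :=
  ⟨by
    have h := Measure.haarMeasure_self
      (K₀ := (⊤ : TopologicalSpace.PositiveCompacts (Matrix.unitaryGroup (Fin N) ℂ)))
    simpa [haar] using h⟩

theorem integrable_of_continuous {f : Matrix (Fin N) (Fin N) ℂ → ℂ} (hf : Continuous f) :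
    Integrable (fun U : Matrix.unitaryGroup (Fin N) ℂ => f U) (haar N) :=
  (hf.comp continuous_subtype_val).integrable_of_hasCompactSupport
    (HasCompactSupport.of_compactSpace _)

/-- The average of a function of the matrix. -/
noncomputable def mean (f : Matrix (Fin N) (Fin N) ℂ → ℂ) : ℂ :=
  ∫ U : Matrix.unitaryGroup (Fin N) ℂ, f U ∂(haar N)

theorem mean_congr {f g : Matrix (Fin N) (Fin N) ℂ → ℂ}
    (h : ∀ M ∈ Matrix.unitaryGroup (Fin N) ℂ, f M = g M) : mean f = mean g :=
  integral_congr_ae (Filter.Eventually.of_forall fun U => h U U.2)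

theorem mean_sum {ι : Type*} (S : Finset ι) {f : ι → Matrix (Fin N) (Fin N) ℂ → ℂ}
    (hf : ∀ i ∈ S, Continuous (f i)) : mean (fun M => ∑ i ∈ S, f i M) = ∑ i ∈ S, mean (f i) :=
  integral_finsetSum _ fun i hi => integrable_of_continuous (hf i hi)

theorem mean_const_mul (c : ℂ) (f : Matrix (Fin N) (Fin N) ℂ → ℂ) :
    mean (fun M => c * f M) = c * mean f := integral_const_mul _ _

/-- The average is invariant under unitary reflections `1 - z w wᵀ` that act on the rows. -/
theorem mean_reflection (w : Fin N → ℝ) (z : ℂ)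
    (hz : z + starRingEnd ℂ z = z * starRingEnd ℂ z * ∑ i, (w i : ℂ) * w i)
    (f : Matrix (Fin N) (Fin N) ℂ → ℂ) :
    mean f = mean fun M => f (Matrix.of fun i k => M i k - z * w i * ∑ l, w l * M l k) := by
  set v : Fin N → ℂ := fun i => w i with hv
  set P : Matrix (Fin N) (Fin N) ℂ := Matrix.vecMulVec v v with hP
  have hPP : P * P = (∑ i, v i * v i) • P := by
    ext i k
    simp only [hP, Matrix.mul_apply, Matrix.vecMulVec_apply, Matrix.smul_apply, smul_eq_mul,
      Finset.sum_mul]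
    exact Finset.sum_congr rfl fun l _ => by ring
  have hPs : star P = P := by
    ext i k
    simp [hP, hv, Matrix.vecMulVec_apply, Matrix.star_apply, mul_comm]
  have hR : (1 - z • P) ∈ Matrix.unitaryGroup (Fin N) ℂ := by
    rw [Matrix.mem_unitaryGroup_iff, star_sub, star_one, star_smul, hPs]
    simp only [sub_mul, mul_sub, one_mul, mul_one, smul_mul_assoc, mul_smul_comm, hPP, smul_smul,
      smul_sub]
    have h1 : z • P + star z • P = (star z * (z * ∑ i, v i * v i)) • P := by
      rw [← add_smul, ← mul_assoc, mul_comm (star z)]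
      congr 1
    rw [← h1]
    abel
  have h2 := integral_mul_left_eq_self (μ := haar N)
    (fun U : Matrix.unitaryGroup (Fin N) ℂ => f U) ⟨1 - z • P, hR⟩
  rw [mean, ← h2, mean]
  refine integral_congr_ae (Filter.Eventually.of_forall fun U => ?_)
  change f ((1 - z • P) * (U : Matrix (Fin N) (Fin N) ℂ)) = f _
  congr 1
  ext i k
  rw [sub_mul, one_mul, smul_mul_assoc, Matrix.sub_apply, Matrix.smul_apply, Matrix.mul_apply,
    Matrix.of_apply]
  simp only [hP, Matrix.vecMulVec_apply, hv, smul_eq_mul, Finset.mul_sum]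
  congr 1
  exact Finset.sum_congr rfl fun l _ => by ring

/-- The reflections that act on two rows only. -/
theorem mean_reflection_pair {j t : Fin N} (hjt : j ≠ t) (x y : ℝ) (z : ℂ)
    (hz : z + starRingEnd ℂ z = z * starRingEnd ℂ z * (x * x + y * y))
    (f : Matrix (Fin N) (Fin N) ℂ → ℂ) :
    mean f = mean fun M => f (Matrix.of fun i k =>
      if i = j then M j k - z * x * (x * M j k + y * M t k)
      else if i = t then M t k - z * y * (x * M j k + y * M t k) else M i k) := by
  have hsum : ∀ g : Fin N → ℂ,
      ∑ l, (((Pi.single j x + Pi.single t y : Fin N → ℝ) l : ℝ) : ℂ) * g l =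
      x * g j + y * g t := by
    intro g
    simp only [Pi.add_apply, Complex.ofReal_add, add_mul, Finset.sum_add_distrib]
    congr 1
    · rw [Finset.sum_eq_single j] <;> simp +contextual
    · rw [Finset.sum_eq_single t] <;> simp +contextual
  rw [mean_reflection (Pi.single j x + Pi.single t y) z]
  · congr 1
    funext M
    congr 1
    ext i k
    rw [Matrix.of_apply, Matrix.of_apply, hsum fun l => M l k]
    split_ifs with h1 h2
    · subst h1
      simp [hjt]
    · subst h2
      simp [hjt.symm]
    · simp [h1, h2]
  · rw [hz, hsum]
    simp [hjt, hjt.symm]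

/-- Exchange of two rows. -/
theorem mean_swap_rows (j t : Fin N) (f : Matrix (Fin N) (Fin N) ℂ → ℂ) :
    mean f = mean fun M => f (Matrix.of fun i k => M (swap j t i) k) := by
  by_cases hjt : j = t
  · subst hjt
    simp only [swap_self, refl_apply]
    rfl
  rw [mean_reflection_pair hjt 1 (-1) 1 (by norm_num)]
  congr 1
  funext M
  congr 1
  ext i k
  rw [Matrix.of_apply, Matrix.of_apply, swap_apply_def]
  split_ifs
  · push_cast; ring
  · push_cast; ring
  · rfl

/-- Multiplication of a row by the imaginary unit. -/
theorem mean_phase {j t : Fin N} (hjt : j ≠ t) (f : Matrix (Fin N) (Fin N) ℂ → ℂ) :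
    mean f = mean fun M => f (Matrix.of fun i k => (if i = t then Complex.I else 1) * M i k) := by
  rw [mean_reflection_pair hjt 0 1 (1 - Complex.I) (by
    simp only [map_sub, map_one, Complex.conj_I]
    push_cast
    linear_combination (1 : ℂ) * Complex.I_mul_I)]
  congr 1
  funext M
  congr 1
  ext i k
  rw [Matrix.of_apply, Matrix.of_apply]
  split_ifs with h1 h2 h2
  · exact absurd (h1.symm.trans h2) hjt
  · subst h1
    push_cast; ring
  · subst h2
    push_cast; ring
  · ring

/-- The reflection that mixes two rows with the coefficients `3 / 5` and `4 / 5`. -/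
theorem mean_mix {j t : Fin N} (hjt : j ≠ t) (f : Matrix (Fin N) (Fin N) ℂ → ℂ) :
    mean f = mean fun M => f (Matrix.of fun i k => if i = j then 3 / 5 * M j k + 4 / 5 * M t k
      else if i = t then 4 / 5 * M j k - 3 / 5 * M t k else M i k) := by
  rw [mean_reflection_pair hjt 1 (-2) (2 / 5) (by
    simp only [map_div₀, map_ofNat]
    push_cast
    norm_num)]
  congr 1
  funext M
  congr 1
  ext i k
  rw [Matrix.of_apply, Matrix.of_apply]
  split_ifs
  · push_cast; ring
  · push_cast; ring
  · rfl

/-- If the row `t` is replaced by the row `j` in one matrix element and one conjugate matrix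
element, then the average becomes a sum over the two ways of pairing these matrix elements. By
invariance under phases only the averages in which the conjugate matrix elements have the same rows
as the matrix elements do not vanish, and a rotation of the two rows relates these averages to each
other. -/
theorem mean_coincident_rows {j t : Fin N} (hjt : j ≠ t) {g : Matrix (Fin N) (Fin N) ℂ → ℂ}
    (hg : Continuous g)
    (hrows : ∀ M M' : Matrix (Fin N) (Fin N) ℂ, (∀ i, i ≠ j → i ≠ t → M i = M' i) → g M = g M')
    (a b c d : Fin N) :
    mean (fun M => g M * (M j a * M j b * starRingEnd ℂ (M j c) * starRingEnd ℂ (M j d))) =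
      mean (fun M => g M * (M j a * M t b * starRingEnd ℂ (M j c) * starRingEnd ℂ (M t d))) +
      mean (fun M => g M * (M j a * M t b * starRingEnd ℂ (M t c) * starRingEnd ℂ (M j d))) := by
  let row : Bool → Fin N := fun b => if b then t else j
  let F : Bool × Bool × Bool × Bool → Matrix (Fin N) (Fin N) ℂ → ℂ := fun x M =>
    g M * (M (row x.1) a * M (row x.2.1) b * starRingEnd ℂ (M (row x.2.2.1) c) *
      starRingEnd ℂ (M (row x.2.2.2) d))
  have hF : ∀ x, Continuous (F x) := by
    intro x
    have he : ∀ i k, Continuous fun M : Matrix (Fin N) (Fin N) ℂ => M i k := fun i k =>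
      continuous_id.matrix_elem i k
    exact hg.mul ((((he _ _).mul (he _ _)).mul (Complex.continuous_conj.comp (he _ _))).mul
      (Complex.continuous_conj.comp (he _ _)))
  have hswap : ∀ p q r s, mean (F (p, q, r, s)) = mean (F (!p, !q, !r, !s)) := by
    intro p q r s
    rw [mean_swap_rows j t]
    have hrow : ∀ b, swap j t (row b) = row !b := by
      intro b
      cases b <;> simp [row]
    congr 1
    funext M
    have h1 : g (Matrix.of fun i k => M (swap j t i) k) = g M := hrows _ _ fun i hi hi' => by
      funext k
      rw [Matrix.of_apply, swap_apply_of_ne_of_ne hi hi']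
    simp only [F, h1, Matrix.of_apply, hrow]
  have hphase : ∀ p q r s, mean (F (p, q, r, s)) =
      (bif p then Complex.I else 1) * (bif q then Complex.I else 1) *
      (bif r then -Complex.I else 1) * (bif s then -Complex.I else 1) * mean (F (p, q, r, s)) := by
    intro p q r s
    rw [← mean_const_mul]
    conv_lhs => rw [mean_phase hjt]
    congr 1
    funext M
    have h1 : g (Matrix.of fun i k => (if i = t then Complex.I else 1) * M i k) = g M :=
      hrows _ _ fun i hi hi' => by
        funext k
        rw [Matrix.of_apply, if_neg hi', one_mul]
    have hrow : ∀ b, (if row b = t then Complex.I else 1) = bif b then Complex.I else 1 := by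
      intro b
      cases b <;> simp [row, hjt]
    have hconj : ∀ b, starRingEnd ℂ (bif b then Complex.I else 1) =
        bif b then -Complex.I else 1 := by
      intro b
      cases b <;> simp
    simp only [F, h1, Matrix.of_apply, hrow, map_mul, hconj]
    ring
  have hmix : mean (F (false, false, false, false)) = ∑ x : Bool × Bool × Bool × Bool,
      ((bif x.1 then 4 / 5 else 3 / 5) * (bif x.2.1 then 4 / 5 else 3 / 5) *
        (bif x.2.2.1 then 4 / 5 else 3 / 5) * (bif x.2.2.2 then 4 / 5 else 3 / 5) : ℂ) *
        mean (F x) := by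
    simp only [← mean_const_mul]
    rw [← mean_sum _ fun x _ => (hF x).const_mul _]
    conv_lhs => rw [mean_mix hjt]
    congr 1
    funext M
    have h1 : g (Matrix.of fun i k => if i = j then 3 / 5 * M j k + 4 / 5 * M t k
        else if i = t then 4 / 5 * M j k - 3 / 5 * M t k else M i k) = g M :=
      hrows _ _ fun i hi hi' => by
        funext k
        rw [Matrix.of_apply, if_neg hi, if_neg hi']
    simp only [F, h1, Matrix.of_apply, Fintype.sum_prod_type, Fintype.sum_bool, row]
    simp only [Bool.false_eq_true, if_false, if_true, cond_true, cond_false, map_add, map_mul,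
      map_div₀, map_ofNat]
    ring
  have hI : (1 - Complex.I) ≠ 0 := by
    intro h
    have := congrArg Complex.re h
    simp at this
  have hI' : (1 + Complex.I) ≠ 0 := by
    intro h
    have := congrArg Complex.re h
    simp at this
  have hzero : ∀ {u m : ℂ}, m = u * m → (u = Complex.I ∨ u = -Complex.I ∨ u = -1) → m = 0 := by
    rintro u m h (rfl | rfl | rfl)
    · exact (mul_eq_zero.mp (by linear_combination h : (1 - Complex.I) * m = 0)).resolve_left hI
    · exact (mul_eq_zero.mp (by linear_combination h : (1 + Complex.I) * m = 0)).resolve_left hI'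
    · linear_combination h / 2
  have z1 := hzero (hphase false false false true) (by simp)
  have z2 := hzero (hphase false false true false) (by simp)
  have z3 := hzero (hphase false false true true) (by simp)
  have z4 := hzero (hphase false true false false) (by simp)
  have z5 := hzero (hphase true false false false) (by simp)
  have z6 := hzero (hphase true true false false) (by simp)
  have z7 := hzero (hphase true true true false) (by simp)
  have z8 := hzero (hphase true true false true) (by simp)
  have z9 := hzero (hphase true false true true) (by simp)
  have z10 := hzero (hphase false true true true) (by simp)
  have s1 := hswap true true true true
  have s2 := hswap true false true false
  have s3 := hswap true false false true
  simp only [Bool.not_true, Bool.not_false] at s1 s2 s3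
  simp only [Fintype.sum_prod_type, Fintype.sum_bool, cond_true, cond_false, z1, z2, z3, z4, z5,
    z6, z7, z8, z9, z10, s1, s2, s3] at hmix
  change mean (F (false, false, false, false)) = mean (F (false, true, false, true)) +
    mean (F (false, true, true, false))
  -- `hmix` has the coefficient `1 - (3 / 5) ^ 4 - (4 / 5) ^ 4 = 288 / 625` on one side, and
  -- `2 * (3 / 5) ^ 2 * (4 / 5) ^ 2 = 288 / 625` on the other
  linear_combination (625 / 288 : ℂ) * hmix

/-- The average of the product of the `U k k` and of the conjugates of the `U k (τ⁻¹ k)`, where `k`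
runs through `T`. -/
noncomputable def coeff (T : Finset (Fin N)) (τ : Perm (Fin N)) : ℂ :=
  mean fun M => ∏ k ∈ T, M k k * starRingEnd ℂ (M k (τ⁻¹ k))

theorem continuous_prod_entries (T : Finset (Fin N)) (τ : Perm (Fin N)) :
    Continuous fun M : Matrix (Fin N) (Fin N) ℂ =>
      ∏ k ∈ T, M k k * starRingEnd ℂ (M k (τ⁻¹ k)) :=
  continuous_finsetProd _ fun k _ => (continuous_id.matrix_elem k k).mul
    (Complex.continuous_conj.comp (continuous_id.matrix_elem k (τ⁻¹ k)))

theorem coeff_empty (τ : Perm (Fin N)) : coeff ∅ τ = 1 := by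
  simp [coeff, mean]

/-- The recursion for the class coefficients. The columns of a unitary matrix are orthonormal, so
the row index of `U t t` and of the conjugate of `U t (τ⁻¹ t)` may be summed over. A row `j` that
occurs in the other factors as well contributes two terms, by `mean_coincident_rows`. -/
theorem coeff_recursion {T : Finset (Fin N)} {t : Fin N} (ht : t ∈ T) (τ : Perm (Fin N)) :
    N * coeff T τ + ∑ j ∈ T.erase t, coeff T (swap t j * τ) =
      if τ t = t then coeff (T.erase t) τ else 0 := by
  let f : Fin N → Matrix (Fin N) (Fin N) ℂ → ℂ := fun c M =>
    (∏ k ∈ T.erase t, M k k * starRingEnd ℂ (M k (τ⁻¹ k))) *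
      (M c t * starRingEnd ℂ (M c (τ⁻¹ t)))
  have hf : ∀ c, Continuous (f c) := fun c => (continuous_prod_entries _ τ).mul
    ((continuous_id.matrix_elem c t).mul
      (Complex.continuous_conj.comp (continuous_id.matrix_elem c (τ⁻¹ t))))
  have hft : mean (f t) = coeff T τ := by
    unfold coeff
    congr 1
    funext M
    exact Finset.prod_erase_mul T _ ht
  have hsum : ∑ c, mean (f c) = if τ t = t then coeff (T.erase t) τ else 0 := by
    rw [← mean_sum _ fun c _ => hf c]
    have horth : ∀ M ∈ Matrix.unitaryGroup (Fin N) ℂ,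
        ∑ c, M c t * starRingEnd ℂ (M c (τ⁻¹ t)) = if τ t = t then 1 else 0 := by
      intro M hM
      have h1 := congrFun (congrFun (Matrix.mem_unitaryGroup_iff'.mp hM) (τ⁻¹ t)) t
      rw [Matrix.mul_apply, Matrix.one_apply] at h1
      have h2 : (τ⁻¹ t = t) ↔ (τ t = t) := by
        rw [Perm.inv_eq_iff_eq, eq_comm]
      simp only [h2] at h1
      rw [← h1]
      exact Finset.sum_congr rfl fun c _ => mul_comm _ _
    split_ifs with hτt
    · refine mean_congr fun M hM => ?_
      simp only [f]
      rw [← Finset.mul_sum, horth M hM, if_pos hτt, mul_one]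
    · rw [← mul_zero (0 : ℂ), ← zero_mul (mean fun _ : Matrix (Fin N) (Fin N) ℂ => (0 : ℂ)),
        ← mean_const_mul]
      rw [zero_mul, ← mean_const_mul]
      refine mean_congr fun M hM => ?_
      simp only [f]
      rw [← Finset.mul_sum, horth M hM, if_neg hτt]
      simp
  -- the row `c` may be exchanged with the row `t`, as neither occurs in the other factors
  have hout : ∀ c ∉ T.erase t, mean (f c) = coeff T τ := by
    intro c hc
    rw [← hft, mean_swap_rows c t]
    congr 1
    funext M
    simp only [f, Matrix.of_apply, swap_apply_left]
    congr 1
    refine Finset.prod_congr rfl fun k hk => ?_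
    rw [swap_apply_of_ne_of_ne (ne_of_mem_of_not_mem hk hc) (Finset.ne_of_mem_erase hk)]
  have hin : ∀ j ∈ T.erase t, mean (f j) = coeff T τ + coeff T (swap t j * τ) := by
    intro j hj
    have hjt := Finset.ne_of_mem_erase hj
    have hjT := Finset.mem_of_mem_erase hj
    have hsplit : ∀ σ : Perm (Fin N), ∀ M : Matrix (Fin N) (Fin N) ℂ,
        ∏ k ∈ T, M k k * starRingEnd ℂ (M k (σ⁻¹ k)) =
        (∏ k ∈ (T.erase t).erase j, M k k * starRingEnd ℂ (M k (σ⁻¹ k))) *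
        (M j j * starRingEnd ℂ (M j (σ⁻¹ j))) * (M t t * starRingEnd ℂ (M t (σ⁻¹ t))) := by
      intro σ M
      rw [Finset.prod_erase_mul (T.erase t) _ hj, Finset.prod_erase_mul T _ ht]
    have h := mean_coincident_rows hjt (continuous_prod_entries ((T.erase t).erase j) τ)
      (fun M M' hM => Finset.prod_congr rfl fun k hk => by
        rw [hM k (Finset.ne_of_mem_erase hk)
          (Finset.ne_of_mem_erase (Finset.mem_of_mem_erase hk))]) j t (τ⁻¹ j) (τ⁻¹ t)
    convert h using 1
    · congr 1
      funext M
      simp only [f]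
      rw [← Finset.prod_erase_mul (T.erase t) _ hj]
      ring
    · unfold coeff
      congr 2
      · funext M
        rw [hsplit τ]
        ring
      · funext M
        rw [hsplit (swap t j * τ)]
        have h1 : ∀ k, (swap t j * τ)⁻¹ k = τ⁻¹ (swap t j k) := fun k => by
          rw [mul_inv_rev, swap_inv, Perm.mul_apply]
        have h2 : ∏ k ∈ (T.erase t).erase j, M k k * starRingEnd ℂ (M k ((swap t j * τ)⁻¹ k)) =
            ∏ k ∈ (T.erase t).erase j, M k k * starRingEnd ℂ (M k (τ⁻¹ k)) := by
          refine Finset.prod_congr rfl fun k hk => ?_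
          rw [h1, swap_apply_of_ne_of_ne
            (Finset.ne_of_mem_erase (Finset.mem_of_mem_erase hk)) (Finset.ne_of_mem_erase hk)]
        rw [h2, h1, h1, swap_apply_left, swap_apply_right]
        ring
  rw [← hsum, ← Finset.sum_add_sum_compl (T.erase t), Finset.sum_congr rfl hin,
    Finset.sum_congr rfl fun c hc => hout c (Finset.mem_compl.mp hc), Finset.sum_add_distrib,
    Finset.sum_const, Finset.sum_const, Finset.card_compl, Fintype.card_fin, nsmul_eq_mul,
    nsmul_eq_mul, Nat.cast_sub (by simpa using Finset.card_le_univ (T.erase t))]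
  ring

theorem classCoeff_eq_coeff {t : ℕ} (ht : t ≤ N) {τ₀ : Perm (Fin t)} {τ : Perm (Fin N)}
    (hτ : ∀ j, τ (Fin.castLE ht j) = Fin.castLE ht (τ₀ j)) :
    classCoeff ht τ₀ = coeff (Finset.univ.map (Fin.castLEEmb ht)) τ := by
  have h : ∀ k, τ⁻¹ (Fin.castLE ht k) = Fin.castLE ht (τ₀⁻¹ k) := fun k => by
    rw [Perm.inv_eq_iff_eq, hτ, apply_inv_self']
  unfold classCoeff average coeff mean
  congr 1
  funext U
  beta_reduce
  rw [Finset.prod_map, ← Finset.prod_mul_distrib]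
  refine Finset.prod_congr rfl fun k _ => ?_
  simp only [Fin.castLEEmb_apply, h]

end CUE

end Averages

/-! ### Summation of the expansion -/

section Expansion

open Equiv

/-- If `L` is a contraction, then the solution of `W = D + L W` is the sum of the terms that are
generated order by order from the expansion of `D`. -/
theorem hasSum_of_affine_recursion {V : Type*} [NormedAddCommGroup V] [NormedSpace ℂ V]
    [CompleteSpace V] (L : V →ₗ[ℂ] V) {q : ℝ} (hq : q < 1)
    (hL : ∀ x, ‖L x‖ ≤ q * ‖x‖) {u d : ℕ → V} {D W : V} (h0 : u 0 = d 0)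
    (hs : ∀ r, u (r + 1) = d (r + 1) + L (u r)) (hd : Summable fun r => ‖d r‖) (hD : HasSum d D)
    (hW : W = D + L W) : HasSum u W := by
  have hbound : ∀ n, ∑ r ∈ Finset.range n, ‖u r‖ ≤ (∑' r, ‖d r‖) / (1 - q) := by
    intro n
    rw [le_div_iff₀ (by linarith)]
    have h1 : ∀ n, ∑ r ∈ Finset.range (n + 1), ‖u r‖ ≤
        ∑ r ∈ Finset.range (n + 1), ‖d r‖ + q * ∑ r ∈ Finset.range n, ‖u r‖ := by
      intro n
      rw [Finset.sum_range_succ', Finset.sum_range_succ' _ n, h0, Finset.mul_sum, add_right_comm,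
        ← Finset.sum_add_distrib]
      gcongr with r
      rw [hs]
      exact (norm_add_le _ _).trans (by gcongr; exact hL _)
    have h2 : ∑ r ∈ Finset.range n, ‖u r‖ ≤ ∑ r ∈ Finset.range (n + 1), ‖u r‖ := by
      rw [Finset.sum_range_succ]
      exact le_add_of_nonneg_right (norm_nonneg _)
    have h3 : ∑ r ∈ Finset.range (n + 1), ‖d r‖ ≤ ∑' r, ‖d r‖ :=
      hd.sum_le_tsum _ fun _ _ => norm_nonneg _
    linarith [h1 n]
  have hu : Summable u :=
    (summable_of_sum_range_le (fun _ => norm_nonneg _) hbound).of_norm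
  let L' : V →L[ℂ] V := L.mkContinuous q hL
  have h1 : HasSum (fun r => u (r + 1)) (∑' r, u r - u 0) := by
    simpa using (hasSum_nat_add_iff' 1).mpr hu.hasSum
  have h2 : HasSum (fun r => d (r + 1) + L' (u r)) (D - d 0 + L' (∑' r, u r)) := by
    refine HasSum.add ?_ (L'.hasSum hu.hasSum)
    simpa using (hasSum_nat_add_iff' 1).mpr hD
  have h3 : ∑' r, u r = D + L (∑' r, u r) := by
    have h := h1.unique (h2.congr_fun fun r => (hs r))
    rw [h0] at h
    change _ = D - d 0 + L (∑' r, u r) at h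
    rwa [sub_add_eq_add_sub, sub_left_inj] at h
  have h4 : ‖∑' r, u r - W‖ ≤ q * ‖∑' r, u r - W‖ := by
    conv_lhs => rw [h3, hW, add_sub_add_left_eq_sub, ← map_sub]
    exact hL _
  have h5 : ‖∑' r, u r - W‖ = 0 := by
    nlinarith [norm_nonneg (∑' r, u r - W)]
  rw [← sub_eq_zero.mp (norm_eq_zero.mp h5)]
  exact hu.hasSum

namespace CUE

variable {N : ℕ}

/-- The signed count of the diagrams whose leaves are labelled by elements of `Fin N`. The edges of
the diagrams are drawn from the infinite type `Fin N ⊕ ℕ`. -/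
noncomputable def diagramCoeff (T : Finset (Fin N)) (τ : Perm (Fin N)) (r : ℕ) : ℤ :=
  PermPair.signedCount (T.map Function.Embedding.inl) (sumCongr τ (Equiv.refl ℕ)) r

theorem sumCongr_refl_apply_eq {T : Finset (Fin N)} {τ : Perm (Fin N)}
    (hτ : ∀ k, k ∉ T → τ k = k) (z : Fin N ⊕ ℕ)
    (hz : z ∉ T.map (Function.Embedding.inl : Fin N ↪ Fin N ⊕ ℕ)) :
    sumCongr τ (Equiv.refl ℕ) z = z := by
  cases z with
  | inl k =>
    have : k ∉ T := fun h => hz (Finset.mem_map_of_mem _ h)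
    simp [hτ k this]
  | inr n => rfl

theorem diagramCoeff_empty (τ : Perm (Fin N)) (r : ℕ) :
    diagramCoeff ∅ τ r = if r = 0 then 1 else 0 := by
  rw [diagramCoeff, Finset.map_empty, PermPair.signedCount_empty]

theorem diagramCoeff_zero {T : Finset (Fin N)} {τ : Perm (Fin N)} (hτ : ∀ k, k ∉ T → τ k = k)
    {t : Fin N} (ht : t ∈ T) :
    diagramCoeff T τ 0 = if τ t = t then diagramCoeff (T.erase t) τ 0 else 0 := by
  have h := PermPair.signedCount_zero (sumCongr_refl_apply_eq hτ)
    (Finset.mem_map_of_mem Function.Embedding.inl ht)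
  rw [← Finset.map_erase] at h
  simpa [diagramCoeff] using h

theorem diagramCoeff_succ {T : Finset (Fin N)} {τ : Perm (Fin N)} (hτ : ∀ k, k ∉ T → τ k = k)
    {t : Fin N} (ht : t ∈ T) (r : ℕ) :
    diagramCoeff T τ (r + 1) = (if τ t = t then diagramCoeff (T.erase t) τ (r + 1) else 0) -
      ∑ j ∈ T.erase t, diagramCoeff T (swap t j * τ) r := by
  have h := PermPair.signedCount_succ (sumCongr_refl_apply_eq hτ)
    (Finset.mem_map_of_mem Function.Embedding.inl ht) r
  have hswap : ∀ j, swap (Sum.inl t) (Sum.inl j) * sumCongr τ (Equiv.refl ℕ) =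
      sumCongr (swap t j * τ) (Equiv.refl ℕ) := by
    intro j
    ext z
    cases z <;> simp [Perm.mul_apply, swap_apply_def, apply_ite Sum.inl]
  rw [← Finset.map_erase, Finset.sum_map] at h
  simpa [diagramCoeff, hswap] using h

/-- The recursion for the class coefficients is a linear system whose off-diagonal part has norm at
most `(|T| - 1) / N < 1`. So the signed diagrams form its Neumann series. -/
theorem hasSum_diagramCoeff (T : Finset (Fin N)) {τ : Perm (Fin N)} (hτ : ∀ k, k ∉ T → τ k = k) :
    HasSum (fun r => (diagramCoeff T τ r : ℂ) / (N : ℂ) ^ (T.card + r)) (coeff T τ) := by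
  classical
  induction T using Finset.strongInduction generalizing τ with
  | H T ih =>
  obtain rfl | ⟨t, ht⟩ := T.eq_empty_or_nonempty
  · convert hasSum_ite_eq 0 (1 : ℂ) using 1
    · funext r
      rw [diagramCoeff_empty]
      split_ifs with h <;> simp [h]
    · exact coeff_empty τ
  have hN : (N : ℂ) ≠ 0 := Nat.cast_ne_zero.mpr (Nat.pos_of_ne_zero fun h => by
    subst h; exact t.elim0).ne'
  have hcard : (T.erase t).card < N := by
    have h1 := Finset.card_erase_lt_of_mem ht
    have h2 := Finset.card_le_univ T
    rw [Fintype.card_fin] at h2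
    omega
  let S : Set (Perm (Fin N)) := {σ | ∀ k, k ∉ T → σ k = k}
  have hS : ∀ σ ∈ S, ∀ j ∈ T.erase t, swap t j * σ ∈ S := by
    intro σ hσ j hj k hk
    rw [Perm.mul_apply, hσ k hk, swap_apply_of_ne_of_ne (ne_of_mem_of_not_mem ht hk).symm
      (ne_of_mem_of_not_mem (Finset.mem_of_mem_erase hj) hk).symm]
  let L : (Perm (Fin N) → ℂ) →ₗ[ℂ] (Perm (Fin N) → ℂ) :=
    { toFun := fun f σ => if σ ∈ S then -(∑ j ∈ T.erase t, f (swap t j * σ)) / N else 0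
      map_add' := fun f g => by
        funext σ
        simp only [Pi.add_apply, Finset.sum_add_distrib]
        split_ifs
        · ring
        · ring
      map_smul' := fun c f => by
        funext σ
        simp only [Pi.smul_apply, smul_eq_mul, ← Finset.mul_sum, RingHom.id_apply]
        split_ifs
        · ring
        · ring }
  let d : ℕ → Perm (Fin N) → ℂ := fun r σ => if σ ∈ S ∧ σ t = t then
    (diagramCoeff (T.erase t) σ r : ℂ) / (N : ℂ) ^ ((T.erase t).card + r) / N else 0
  have hd : HasSum d fun σ => if σ ∈ S ∧ σ t = t then coeff (T.erase t) σ / N else 0 := by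
    refine Pi.hasSum.mpr fun σ => ?_
    by_cases h : σ ∈ S ∧ σ t = t
    · simp only [d, if_pos h]
      refine (ih _ (Finset.erase_ssubset ht) fun k hk => ?_).div_const _
      by_cases hkt : k = t
      · rw [hkt, h.2]
      · exact h.1 k fun hkT => hk (Finset.mem_erase.mpr ⟨hkt, hkT⟩)
    · simp only [d, if_neg h]
      exact hasSum_zero
  have hpow : ∀ r, (N : ℂ) ^ (T.card + r) = (N : ℂ) ^ ((T.erase t).card + r) * N := fun r => by
    rw [← Finset.card_erase_add_one ht, add_right_comm, pow_succ]
  have key := hasSum_of_affine_recursion L (q := (T.erase t).card / N)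
    (by rw [div_lt_one (by exact_mod_cast (Nat.zero_le _).trans_lt hcard)]; exact_mod_cast hcard)
    (fun f => by
      refine (pi_norm_le_iff_of_nonneg (by positivity)).mpr fun σ => ?_
      change ‖if σ ∈ S then -(∑ j ∈ T.erase t, f (swap t j * σ)) / N else 0‖ ≤ _
      split_ifs
      · rw [norm_div, norm_neg, Complex.norm_natCast, div_mul_eq_mul_div]
        gcongr
        refine (norm_sum_le_of_le _ fun j _ => norm_le_pi_norm f _).trans ?_
        rw [Finset.sum_const, nsmul_eq_mul]
      · rw [norm_zero]
        positivity)
    (u := fun r σ => if σ ∈ S then (diagramCoeff T σ r : ℂ) / (N : ℂ) ^ (T.card + r) else 0)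
    (d := d) (W := fun σ => if σ ∈ S then coeff T σ else 0) ?_ ?_
    (summable_norm_iff.mpr hd.summable) hd ?_
  · have h := Pi.hasSum.mp key τ
    simpa only [if_pos (show τ ∈ S from hτ)] using h
  · funext σ
    by_cases hσ : σ ∈ S
    · simp only [d, hσ, true_and, if_true, diagramCoeff_zero hσ ht, hpow]
      split_ifs
      · rw [div_div]
      · simp
    · simp [d, hσ]
  · intro r
    funext σ
    by_cases hσ : σ ∈ S
    · change _ = d (r + 1) σ + if σ ∈ S then -(∑ j ∈ T.erase t,
        if swap t j * σ ∈ S then (diagramCoeff T (swap t j * σ) r : ℂ) / (N : ℂ) ^ (T.card + r)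
        else 0) / N else 0
      rw [Finset.sum_congr rfl fun j hj => if_pos (hS σ hσ j hj), ← Finset.sum_div]
      simp only [d, hσ, true_and, if_true, diagramCoeff_succ hσ ht, ← add_assoc, pow_succ]
      rw [hpow]
      push_cast
      split_ifs
      · field_simp
        ring
      · field_simp
        ring
    · have hL : ∀ f, L f σ = 0 := fun f => if_neg hσ
      simp [d, hσ, hL]
  · funext σ
    by_cases hσ : σ ∈ S
    · change _ = (if σ ∈ S ∧ σ t = t then coeff (T.erase t) σ / N else 0) +
        if σ ∈ S then -(∑ j ∈ T.erase t,
          if swap t j * σ ∈ S then coeff T (swap t j * σ) else 0) / N else 0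
      rw [Finset.sum_congr rfl fun j hj => if_pos (hS σ hσ j hj)]
      have h := coeff_recursion ht σ
      simp only [hσ, true_and, if_true]
      split_ifs at h ⊢
      · field_simp
        linear_combination h
      · field_simp
        linear_combination h
    · have hL : ∀ f, L f σ = 0 := fun f => if_neg hσ
      simp [hσ, hL]

end CUE

end Expansion

theorem theorem5p6 {N t : ℕ} (hN : 1 ≤ N) (ht : t ≤ N) (τ : Equiv.Perm (Fin t)) :
    (∀ v e : ℕ, numUnitaryDiagrams v e τ ≠ 0 → v ≤ e) ∧
    (∀ m : ℕ, {v : ℕ | numUnitaryDiagrams v (v + m) τ ≠ 0}.Finite) ∧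
    HasSum (fun m : ℕ => (unitaryOrderCoeff τ m : ℂ) / (N : ℂ) ^ m) (CUE.classCoeff ht τ) := by
  let τ' : Equiv.Perm (Fin N) := τ.viaEmbedding (Fin.castLEEmb ht)
  have h1 : ∀ j, τ' (Fin.castLE ht j) = Fin.castLE ht (τ j) :=
    Equiv.Perm.viaEmbedding_apply τ (Fin.castLEEmb ht)
  let T : Finset (Fin N) := Finset.univ.map (Fin.castLEEmb ht)
  have h2 : ∀ k, k ∉ T → τ' k = k := fun k hk =>
    Equiv.Perm.viaEmbedding_apply_of_notMem τ (Fin.castLEEmb ht) k fun ⟨j, hj⟩ =>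
      hk (Finset.mem_map.mpr ⟨j, Finset.mem_univ j, hj⟩)
  let s : Fin t ↪ Fin N ⊕ ℕ := (Fin.castLEEmb ht).trans Function.Embedding.inl
  have hs : leafLabels s = T.map Function.Embedding.inl := by
    rw [leafLabels, Finset.map_map]
  let σ : Equiv.Perm (Fin N ⊕ ℕ) := Equiv.sumCongr τ' (Equiv.refl ℕ)
  have hσ : ∀ z, z ∉ leafLabels s → σ z = z := by
    rw [hs]
    exact CUE.sumCongr_refl_apply_eq h2
  have hσs : ∀ j, σ (s j) = s (τ j) := fun j => congrArg Sum.inl (h1 j)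
  have hcount : ∀ v n, numUnitaryDiagrams v (t + n) τ =
      PermPair.numDiagrams (leafLabels s) σ n v := numUnitaryDiagrams_eq s hσs hσ
  -- Every internal vertex has degree at least four, so there are `t + 2 * v` edges or more.
  have hedges : ∀ v e, numUnitaryDiagrams v e τ ≠ 0 → t + 2 * v ≤ e := by
    intro v e h
    by_contra! he
    refine h ?_
    by_cases het : e < t
    · exact numUnitaryDiagrams_eq_zero het
    · obtain ⟨n, rfl⟩ := Nat.exists_eq_add_of_le (not_lt.mp het)
      rw [hcount, PermPair.numDiagrams_eq_zero hσ (by omega)]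
  refine ⟨fun v e h => by have := hedges v e h; omega, fun m => ?_, ?_⟩
  · refine (Set.finite_Iic m).subset fun v hv => ?_
    have := hedges v _ hv
    rw [Set.mem_Iic]
    omega
  have hcoeff : ∀ m, unitaryOrderCoeff τ m =
      if t ≤ m then CUE.diagramCoeff T τ' (m - t) else 0 := by
    intro m
    split_ifs with hm
    · obtain ⟨r, rfl⟩ := Nat.exists_eq_add_of_le hm
      rw [unitaryOrderCoeff, finsum_eq_sum_of_support_subset (s := Finset.range (r + 1)),
        Nat.add_sub_cancel_left, CUE.diagramCoeff, ← hs, PermPair.signedCount]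
      · refine Finset.sum_congr rfl fun v _ => ?_
        rw [add_left_comm, hcount, mul_comm]
      · intro v hv
        have h := hedges v (v + (t + r)) fun h => hv (by simp [h])
        rw [Finset.coe_range, Set.mem_Iio]
        omega
    · rw [unitaryOrderCoeff, finsum_eq_zero_of_forall_eq_zero]
      intro v
      have : numUnitaryDiagrams v (v + m) τ = 0 := by
        by_contra h
        have := hedges v _ h
        omega
      rw [this, Nat.cast_zero, zero_mul]
  have hsum := CUE.hasSum_diagramCoeff T h2
  rw [CUE.classCoeff_eq_coeff ht h1, ← hasSum_nat_add_iff' t]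
  rw [Finset.sum_eq_zero, sub_zero]
  · refine hsum.congr_fun fun r => ?_
    rw [hcoeff, if_pos (by omega), Nat.add_sub_cancel, Finset.card_map, Finset.card_univ,
      Fintype.card_fin, add_comm]
  · intro m hm
    rw [hcoeff, if_neg (by simpa using hm), Int.cast_zero, zero_div]
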